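/- **Conventions.** Algebras are unital, associative, over $\mathbb C$. For an algebra $R$ put $\overline R=R/\mathbb C1$, $\Omega^n(R)=R\otimes\overline R^{\otimes n}\ni x_0dx_1\cdots dx_n$, with $\Omega(R)=\bigoplus_n\Omega^n(R)$ the universal differential graded algebra. The $X$-complex $X(R)$ is the two-periodic complex $\natural d:R\rightleftarrows\Omega^1(R)_\natural:\overline b$, where $\Omega^1(R)_\natural=\Omega^1(R)/[R,\Omega^1(R)]$, $\natural d(x)=\natural dx$ and $\overline b(\natural x\,dy)=[x,y]$. For a $\mathbb Z_2$-graded algebra $L=L_+\oplus L_-$ let $L_\natural=L/[L,L]$ (graded commutators), and let $H_-$ of $X(R)\hat\otimes L_\natural$, or of a projective limit of such complexes, be $\operatorname{Ker}(\overline b\otimes\mathrm{Id})/\operatorname{Im}(\natural d\otimes\mathrm{Id})$ at the place $\Omega^1(R)_\natural\otimes L_\natural$. Let $A$ be an algebra, $RA=\bigoplus_k\Omega^{2k}(A)$ with the Fedosov product $\omega_1\circ\omega_2=\omega_1\omega_2-d\omega_1d\omega_2$, $IA$ the kernel of the projection $RA\to A$ to degree $0$, $R_n=RA/IA^{n+1}$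 and $\hat RA=\varprojlim R_n$. Let $g\in A\otimes L_+$ be invertible, and let $g_n\in R_n\otimes L_+$ be its image under $A=\Omega^0(A)\subset RA\to R_n$. Let $D,\theta\in L_-$. Work in $Q_n=\Omega(R_n)\hat\otimes L$ (graded tensor product, differential $d\otimes\mathrm{Id}$) modulo forms of degree $\ge2$ in $\Omega(R_n)$. Put $\theta^g=g_n^{-1}\theta g_n+g_n^{-1}[D,g_n]$, $\omega=g_n^{-1}dg_n$, $\rho_t=D+t(\omega+\theta^g)$, $\nabla_t^2=d\rho_t+\rho_t^2$. The Chern–Simons form is $$cs_n=\natural\otimes\natural\int_0^1\mu_1(t)\,dt\in\Omega^1(R_n)_\natural\otimes L_\natural,\qquad \mu_1(t)=\text{component in }\Omega^1(R_n)\otimes L\text{ of }(\omega+\theta^g)e^{-\nabla_t^2}.$$ *Analytic conventions.* Each $Q_n$ carries a Hausdorff locally convex vector space topology for which multiplication is sequentially continuous, every continuous map $[0,1]\to Q_n$ has a (weak) integral in $Q_n$, the differential and the projections onto $\Omega^1(R_n)\otimes L$ and onto the $L_+$-part are continuous, and the kernel of $\natural\otimes\natural$ (on the component $\Omega^1(R_n)\otimes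 L$) is closed; the maps $Q_{n+1}\to Q_n$ are continuous. Call such topologies admissible. The pair $(D,\theta)$ is exponentiable if for each $n$ the series $e^{-s\nabla_t^2}=\sum_j\frac{(-s)^j}{j!}\nabla_t^{2j}$ converges in $Q_n$ for all $s,t\in[0,1]$ with sum jointly continuous in $(s,t)$. **Statement.** (1) Let $A$, $L$ and $g$ be as above. Every $g_n$ is invertible in $R_n\otimes L$. For admissible topologies and odd $D,\theta$ with $(D,\theta)$ exponentiable, the integrals $\int_0^1\mu_1$ exist, the forms $cs_n$ lie in $\Omega^1(R_n)_\natural\otimes(L_\natural)_+$, they are cycles, $(\overline b\otimes\mathrm{Id})cs_n=0$, and $cs_{n+1}\mapsto cs_n$ under $X(R_{n+1})\hat\otimes L_\natural\to X(R_n)\hat\otimes L_\natural$. Hence they define a class $$cs=\varprojlim cs_n\in H_-\bigl(\varprojlim X(R_n)\hat\otimes L_\natural\bigr),$$ and this class does not depend on $D$ and $\theta$ (nor on the admissible topologies): it is the same for all exponentiable pairs. (2) Let $HP_1(A)=H_-(\varprojlim X(R_n))$ be odd periodic cyclic homology in the Cuntz–Quillen description and $K_1(A)=GL_\infty(A)_{ab}$.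 There is a unique group homomorphism $\mathrm{ch}:K_1(A)\to HP_1(A)$, the Cuntz–Quillen Chern character, such that for every $N$ and every invertible $u\in M_N(\hat RA)$ with image $\bar u\in GL_N(A)$, $\mathrm{ch}[\bar u]$ is the class of the image of $\natural\operatorname{Tr}(u^{-1}du)\in\Omega^1(\hat RA)_\natural$ under $X(\hat RA)\to\varprojlim X(R_n)$. (3) Let $L=L_+=M_N(\mathbb C)$, $L_-=0$ (so $D=\theta=0$), and $g\in GL_N(A)$. Then the map $H_-(\varprojlim X(R_n)\hat\otimes L_\natural)\to HP_1(A)$ induced by $\operatorname{Tr}:L_\natural\to\mathbb C$ (an isomorphism if $N\ge1$) sends $cs$ to $\mathrm{ch}[g]$. -/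

import Mathlib

open Filter Topology
open scoped TensorProduct

universe u v

noncomputable section

namespace BRS



section UniversalForms

variable (A : Type u) [Ring A] [Algebra ℂ A]

/-- The quotient space `Ā = A / ℂ·1`. -/
abbrev Bar : Type u := A ⧸ Submodule.span ℂ {(1 : A)}

/-- The projection `A → Ā`. -/
def toBar : A →ₗ[ℂ] Bar A := (Submodule.span ℂ {(1 : A)}).mkQ

theorem toBar_one : toBar A 1 = 0 :=
  (Submodule.Quotient.mk_eq_zero _).2 (Submodule.mem_span_singleton_self 1)

theorem toBar_surjective : Function.Surjective (toBar A) := Submodule.mkQ_surjective _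

/-- The space of universal (noncommutative) differential forms
`Ω(A) = ⨁ₙ A ⊗ Ā^{⊗n} = A ⊗ T(Ā)`; the tensor `a₀ ⊗ (ā₁ ⋯ āₙ)` is the form `a₀ da₁ ⋯ daₙ`. -/
def Forms : Type u := A ⊗[ℂ] TensorAlgebra ℂ (Bar A)

instance : AddCommGroup (Forms A) :=
  inferInstanceAs (AddCommGroup (A ⊗[ℂ] TensorAlgebra ℂ (Bar A)))

instance : Module ℂ (Forms A) :=
  inferInstanceAs (Module ℂ (A ⊗[ℂ] TensorAlgebra ℂ (Bar A)))

namespace Forms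

variable {A}

/-- The form `a₀ da₁ ⋯ daₙ` for `w = ā₁ ⋯ āₙ`. -/
def mk (a : A) (w : TensorAlgebra ℂ (Bar A)) : Forms A := a ⊗ₜ[ℂ] w

theorem hom_ext {M : Type*} [AddCommGroup M] [Module ℂ M] {f g : Forms A →ₗ[ℂ] M}
    (h : ∀ a w, f (mk a w) = g (mk a w)) : f = g :=
  TensorProduct.ext' h

variable (A)

/-- The differential `d (a₀ da₁ ⋯ daₙ) = da₀ da₁ ⋯ daₙ`. -/
def d : Forms A →ₗ[ℂ] Forms A :=
  TensorProduct.lift ((LinearMap.mul ℂ (TensorAlgebra ℂ (Bar A)) ∘ₗ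
    TensorAlgebra.ι ℂ ∘ₗ toBar A).compr₂ (TensorProduct.mk ℂ A (TensorAlgebra ℂ (Bar A)) 1))

/-- Left multiplication of forms by an element of `A`. -/
def smulL : A →ₗ[ℂ] Module.End ℂ (Forms A) :=
  LinearMap.rTensorHom (TensorAlgebra ℂ (Bar A)) ∘ₗ LinearMap.mul ℂ A

variable {A}

theorem d_mk (a : A) (w) : d A (mk a w) = mk 1 (TensorAlgebra.ι ℂ (toBar A a) * w) := rfl

theorem smulL_mk (a b : A) (w) : smulL A a (mk b w) = mk (a * b) w := rfl

theorem d_d : d A * d A = 0 :=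
  hom_ext fun a w => by
    rw [Module.End.mul_apply, d_mk, d_mk, toBar_one, map_zero, zero_mul]
    exact TensorProduct.tmul_zero _ _

theorem smulL_one : smulL A 1 = 1 := hom_ext fun a w => by simp [smulL_mk]

theorem smulL_mul (a b : A) : smulL A (a * b) = smulL A a * smulL A b :=
  hom_ext fun c w => by simp [smulL_mk, mul_assoc]

/-- Left multiplication of forms by `da`, determined by the Leibniz rule
`da · η = d (a η) - a dη`; it depends only on the class of `a` in `Ā`. -/
def smulD : Bar A →ₗ[ℂ] Module.End ℂ (Forms A) :=
  (Submodule.span ℂ {(1 : A)}).liftQ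
    (LinearMap.mulLeft ℂ (d A) ∘ₗ smulL A - LinearMap.mulRight ℂ (d A) ∘ₗ smulL A)
    (by
      rw [Submodule.span_singleton_le_iff_mem, LinearMap.mem_ker]
      simp [smulL_one])

theorem smulD_toBar (a : A) : smulD (toBar A a) = d A * smulL A a - smulL A a * d A := rfl

/-- Left multiplication of forms by `da₁ ⋯ daₙ`. -/
def smulT : TensorAlgebra ℂ (Bar A) →ₐ[ℂ] Module.End ℂ (Forms A) :=
  TensorAlgebra.lift ℂ smulD

variable (A) in
/-- The product of forms, `(a₀ da₁ ⋯ daₙ) η = a₀ (da₁ (⋯ (daₙ η)))`. -/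
def mulHom : Forms A →ₗ[ℂ] Module.End ℂ (Forms A) :=
  TensorProduct.lift ((LinearMap.mul ℂ (Module.End ℂ (Forms A))).compl₁₂ (smulL A)
    (smulT (A := A)).toLinearMap)

theorem mulHom_mk (a : A) (w) : mulHom A (mk a w) = smulL A a * smulT w := rfl

theorem smulT_ι (a : A) :
    smulT (TensorAlgebra.ι ℂ (toBar A a)) = d A * smulL A a - smulL A a * d A := by
  rw [smulT, TensorAlgebra.lift_ι_apply, smulD_toBar]

theorem mulHom_smulL (a : A) (y : Forms A) : mulHom A (smulL A a y) = smulL A a * mulHom A y := by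
  have : mulHom A ∘ₗ smulL A a = LinearMap.mulLeft ℂ (smulL A a) ∘ₗ mulHom A :=
    hom_ext fun b w => by simp [smulL_mk, mulHom_mk, smulL_mul, mul_assoc]
  exact LinearMap.congr_fun this y

theorem mulHom_smulT (v : TensorAlgebra ℂ (Bar A)) (y : Forms A) :
    mulHom A (smulT v y) = smulT v * mulHom A y := by
  induction v using TensorAlgebra.induction generalizing y with
  | algebraMap r => simp [Algebra.algebraMap_eq_smul_one]
  | ι x =>
    obtain ⟨a, rfl⟩ := toBar_surjective A x
    have : mulHom A ∘ₗ (smulT (TensorAlgebra.ι ℂ (toBar A a))) =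
        LinearMap.mulLeft ℂ (smulT (TensorAlgebra.ι ℂ (toBar A a))) ∘ₗ mulHom A := by
      refine hom_ext fun b w => ?_
      simp only [LinearMap.comp_apply, LinearMap.mulLeft_apply, mulHom_mk, smulT_ι,
        LinearMap.sub_apply, Module.End.mul_apply, smulL_mk, d_mk, map_sub, map_mul,
        smulL_one, smulL_mul]
      noncomm_ring
    exact LinearMap.congr_fun this y
  | mul p q hp hq => simp [hp, hq, mul_assoc]
  | add p q hp hq => simp [hp, hq, add_mul]

theorem mulHom_mulHom (x y : Forms A) : mulHom A (mulHom A x y) = mulHom A x * mulHom A y := by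
  have : ∀ y, mulHom A ∘ₗ (LinearMap.flip (mulHom A) y) =
      LinearMap.mulRight ℂ (mulHom A y) ∘ₗ mulHom A := fun y =>
    hom_ext fun a w => by
      simp [mulHom_mk, mulHom_smulL, mulHom_smulT, mul_assoc]
  exact LinearMap.congr_fun (this y) x

theorem smulT_mk_one (w v : TensorAlgebra ℂ (Bar A)) : smulT w (mk 1 v) = mk 1 (w * v) := by
  induction w using TensorAlgebra.induction generalizing v with
  | algebraMap r =>
    simp only [Algebra.algebraMap_eq_smul_one, map_smul, map_one, LinearMap.smul_apply,
      Module.End.one_apply, smul_mul_assoc, one_mul]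
    exact (TensorProduct.tmul_smul _ _ _).symm
  | ι x =>
    obtain ⟨a, rfl⟩ := toBar_surjective A x
    have h0 : mk (1 : A) (0 : TensorAlgebra ℂ (Bar A)) = 0 := TensorProduct.tmul_zero _ _
    simp [smulT_ι, smulL_mk, d_mk, toBar_one, h0]
  | mul p q hp hq => simp [hp, hq, mul_assoc]
  | add p q hp hq =>
    rw [map_add, LinearMap.add_apply, hp, hq, add_mul]
    exact (TensorProduct.tmul_add _ _ _).symm

instance : One (Forms A) := ⟨mk 1 1⟩
instance : Mul (Forms A) := ⟨fun x y => mulHom A x y⟩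

theorem one_def : (1 : Forms A) = mk 1 1 := rfl
theorem mul_def (x y : Forms A) : x * y = mulHom A x y := rfl

/-- `Ω(A)` is a unital associative algebra. -/
instance : Ring (Forms A) :=
  { (inferInstance : AddCommGroup (Forms A)) with
    mul := (· * ·)
    one := 1
    left_distrib := fun x y z => by simp [mul_def]
    right_distrib := fun x y z => by simp [mul_def]
    zero_mul := fun x => by simp [mul_def]
    mul_zero := fun x => by simp [mul_def]
    mul_assoc := fun x y z => by simp [mul_def, mulHom_mulHom]
    one_mul := fun x => by simp [mul_def, one_def, mulHom_mk, smulL_one]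
    mul_one := fun x => by
      have : LinearMap.flip (mulHom A) 1 = LinearMap.id :=
        hom_ext fun a w => by simp [one_def, mulHom_mk, smulT_mk_one, smulL_mk]
      exact LinearMap.congr_fun this x }

variable (A) in
/-- The space `Ωⁿ(A)` of `n`-forms, spanned by the `a₀ da₁ ⋯ daₙ`. -/
def deg (n : ℕ) : Submodule ℂ (Forms A) :=
  Submodule.span ℂ {x | ∃ a : A, ∃ w ∈ LinearMap.range (TensorAlgebra.ι ℂ (M := Bar A)) ^ n,
    x = mk a w}

variable (A) in
/-- The space `Ω⁺(A) = ⨁ₖ Ω²ᵏ(A)` of forms of even degree. -/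
def even : Submodule ℂ (Forms A) := ⨆ k : ℕ, deg A (2 * k)

theorem mk_mem_deg {n : ℕ} (a : A) {w : TensorAlgebra ℂ (Bar A)}
    (hw : w ∈ LinearMap.range (TensorAlgebra.ι ℂ (M := Bar A)) ^ n) : mk a w ∈ deg A n :=
  Submodule.subset_span ⟨a, w, hw, rfl⟩

theorem d_mem_deg {n : ℕ} {x : Forms A} (hx : x ∈ deg A n) : d A x ∈ deg A (n + 1) := by
  induction hx using Submodule.span_induction with
  | mem x h =>
    obtain ⟨a, w, hw, rfl⟩ := h
    rw [d_mk]
    refine mk_mem_deg _ ?_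
    rw [pow_succ']
    exact Submodule.mul_mem_mul (LinearMap.mem_range_self _ _) hw
  | zero => simp
  | add x y _ _ hx hy => rw [map_add]; exact add_mem hx hy
  | smul c x _ hx => rw [map_smul]; exact Submodule.smul_mem _ _ hx

theorem smulL_mem_deg {n : ℕ} (a : A) {x : Forms A} (hx : x ∈ deg A n) :
    smulL A a x ∈ deg A n := by
  induction hx using Submodule.span_induction with
  | mem x h => obtain ⟨b, w, hw, rfl⟩ := h; exact mk_mem_deg _ hw
  | zero => simp
  | add x y _ _ hx hy => rw [map_add]; exact add_mem hx hy
  | smul c x _ hx => rw [map_smul]; exact Submodule.smul_mem _ _ hx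

theorem smulT_mem_deg {m n : ℕ} {w : TensorAlgebra ℂ (Bar A)}
    (hw : w ∈ LinearMap.range (TensorAlgebra.ι ℂ (M := Bar A)) ^ m) {x : Forms A}
    (hx : x ∈ deg A n) : smulT w x ∈ deg A (m + n) := by
  induction hw using Submodule.pow_induction_on_left' with
  | algebraMap r => simpa [Algebra.algebraMap_eq_smul_one] using Submodule.smul_mem _ r hx
  | add x y i _ _ hx hy => rw [map_add]; exact add_mem hx hy
  | mem_mul b hb i z _ hz =>
    obtain ⟨b, rfl⟩ := hb
    obtain ⟨a, rfl⟩ := toBar_surjective A b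
    rw [map_mul, Module.End.mul_apply, smulT_ι, Nat.succ_eq_add_one, add_right_comm]
    exact sub_mem (d_mem_deg (smulL_mem_deg a hz)) (smulL_mem_deg a (d_mem_deg hz))

theorem mul_mem_deg {m n : ℕ} {x y : Forms A} (hx : x ∈ deg A m) (hy : y ∈ deg A n) :
    x * y ∈ deg A (m + n) := by
  induction hx using Submodule.span_induction with
  | mem x h =>
    obtain ⟨b, w, hw, rfl⟩ := h
    exact smulL_mem_deg b (smulT_mem_deg hw hy)
  | zero => simp
  | add x y _ _ hx hy => rw [add_mul]; exact add_mem hx hy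
  | smul c x _ hx => 
    rw [mul_def, map_smul]; exact Submodule.smul_mem _ _ hx

theorem d_smulT {m : ℕ} {w : TensorAlgebra ℂ (Bar A)}
    (hw : w ∈ LinearMap.range (TensorAlgebra.ι ℂ (M := Bar A)) ^ m) :
    d A * smulT w = (-1 : ℂ) ^ m • (smulT w * d A) := by
  induction hw using Submodule.pow_induction_on_left' with
  | algebraMap r => simp [Algebra.algebraMap_eq_smul_one]
  | add x y i _ _ hx hy => rw [map_add, mul_add, hx, hy, add_mul, smul_add]
  | mem_mul b hb i z _ hz =>
    obtain ⟨b, rfl⟩ := hb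
    obtain ⟨a, rfl⟩ := toBar_surjective A b
    have h1 : d A * smulT (TensorAlgebra.ι ℂ (toBar A a)) =
        -(smulT (TensorAlgebra.ι ℂ (toBar A a)) * d A) := by
      rw [smulT_ι, mul_sub, sub_mul, ← mul_assoc, d_d, mul_assoc _ (d A) (d A), d_d]
      simp [mul_assoc]
    rw [map_mul, ← mul_assoc, h1, neg_mul, mul_assoc, hz, pow_succ, mul_smul_comm]
    simp [mul_assoc]

/-- The graded Leibniz rule. -/
theorem d_mul {m : ℕ} {x : Forms A} (hx : x ∈ deg A m) (y : Forms A) :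
    d A (x * y) = d A x * y + (-1 : ℂ) ^ m • (x * d A y) := by
  induction hx using Submodule.span_induction with
  | mem x h =>
    obtain ⟨b, w, hw, rfl⟩ := h
    have h2 := LinearMap.congr_fun (d_smulT hw) y
    simp only [Module.End.mul_apply, LinearMap.smul_apply] at h2
    simp only [mul_def, mulHom_mk, d_mk, Module.End.mul_apply, smulL_one, map_mul, smulT_ι,
      LinearMap.sub_apply, Module.End.one_apply, h2, map_smul]
    abel
  | zero => simp
  | add x y _ _ hx hy => simp only [add_mul, map_add, hx, hy, smul_add]; abel
  | smul c x _ hx =>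
    simp only [mul_def, map_smul, LinearMap.smul_apply] at hx ⊢
    rw [hx, smul_add, smul_comm]

theorem mul_mem_even {x y : Forms A} (hx : x ∈ even A) (hy : y ∈ even A) : x * y ∈ even A := by
  induction hx using Submodule.iSup_induction' with
  | mem i x hx =>
    induction hy using Submodule.iSup_induction' with
    | mem j y hy =>
      refine Submodule.mem_iSup_of_mem (i + j) ?_
      rw [mul_add]
      exact mul_mem_deg hx hy
    | zero => simp
    | add x y _ _ hx hy => rw [mul_add]; exact add_mem hx hy
  | zero => simp
  | add x y _ _ hx hy => rw [add_mul]; exact add_mem hx hy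

theorem d_mul_d_mem_even {x y : Forms A} (hx : x ∈ even A) (hy : y ∈ even A) :
    d A x * d A y ∈ even A := by
  induction hx using Submodule.iSup_induction' with
  | mem i x hx =>
    induction hy using Submodule.iSup_induction' with
    | mem j y hy =>
      refine Submodule.mem_iSup_of_mem (i + j + 1) ?_
      have h := mul_mem_deg (d_mem_deg hx) (d_mem_deg hy)
      convert h using 2
      ring
    | zero => simp
    | add x y _ _ hx hy => rw [map_add, mul_add]; exact add_mem hx hy
  | zero => simp
  | add x y _ _ hx hy => rw [map_add, add_mul]; exact add_mem hx hy

theorem d_mul_even {x : Forms A} (hx : x ∈ even A) (y : Forms A) :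
    d A (x * y) = d A x * y + x * d A y := by
  induction hx using Submodule.iSup_induction' with
  | mem i x hx => simpa [pow_mul] using d_mul hx y
  | zero => simp
  | add x y _ _ hx hy => simp only [add_mul, map_add, hx, hy]; abel

theorem d_d_apply (x : Forms A) : d A (d A x) = 0 := LinearMap.congr_fun d_d x

theorem d_dmul {x : Forms A} (hx : x ∈ even A) (y : Forms A) :
    d A (d A x * y) = -(d A x * d A y) := by
  induction hx using Submodule.iSup_induction' with
  | mem i x hx =>
    rw [d_mul (d_mem_deg hx), d_d_apply, zero_mul, zero_add, pow_succ, pow_mul]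
    simp
  | zero => simp
  | add x y _ _ hx hy => rw [map_add, add_mul, map_add, hx, hy, add_mul]; abel

theorem d_one : d A (1 : Forms A) = 0 := by
  rw [one_def, d_mk, toBar_one, map_zero, zero_mul]
  exact TensorProduct.tmul_zero _ _

theorem one_mem_even : (1 : Forms A) ∈ even A :=
  Submodule.mem_iSup_of_mem 0 (mk_mem_deg 1 (by simp))

variable (A) in
/-- The projection of a form to its component of degree zero. -/
def aug : Forms A →ₗ[ℂ] A :=
  TensorProduct.rid ℂ A ∘ₗ
    TensorProduct.map LinearMap.id (TensorAlgebra.algebraMapInv (M := Bar A)).toLinearMap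

theorem aug_mk (a : A) (w) : aug A (mk a w) = TensorAlgebra.algebraMapInv w • a := rfl

theorem aug_d (x : Forms A) : aug A (d A x) = 0 := by
  have : aug A ∘ₗ d A = 0 := hom_ext fun a w => by
    simp [d_mk, aug_mk, TensorAlgebra.algebraMapInv]
  exact LinearMap.congr_fun this x

theorem aug_smulL (a : A) (x : Forms A) : aug A (smulL A a x) = a * aug A x := by
  have : aug A ∘ₗ smulL A a = LinearMap.mulLeft ℂ a ∘ₗ aug A := hom_ext fun b w => by
    simp [smulL_mk, aug_mk]
  exact LinearMap.congr_fun this x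

theorem aug_smulT (w) (x : Forms A) :
    aug A (smulT w x) = TensorAlgebra.algebraMapInv w • aug A x := by
  induction w using TensorAlgebra.induction generalizing x with
  | algebraMap r => simp [Algebra.algebraMap_eq_smul_one]
  | ι y =>
    obtain ⟨a, rfl⟩ := toBar_surjective A y
    simp [smulT_ι, aug_d, aug_smulL, TensorAlgebra.algebraMapInv]
  | mul p q hp hq => simp [hp, hq, mul_smul]
  | add p q hp hq => simp [hp, hq, add_smul]

theorem aug_mul (x y : Forms A) : aug A (x * y) = aug A x * aug A y := by
  have : aug A ∘ₗ (LinearMap.flip (mulHom A) y) = LinearMap.mulRight ℂ (aug A y) ∘ₗ aug A :=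
    hom_ext fun b w => by simp [mulHom_mk, aug_mk, aug_smulL, aug_smulT]
  exact LinearMap.congr_fun this x

end Forms

open Forms in
/-- The algebra `RA = Ω⁺(A)` of even forms with the Fedosov product
`ω₁ ∘ ω₂ = ω₁ ω₂ - dω₁ dω₂`. -/
def RA : Type u := Forms.even A

namespace RA

open Forms

variable {A}

instance : AddCommGroup (RA A) := inferInstanceAs (AddCommGroup (Forms.even A))
instance : Module ℂ (RA A) := inferInstanceAs (Module ℂ (Forms.even A))

/-- The even form underlying an element of `RA`. -/
def form (x : RA A) : Forms A := (show Forms.even A from x).1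

theorem form_mem (x : RA A) : form x ∈ Forms.even A := (show Forms.even A from x).2

instance : Mul (RA A) :=
  ⟨fun x y => (⟨form x * form y - d A (form x) * d A (form y),
    sub_mem (mul_mem_even (form_mem x) (form_mem y))
      (d_mul_d_mem_even (form_mem x) (form_mem y))⟩ : Forms.even A)⟩

instance : One (RA A) := ⟨(⟨1, one_mem_even⟩ : Forms.even A)⟩

theorem form_mul (x y : RA A) :
    form (x * y) = form x * form y - d A (form x) * d A (form y) := rfl
theorem form_one : form (1 : RA A) = 1 := rfl
theorem form_add (x y : RA A) : form (x + y) = form x + form y := rfl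
theorem form_smul (c : ℂ) (x : RA A) : form (c • x) = c • form x := rfl
theorem form_zero : form (0 : RA A) = 0 := rfl
theorem form_injective {x y : RA A} (h : form x = form y) : x = y := Subtype.ext h

instance : Ring (RA A) :=
  { (inferInstance : AddCommGroup (RA A)) with
    mul := (· * ·)
    one := 1
    left_distrib := fun x y z => form_injective (by
      simp only [form_mul, form_add, map_add, mul_add]; abel)
    right_distrib := fun x y z => form_injective (by
      simp only [form_mul, form_add, map_add, add_mul]; abel)
    zero_mul := fun x => form_injective (by simp [form_mul, form_zero])
    mul_zero := fun x => form_injective (by simp [form_mul, form_zero])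
    mul_assoc := fun x y z => form_injective (by
      have h1 := d_mul_even (form_mem x) (form y)
      have h2 := d_mul_even (form_mem y) (form z)
      have h3 := d_dmul (form_mem x) (d A (form y))
      have h4 := d_dmul (form_mem y) (d A (form z))
      simp only [form_mul, map_sub, h1, h2, h3, h4, d_d_apply, mul_zero, neg_zero, sub_zero]
      noncomm_ring)
    one_mul := fun x => form_injective (by simp [form_mul, form_one, d_one])
    mul_one := fun x => form_injective (by simp [form_mul, form_one, d_one]) }

instance : Algebra ℂ (RA A) :=
  Algebra.ofModule
    (fun c x y => form_injective (by
      simp only [form_mul, form_smul, map_smul, mul_def, LinearMap.smul_apply, smul_sub]))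
    (fun c x y => form_injective (by
      simp only [form_mul, form_smul, map_smul, mul_def, smul_sub]))

variable (A)

/-- The homomorphism `RA → A` projecting a form to its component of degree zero. -/
def toBase : RA A →ₐ[ℂ] A :=
  AlgHom.ofLinearMap (aug A ∘ₗ (Forms.even A).subtype)
    (by
      change aug A (mk 1 1) = 1
      simp [aug_mk])
    (fun x y => by
      change aug A (form x * form y - d A (form x) * d A (form y)) =
        aug A (form x) * aug A (form y)
      simp [aug_mul, aug_d])

/-- The inclusion of `A = Ω⁰(A)` in `RA`, as a linear map. -/
def incl : A →ₗ[ℂ] RA A :=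
  LinearMap.codRestrict (Forms.even A) ((TensorProduct.mk ℂ A (TensorAlgebra ℂ (Bar A))).flip 1)
    (fun a => Submodule.mem_iSup_of_mem 0 (mk_mem_deg a (by simp)))

end RA

/-- The ideal `IA`, the kernel of `RA → A`. -/
def IA : Ideal (RA A) := RingHom.ker (RA.toBase A)

instance : (IA A).IsTwoSided := inferInstanceAs (RingHom.ker (RA.toBase A)).IsTwoSided

/-- The algebra `R_n = RA / IA^{n+1}`. -/
abbrev Rn (n : ℕ) : Type u := RA A ⧸ IA A ^ (n + 1)

/-- The projection `R_{n+1} → R_n`. -/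
def RnMap (n : ℕ) : Rn A (n + 1) →ₐ[ℂ] Rn A n :=
  Ideal.Quotient.factorₐ ℂ (Ideal.pow_le_pow_right (Nat.le_succ (n + 1)))

end UniversalForms

section XComplex

variable (R : Type u) [Ring R] [Algebra ℂ R]

/-- The space `Ω¹(R) = R ⊗ R̄` of universal one-forms. -/
def OneForms : Type u := R ⊗[ℂ] Bar R

namespace OneForms

instance : AddCommGroup (OneForms R) := inferInstanceAs (AddCommGroup (R ⊗[ℂ] Bar R))
instance : Module ℂ (OneForms R) := inferInstanceAs (Module ℂ (R ⊗[ℂ] Bar R))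

/-- The one-form `x dy`. -/
def mk : R →ₗ[ℂ] R →ₗ[ℂ] OneForms R :=
  (TensorProduct.mk ℂ R (Bar R)).compl₂ (toBar R)

variable {R}

theorem mk_apply (x y : R) : mk R x y = x ⊗ₜ[ℂ] toBar R y := rfl

theorem mk_one (x : R) : mk R x 1 = 0 := by
  rw [mk_apply, toBar_one]; exact TensorProduct.tmul_zero _ _

theorem hom_ext {M : Type*} [AddCommGroup M] [Module ℂ M] {f g : OneForms R →ₗ[ℂ] M}
    (h : ∀ x y, f (mk R x y) = g (mk R x y)) : f = g :=
  TensorProduct.ext' fun x y => by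
    obtain ⟨y, rfl⟩ := toBar_surjective R y
    exact h x y

/-- A bilinear map `(x, y) ↦ F y x` vanishing for `y = 1` defines a linear map on `Ω¹(R)`. -/
def lift {M : Type*} [AddCommGroup M] [Module ℂ M] (F : R →ₗ[ℂ] R →ₗ[ℂ] M) (hF : F 1 = 0) :
    OneForms R →ₗ[ℂ] M :=
  TensorProduct.lift ((Submodule.span ℂ {(1 : R)}).liftQ F
    ((Submodule.span_singleton_le_iff_mem _ _).2 hF)).flip

theorem lift_mk {M : Type*} [AddCommGroup M] [Module ℂ M] (F : R →ₗ[ℂ] R →ₗ[ℂ] M) (hF : F 1 = 0)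
    (x y : R) : lift F hF (mk R x y) = F y x := rfl

/-- The left multiplication `x (y dz) = (x y) dz`. -/
instance : Module R (OneForms R) := inferInstanceAs (Module R (R ⊗[ℂ] Bar R))

theorem smul_mk (z x y : R) : z • mk R x y = mk R (z * x) y := rfl

/-- The right multiplication by `z`, determined by `(x dy) z = x d(y z) - x y dz`. -/
def rmul (z : R) : OneForms R →ₗ[ℂ] OneForms R :=
  lift
    ((mk R).flip ∘ₗ LinearMap.mulRight ℂ z - (LinearMap.mul ℂ R).flip.compr₂ ((mk R).flip z))
    (by ext x; simp)

theorem rmul_mk (z x y : R) : rmul z (mk R x y) = mk R x (y * z) - mk R (x * y) z := rfl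

instance : SMul Rᵐᵒᵖ (OneForms R) := ⟨fun z η => rmul z.unop η⟩

theorem op_smul_def (z : Rᵐᵒᵖ) (η : OneForms R) : z • η = rmul z.unop η := rfl

instance : Module Rᵐᵒᵖ (OneForms R) where
  one_smul η := by
    have : rmul (1 : R) = LinearMap.id := hom_ext fun x y => by simp [rmul_mk, mk_one]
    exact LinearMap.congr_fun this η
  mul_smul z w η := by
    have : rmul (w.unop * z.unop) = rmul z.unop ∘ₗ rmul w.unop := hom_ext fun x y => by
      simp [rmul_mk, mul_assoc]
    exact LinearMap.congr_fun this η
  smul_zero z := map_zero _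
  smul_add z := map_add _
  add_smul z w η := by
    have : rmul (z.unop + w.unop) = rmul z.unop + rmul w.unop := hom_ext fun x y => by
      simp [rmul_mk, mul_add]; abel
    exact LinearMap.congr_fun this η
  zero_smul η := by
    have : rmul (0 : R) = 0 := hom_ext fun x y => by simp [rmul_mk]
    exact LinearMap.congr_fun this η

instance : IsScalarTower ℂ R (OneForms R) := inferInstanceAs (IsScalarTower ℂ R (R ⊗[ℂ] Bar R))

instance : IsScalarTower ℂ Rᵐᵒᵖ (OneForms R) where
  smul_assoc c z η := by
    have : rmul (c • z.unop) = c • rmul z.unop := hom_ext fun x y => by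
      simp [rmul_mk, smul_sub]
    exact LinearMap.congr_fun this η

instance : SMulCommClass R Rᵐᵒᵖ (OneForms R) where
  smul_comm z w η := by
    have : Module.toModuleEnd ℂ (S := R) (OneForms R) z ∘ₗ rmul w.unop =
        rmul w.unop ∘ₗ Module.toModuleEnd ℂ (S := R) (OneForms R) z := hom_ext fun x y => by
      simp [rmul_mk, smul_mk, smul_sub, mul_assoc]
    exact LinearMap.congr_fun this η

/-- The map `x dy ↦ f(x) df(y)` induced on one-forms by a homomorphism `f`. -/
def map {S : Type v} [Ring S] [Algebra ℂ S] (f : R →ₐ[ℂ] S) : OneForms R →ₗ[ℂ] OneForms S :=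
  lift ((mk S).compl₁₂ f.toLinearMap f.toLinearMap).flip (by ext x; simp [mk_one])

theorem map_mk {S : Type v} [Ring S] [Algebra ℂ S] (f : R →ₐ[ℂ] S) (x y : R) :
    map f (mk R x y) = mk S (f x) (f y) := rfl

variable (R)

/-- The subspace `[R, Ω¹(R)]` of `Ω¹(R)`. -/
def comm : Submodule ℂ (OneForms R) :=
  Submodule.span ℂ {ξ | ∃ (x : R) (η : OneForms R), ξ = x • η - MulOpposite.op x • η}

end OneForms

/-- `Ω¹(R)_♮ = Ω¹(R) / [R, Ω¹(R)]`, the odd part of the `X`-complex of `R`; the even part is `R`. -/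
abbrev XOdd : Type u := OneForms R ⧸ OneForms.comm R

/-- The differential `♮d : R → Ω¹(R)_♮` of the `X`-complex. -/
def natD : R →ₗ[ℂ] XOdd R := (OneForms.comm R).mkQ ∘ₗ OneForms.mk R 1

/-- The map `b : Ω¹(R) → R`, `x dy ↦ [x, y]`. -/
def hochschildB : OneForms R →ₗ[ℂ] R :=
  OneForms.lift ((LinearMap.mul ℂ R).flip - LinearMap.mul ℂ R) (by ext x; simp)

theorem hochschildB_mk (x y : R) : hochschildB R (OneForms.mk R x y) = x * y - y * x := rfl

/-- The differential `b̄ : Ω¹(R)_♮ → R`, `♮ x dy ↦ [x, y]`, of the `X`-complex. -/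
def bBar : XOdd R →ₗ[ℂ] R :=
  (OneForms.comm R).liftQ (hochschildB R) (Submodule.span_le.2 (by
    rintro _ ⟨x, η, rfl⟩
    have : hochschildB R ∘ₗ (Module.toModuleEnd ℂ (S := R) (OneForms R) x - OneForms.rmul x) =
        0 := OneForms.hom_ext fun y z => by
      simp [OneForms.smul_mk, OneForms.rmul_mk, hochschildB_mk]
      noncomm_ring
    exact LinearMap.congr_fun this η))

theorem bBar_natD (x : R) : bBar R (natD R x) = 0 := by
  change (1 : R) * x - x * 1 = 0
  simp

theorem natD_bBar (ξ : XOdd R) : natD R (bBar R ξ) = 0 := by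
  obtain ⟨η, rfl⟩ := (OneForms.comm R).mkQ_surjective ξ
  have : natD R ∘ₗ hochschildB R = 0 := OneForms.hom_ext fun x y => by
    refine (Submodule.Quotient.mk_eq_zero _).2 ?_
    have h : OneForms.mk R 1 (x * y - y * x) =
        (x • OneForms.mk R 1 y - MulOpposite.op x • OneForms.mk R 1 y) -
          (y • OneForms.mk R 1 x - MulOpposite.op y • OneForms.mk R 1 x) := by
      simp only [OneForms.op_smul_def, MulOpposite.unop_op, OneForms.rmul_mk, OneForms.smul_mk,
        mul_one, one_mul, map_sub]
      abel
    rw [hochschildB_mk, h]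
    exact sub_mem (Submodule.subset_span ⟨x, _, rfl⟩) (Submodule.subset_span ⟨y, _, rfl⟩)
  exact LinearMap.congr_fun this η

variable {R}

/-- The map induced on the odd part of the `X`-complex by a homomorphism. -/
def XOdd.map {S : Type v} [Ring S] [Algebra ℂ S] (f : R →ₐ[ℂ] S) : XOdd R →ₗ[ℂ] XOdd S :=
  (OneForms.comm R).mapQ (OneForms.comm S) (OneForms.map f) (Submodule.span_le.2 (by
    rintro _ ⟨x, η, rfl⟩
    have : OneForms.map f ∘ₗ (Module.toModuleEnd ℂ (S := R) (OneForms R) x - OneForms.rmul x) =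
        (Module.toModuleEnd ℂ (S := S) (OneForms S) (f x) - OneForms.rmul (f x)) ∘ₗ
          OneForms.map f := OneForms.hom_ext fun y z => by
      simp [OneForms.smul_mk, OneForms.rmul_mk, OneForms.map_mk]
    have h := LinearMap.congr_fun this η
    exact Submodule.subset_span ⟨f x, OneForms.map f η, h⟩))

end XComplex


section ChernSimons

variable (R : Type u) [Ring R] [Algebra ℂ R]

/-- The algebra `Ω^{≤1}(R) = Ω(R) / Ω^{≥2}(R)` of forms of degree at most one: pairs of an element
of `R` and a one-form, a product of two one-forms being zero. -/
abbrev TruncForms : Type u := TrivSqZeroExt R (OneForms R)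

/-- The differential of `Ω^{≤1}(R)`. -/
def truncD : TruncForms R →ₗ[ℂ] TruncForms R where
  toFun x := TrivSqZeroExt.inr (OneForms.mk R 1 x.fst)
  map_add' x y := by simp
  map_smul' c x := by simp

/-- The projection of `Ω^{≤1}(R)` onto its component `Ω¹(R)`. -/
def truncSnd : TruncForms R →ₗ[ℂ] OneForms R where
  toFun x := x.snd
  map_add' _ _ := rfl
  map_smul' _ _ := rfl

/-- The inclusion of `Ω¹(R)` in `Ω^{≤1}(R)`. -/
def truncInr : OneForms R →ₗ[ℂ] TruncForms R where
  toFun η := TrivSqZeroExt.inr η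
  map_add' _ _ := by simp
  map_smul' _ _ := by simp

theorem truncSnd_apply (x : TruncForms R) : truncSnd R x = x.snd := rfl

theorem truncInr_apply (η : OneForms R) : truncInr R η = TrivSqZeroExt.inr η := rfl

variable {R} in
/-- The map induced on `Ω^{≤1}` by a homomorphism. -/
def truncMap {S : Type v} [Ring S] [Algebra ℂ S] (f : R →ₐ[ℂ] S) :
    TruncForms R →ₗ[ℂ] TruncForms S where
  toFun x := TrivSqZeroExt.inl (f x.fst) + TrivSqZeroExt.inr (OneForms.map f x.snd)
  map_add' x y := by ext <;> simp
  map_smul' c x := by ext <;> simp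

/-- The grading of `Ω^{≤1}(R)` by the parity of the degree. -/
def truncGrading (i : ZMod 2) : Submodule ℂ (TruncForms R) :=
  if i = 0 then LinearMap.ker (truncSnd R)
  else LinearMap.ker (TrivSqZeroExt.fstHom ℂ R (OneForms R)).toLinearMap

theorem mem_truncGrading_zero {x : TruncForms R} : x ∈ truncGrading R 0 ↔ x.snd = 0 := Iff.rfl

theorem mem_truncGrading_one {x : TruncForms R} : x ∈ truncGrading R 1 ↔ x.fst = 0 := Iff.rfl

theorem zmod_two_cases (i : ZMod 2) : i = 0 ∨ i = 1 := by revert i; decide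

instance : SetLike.GradedMonoid (truncGrading R) where
  one_mem := by rw [mem_truncGrading_zero]; simp
  mul_mem i j x y hx hy := by
    rcases zmod_two_cases i with rfl | rfl <;> rcases zmod_two_cases j with rfl | rfl
    · rw [zero_add]
      rw [mem_truncGrading_zero] at *
      simp [hx, hy]
    · rw [zero_add]
      rw [mem_truncGrading_one] at *
      simp [hy]
    · rw [add_zero]
      rw [mem_truncGrading_one] at *
      simp [hx]
    · rw [show (1 : ZMod 2) + 1 = 0 from rfl]
      rw [mem_truncGrading_one] at hx hy
      rw [mem_truncGrading_zero]
      simp [hx, hy]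

/-- The decomposition of `Ω^{≤1}(R)` into `R` and `Ω¹(R)`. -/
def truncDecompose : TruncForms R →ₗ[ℂ] DirectSum (ZMod 2) fun i => truncGrading R i :=
  DirectSum.lof ℂ (ZMod 2) (fun i => truncGrading R i) 0 ∘ₗ
      LinearMap.codRestrict (truncGrading R 0)
        ((TrivSqZeroExt.inlAlgHom ℂ R (OneForms R)).toLinearMap ∘ₗ
          (TrivSqZeroExt.fstHom ℂ R (OneForms R)).toLinearMap)
        (fun x => by rw [mem_truncGrading_zero]; simp) +
    DirectSum.lof ℂ (ZMod 2) (fun i => truncGrading R i) 1 ∘ₗ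
      LinearMap.codRestrict (truncGrading R 1) (truncInr R ∘ₗ truncSnd R)
        (fun x => by rw [mem_truncGrading_one]; simp [truncInr_apply])

instance : DirectSum.Decomposition (truncGrading R) :=
  DirectSum.Decomposition.ofLinearMap (truncGrading R) (truncDecompose R)
    (by
      ext x <;> simp [truncDecompose, truncInr_apply, truncSnd_apply, DirectSum.lof_eq_of])
    (by
      refine DirectSum.linearMap_ext ℂ fun i => LinearMap.ext fun x => ?_
      obtain ⟨x, hx⟩ := x
      rcases zmod_two_cases i with rfl | rfl
      · have h0 : LinearMap.codRestrict (truncGrading R 1) (truncInr R ∘ₗ truncSnd R)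
            (fun x => by rw [mem_truncGrading_one]; simp [truncInr_apply]) x = 0 := by
          rw [mem_truncGrading_zero] at hx
          ext <;> simp [truncInr_apply, truncSnd_apply, hx]
        have h1 : LinearMap.codRestrict (truncGrading R 0)
            ((TrivSqZeroExt.inlAlgHom ℂ R (OneForms R)).toLinearMap ∘ₗ
              (TrivSqZeroExt.fstHom ℂ R (OneForms R)).toLinearMap)
            (fun x => by rw [mem_truncGrading_zero]; simp) x = ⟨x, hx⟩ := by
          rw [mem_truncGrading_zero] at hx
          ext <;> simp [hx]
        simp only [truncDecompose, LinearMap.comp_apply, LinearMap.add_apply, LinearMap.id_apply,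
          DirectSum.coeLinearMap_lof, h0, h1, map_zero, add_zero]
      · have h0 : LinearMap.codRestrict (truncGrading R 1) (truncInr R ∘ₗ truncSnd R)
            (fun x => by rw [mem_truncGrading_one]; simp [truncInr_apply]) x = ⟨x, hx⟩ := by
          rw [mem_truncGrading_one] at hx
          ext <;> simp [truncInr_apply, truncSnd_apply, hx]
        have h1 : LinearMap.codRestrict (truncGrading R 0)
            ((TrivSqZeroExt.inlAlgHom ℂ R (OneForms R)).toLinearMap ∘ₗ
              (TrivSqZeroExt.fstHom ℂ R (OneForms R)).toLinearMap)
            (fun x => by rw [mem_truncGrading_zero]; simp) x = 0 := by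
          rw [mem_truncGrading_one] at hx
          ext <;> simp [hx]
        simp only [truncDecompose, LinearMap.comp_apply, LinearMap.add_apply, LinearMap.id_apply,
          DirectSum.coeLinearMap_lof, h0, h1, map_zero, zero_add])

instance : GradedAlgebra (truncGrading R) where


variable {L : Type v} [Ring L] [Algebra ℂ L] (ℒ : ZMod 2 → Submodule ℂ L)

/-- `L_♮ = L / [L, L]`, the quotient of `L` by the span of the graded commutators. -/
abbrev GradedAb : Type v :=
  L ⧸ Submodule.span ℂ {x : L | ∃ (i j : ZMod 2) (a b : L), a ∈ ℒ i ∧ b ∈ ℒ j ∧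
    x = a * b - (-1 : ℤˣ) ^ (i * j) • (b * a)}

/-- The universal trace `♮ : L → L_♮`. -/
def gradedTr : L →ₗ[ℂ] GradedAb ℒ := Submodule.mkQ _

/-- The subspace `R ⊗ L₊` of `R ⊗ L`. -/
def evenPart : Submodule ℂ (R ⊗[ℂ] L) := LinearMap.range ((ℒ 0).subtype.lTensor R)

variable [GradedAlgebra ℒ]

/-- The graded tensor product of `Ω(R)` and `L`, modulo the ideal of forms of degree at least two
in `Ω(R)`; products carry the sign `(η ⊗ l) (ξ ⊗ m) = (-1)^{|l| |ξ|} η ξ ⊗ l m`. -/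
abbrev FormsTensor : Type (max u v) := truncGrading R ᵍ⊗[ℂ] ℒ

namespace FormsTensor

/-- The inclusion of `R ⊗ L` as the forms of degree zero. -/
def ofDegZero : R ⊗[ℂ] L →ₗ[ℂ] FormsTensor R ℒ :=
  (GradedTensorProduct.of ℂ (truncGrading R) ℒ).toLinearMap ∘ₗ
    (TrivSqZeroExt.inlAlgHom ℂ R (OneForms R)).toLinearMap.rTensor L

/-- The element `1 ⊗ l`. -/
def ofL (l : L) : FormsTensor R ℒ := 1 ᵍ⊗ₜ[ℂ] l

/-- The differential `d ⊗ Id`. -/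
def d : FormsTensor R ℒ →ₗ[ℂ] FormsTensor R ℒ :=
  (GradedTensorProduct.of ℂ (truncGrading R) ℒ).toLinearMap ∘ₗ (truncD R).rTensor L ∘ₗ
    (GradedTensorProduct.of ℂ (truncGrading R) ℒ).symm.toLinearMap

/-- The projection onto `Ω¹(R) ⊗ L`, as an endomorphism. -/
def projOne : FormsTensor R ℒ →ₗ[ℂ] FormsTensor R ℒ :=
  (GradedTensorProduct.of ℂ (truncGrading R) ℒ).toLinearMap ∘ₗ
    (truncInr R ∘ₗ truncSnd R).rTensor L ∘ₗ
      (GradedTensorProduct.of ℂ (truncGrading R) ℒ).symm.toLinearMap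

/-- The projection induced by the projection of `L` onto `L₊`, as an endomorphism. -/
def projEven : FormsTensor R ℒ →ₗ[ℂ] FormsTensor R ℒ :=
  (GradedTensorProduct.of ℂ (truncGrading R) ℒ).toLinearMap ∘ₗ
    (GradedAlgebra.proj ℒ 0).lTensor (TruncForms R) ∘ₗ
      (GradedTensorProduct.of ℂ (truncGrading R) ℒ).symm.toLinearMap

/-- The trace `♮ ⊗ ♮`, defined on the component in `Ω¹(R) ⊗ L`. -/
def natTrace : FormsTensor R ℒ →ₗ[ℂ] XOdd R ⊗[ℂ] GradedAb ℒ :=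
  TensorProduct.map ((OneForms.comm R).mkQ ∘ₗ truncSnd R) (gradedTr ℒ) ∘ₗ
    (GradedTensorProduct.of ℂ (truncGrading R) ℒ).symm.toLinearMap

variable {R} in
/-- The map induced by a homomorphism of `R`. -/
def map {S : Type u} [Ring S] [Algebra ℂ S] (f : R →ₐ[ℂ] S) :
    FormsTensor R ℒ →ₗ[ℂ] FormsTensor S ℒ :=
  (GradedTensorProduct.of ℂ (truncGrading S) ℒ).toLinearMap ∘ₗ (truncMap f).rTensor L ∘ₗ
    (GradedTensorProduct.of ℂ (truncGrading R) ℒ).symm.toLinearMap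

end FormsTensor

/-- `y` is the (weak) integral `∫₀¹ f(t) dt` of a function with values in a topological vector
space. -/
def IsWeakIntegral {Q : Type*} [AddCommGroup Q] [Module ℂ Q] [TopologicalSpace Q] (f : ℝ → Q) (y : Q) :
    Prop :=
  ∀ φ : Q →L[ℂ] ℂ, IntervalIntegrable (fun t => φ (f t)) MeasureTheory.volume 0 1 ∧
    ∫ t in (0 : ℝ)..1, φ (f t) = φ y

open Classical in
/-- The integral `∫₀¹ f(t) dt`, when it exists. -/
def weakIntegral {Q : Type*} [AddCommGroup Q] [Module ℂ Q] [TopologicalSpace Q] (f : ℝ → Q) : Q :=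
  if h : ∃ y, IsWeakIntegral f y then h.choose else 0

/-- The partial sums of the exponential series `∑ xʲ / j!`. -/
def expPartial {Q : Type*} [Ring Q] [Algebra ℂ Q] (x : Q) (N : ℕ) : Q :=
  ∑ j ∈ Finset.range N, ((j.factorial : ℂ)⁻¹) • x ^ j

/-- The exponential `eˣ`, the sum of the exponential series when it converges. -/
def expSum {Q : Type*} [Ring Q] [Algebra ℂ Q] [TopologicalSpace Q] (x : Q) : Q :=
  limUnder atTop (expPartial x)

/-- The requirements on a topology of the graded tensor product of `Ω(R)` and `L` (in degrees at
most one): it is a Hausdorff locally convex space with sequentially continuous product, in which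
continuous curves can be integrated, the differential and the projections attached to the gradings
are continuous, and the kernel of the trace `♮ ⊗ ♮` is closed. -/
structure IsAdmissible [TopologicalSpace (FormsTensor R ℒ)] : Prop where
  t2 : T2Space (FormsTensor R ℒ)
  isTopologicalAddGroup : IsTopologicalAddGroup (FormsTensor R ℒ)
  continuousSMul : ContinuousSMul ℂ (FormsTensor R ℒ)
  locallyConvex : LocallyConvexSpace ℝ (FormsTensor R ℒ)
  tendsto_mul : ∀ (x y : ℕ → FormsTensor R ℒ) (a b : FormsTensor R ℒ),
    Tendsto x atTop (𝓝 a) → Tendsto y atTop (𝓝 b) →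
      Tendsto (fun k => x k * y k) atTop (𝓝 (a * b))
  exists_weakIntegral : ∀ f : ℝ → FormsTensor R ℒ, ContinuousOn f (Set.Icc 0 1) → ∃ y, IsWeakIntegral f y
  continuous_d : Continuous (FormsTensor.d R ℒ)
  continuous_projOne : Continuous (FormsTensor.projOne R ℒ)
  continuous_projEven : Continuous (FormsTensor.projEven R ℒ)
  isClosed_ker : IsClosed {x | FormsTensor.natTrace R ℒ x = 0}

variable {R}
variable (D θ : L) (g : R ⊗[ℂ] L)

open FormsTensor

/-- The gauge transform `θ^g = g⁻¹ θ g + g⁻¹ [D, g]`. -/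
def gaugeTransform : FormsTensor R ℒ :=
  ofDegZero R ℒ (Ring.inverse g) * ofL R ℒ θ * ofDegZero R ℒ g +
    ofDegZero R ℒ (Ring.inverse g) *
      (ofL R ℒ D * ofDegZero R ℒ g - ofDegZero R ℒ g * ofL R ℒ D)

/-- The Maurer-Cartan form `ω = g⁻¹ dg`. -/
def maurerCartan : FormsTensor R ℒ :=
  ofDegZero R ℒ (Ring.inverse g) * FormsTensor.d R ℒ (ofDegZero R ℒ g)

/-- The potential `ρ = D + t (ω + θ^g)` of the superconnection `∇ = d + ρ`. -/
def potential (t : ℝ) : FormsTensor R ℒ :=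
  ofL R ℒ D + (t : ℂ) • (maurerCartan ℒ g + gaugeTransform ℒ D θ g)

/-- The curvature `∇² = dρ + ρ²`. -/
def curvature (t : ℝ) : FormsTensor R ℒ :=
  FormsTensor.d R ℒ (potential ℒ D θ g t) + potential ℒ D θ g t * potential ℒ D θ g t

variable [TopologicalSpace (FormsTensor R ℒ)]

/-- The curvature is exponentiable: the series `e^{-s ∇²}` converges for `s` and `t` in `[0, 1]`,
and its sum depends continuously on `(s, t)`. -/
def Exponentiable : Prop :=
  (∀ s ∈ Set.Icc (0 : ℝ) 1, ∀ t ∈ Set.Icc (0 : ℝ) 1,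
    ∃ e, Tendsto (expPartial (-(s : ℂ) • curvature ℒ D θ g t)) atTop (𝓝 e)) ∧
  ContinuousOn (fun p : ℝ × ℝ => expSum (-(p.1 : ℂ) • curvature ℒ D θ g p.2))
    (Set.Icc 0 1 ×ˢ Set.Icc 0 1)

/-- The component `μ₁` in `Ω¹(R) ⊗ L` of `μ = (ω + θ^g) e^{-∇²}`. -/
def muOne (t : ℝ) : FormsTensor R ℒ :=
  projOne R ℒ ((maurerCartan ℒ g + gaugeTransform ℒ D θ g) * expSum (-curvature ℒ D θ g t))

/-- The Chern-Simons form `cs = ♮ ⊗ ♮ ∫₀¹ μ₁ dt`. -/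
def chernSimons : XOdd R ⊗[ℂ] GradedAb ℒ :=
  natTrace R ℒ (weakIntegral (muOne ℒ D θ g))

end ChernSimons

section Limits

/-- The projective limit of a sequence of vector spaces. -/
def invLim {V : ℕ → Type u} [∀ n, AddCommGroup (V n)] [∀ n, Module ℂ (V n)]
    (π : ∀ n, V (n + 1) →ₗ[ℂ] V n) : Submodule ℂ (∀ n, V n) where
  carrier := {x | ∀ n, π n (x (n + 1)) = x n}
  add_mem' hx hy n := by simp [hx n, hy n]
  zero_mem' n := by simp
  smul_mem' c x hx n := by simp [hx n]

variable {E O : ℕ → Type u} [∀ n, AddCommGroup (E n)] [∀ n, Module ℂ (E n)]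
  [∀ n, AddCommGroup (O n)] [∀ n, Module ℂ (O n)]
  (πE : ∀ n, E (n + 1) →ₗ[ℂ] E n) (πO : ∀ n, O (n + 1) →ₗ[ℂ] O n)
  (δ : ∀ n, E n →ₗ[ℂ] O n) (β : ∀ n, O n →ₗ[ℂ] E n)

/-- The odd cycles of the projective limit of the two-periodic complexes `δ : E n ⇄ O n : β`. -/
def limCycles : Submodule ℂ (∀ n, O n) :=
  invLim πO ⊓ LinearMap.ker (LinearMap.pi fun n => β n ∘ₗ LinearMap.proj n)

/-- The odd boundaries of the projective limit of the two-periodic complexes `δ : E n ⇄ O n : β`. -/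
def limBoundaries : Submodule ℂ (∀ n, O n) :=
  (invLim πE).map (LinearMap.pi fun n => δ n ∘ₗ LinearMap.proj n)

/-- The odd homology of the projective limit of the two-periodic complexes `δ : E n ⇄ O n : β`. -/
abbrev LimHomology : Type u :=
  limCycles πO β ⧸ (limBoundaries πE δ).submoduleOf (limCycles πO β)

/-- The homology class of a cycle. -/
def LimHomology.cls (c : ∀ n, O n) (hc : c ∈ limCycles πO β) : LimHomology πE πO δ β :=
  Submodule.Quotient.mk ⟨c, hc⟩

end Limits

section Homology

variable (A : Type u) [Ring A] [Algebra ℂ A]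

/-- The odd periodic cyclic homology `HP₁(A) = H₋(lim X(R_n))`. -/
abbrev HPOne : Type u :=
  LimHomology (fun n => (RnMap A n).toLinearMap) (fun n => XOdd.map (RnMap A n))
    (fun n => natD (Rn A n)) (fun n => bBar (Rn A n))

variable (V : Type v) [AddCommGroup V] [Module ℂ V]

/-- The odd homology `H₋(lim X(R_n) ⊗ V)`. -/
abbrev HMinus : Type (max u v) :=
  LimHomology (fun n => (RnMap A n).toLinearMap.rTensor V)
    (fun n => (XOdd.map (RnMap A n)).rTensor V)
    (fun n => (natD (Rn A n)).rTensor V) (fun n => (bBar (Rn A n)).rTensor V)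

variable {V}

/-- Contraction of the coefficients with a linear form. -/
def contract (M : Type u) [AddCommGroup M] [Module ℂ M] (f : V →ₗ[ℂ] ℂ) : M ⊗[ℂ] V →ₗ[ℂ] M :=
  (TensorProduct.rid ℂ M).toLinearMap ∘ₗ f.lTensor M

theorem contract_rTensor {M N : Type u} [AddCommGroup M] [Module ℂ M] [AddCommGroup N] [Module ℂ N]
    (f : V →ₗ[ℂ] ℂ) (h : M →ₗ[ℂ] N) (x : M ⊗[ℂ] V) :
    contract N f (h.rTensor V x) = h (contract M f x) := by
  have : contract N f ∘ₗ h.rTensor V = h ∘ₗ contract M f :=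
    TensorProduct.ext' fun m v => by simp [contract]
  exact LinearMap.congr_fun this x

/-- The map `H₋(lim X(R_n) ⊗ V) → H₋(lim X(R_n))` induced by a linear form on `V`. -/
def HMinus.contract (f : V →ₗ[ℂ] ℂ) : HMinus A V →ₗ[ℂ] HPOne A :=
  Submodule.mapQ _ _
    ((LinearMap.pi fun n => BRS.contract (XOdd (Rn A n)) f ∘ₗ LinearMap.proj n).restrict
      (fun c hc => by
        obtain ⟨h1, h2⟩ := hc
        refine ⟨fun n => ?_, ?_⟩
        · have := congrArg (BRS.contract (XOdd (Rn A n)) f) (h1 n)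
          rwa [contract_rTensor] at this
        · refine LinearMap.mem_ker.2 (funext fun n => ?_)
          have := congrArg (BRS.contract (Rn A n) f) (congrFun (LinearMap.mem_ker.1 h2) n)
          simp only [LinearMap.pi_apply, LinearMap.comp_apply, LinearMap.proj_apply,
            contract_rTensor, Pi.zero_apply, map_zero] at this
          exact this))
    (by
      rintro ⟨c, hc⟩ ⟨e, he, hec⟩
      refine ⟨fun n => BRS.contract (Rn A n) f (e n), fun n => ?_, ?_⟩
      · have := congrArg (BRS.contract (Rn A n) f) (he n)
        rwa [contract_rTensor] at this
      · funext n
        have := congrArg (BRS.contract (XOdd (Rn A n)) f) (congrFun hec n)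
        simp only [LinearMap.pi_apply, LinearMap.comp_apply, LinearMap.proj_apply,
          contract_rTensor] at this
        exact this)

variable {L : Type v} [Ring L] [Algebra ℂ L] (ℒ : ZMod 2 → Submodule ℂ L)

/-- The image `g_n` in `R_n ⊗ L` of `g` in `A ⊗ L`, where `A = Ω⁰(A)` is included in `RA`. -/
def liftRn (n : ℕ) : A ⊗[ℂ] L →ₗ[ℂ] Rn A n ⊗[ℂ] L :=
  ((Ideal.Quotient.mkₐ ℂ (IA A ^ (n + 1))).toLinearMap ∘ₗ RA.incl A).rTensor L

variable {A}

/-- The Chern-Simons form `cs_n` of the triple `(D, θ, g_n)`. -/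
def csn [GradedAlgebra ℒ] [∀ n, TopologicalSpace (FormsTensor (Rn A n) ℒ)] (D θ : L)
    (g : A ⊗[ℂ] L) (n : ℕ) : XOdd (Rn A n) ⊗[ℂ] GradedAb ℒ :=
  chernSimons ℒ D θ (liftRn A n g)

end Homology

section KTheory

variable (A : Type u) [Ring A]

/-- The block inclusion `g ↦ diag(g, 1)` of `N × N` matrices in `M × M` matrices, `N ≤ M`. -/
def stab (N M : ℕ) (h : N ≤ M) : Matrix (Fin N) (Fin N) A →* Matrix (Fin M) (Fin M) A where
  toFun g := Matrix.of fun i j =>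
    if hij : (i : ℕ) < N ∧ (j : ℕ) < N then g ⟨i, hij.1⟩ ⟨j, hij.2⟩ else if i = j then 1 else 0
  map_one' := by
    ext i j
    by_cases hij : (i : ℕ) < N ∧ (j : ℕ) < N
    · simp [Matrix.one_apply, Fin.ext_iff]
    · simp [hij, Matrix.one_apply]
  map_mul' a b := by
    ext i j
    rw [Matrix.mul_apply]
    by_cases hi : (i : ℕ) < N
    · by_cases hj : (j : ℕ) < N
      · simp only [Matrix.of_apply, hi, hj, and_self, dite_true, Matrix.mul_apply, true_and,
          and_true]
        refine Fintype.sum_of_injective (Fin.castLE h) (Fin.castLE_injective h) _ _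
          (fun k hk => ?_) (fun k => ?_)
        · have hk' : ¬ (k : ℕ) < N := fun hlt => hk ⟨⟨k, hlt⟩, Fin.ext rfl⟩
          have : i ≠ k := fun e => hk' (e ▸ hi)
          simp [hk', this]
        · simp
      · rw [Finset.sum_eq_single j (fun k _ hkj => by simp [hj, hkj]) (by simp)]
        simp [hj]
    · rw [Finset.sum_eq_single i (fun k _ hki => by simp [hi, hki.symm]) (by simp)]
      simp [hi]

/-- The block inclusion `GL_N(A) → GL_M(A)`, `N ≤ M`. -/
def stabGL (N M : ℕ) (h : N ≤ M) : (Matrix (Fin N) (Fin N) A)ˣ →* (Matrix (Fin M) (Fin M) A)ˣ :=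
  Units.map (stab A N M h)

instance : DirectedSystem (fun N => (Matrix (Fin N) (Fin N) A)ˣ) (stabGL A · · ·) where
  map_self N g := Units.ext (by
    ext i j
    simp [stabGL, stab])
  map_map P M N h h' g := Units.ext (by
    ext i j
    by_cases hN : (i : ℕ) < N ∧ (j : ℕ) < N
    · have hM : (i : ℕ) < M ∧ (j : ℕ) < M := ⟨hN.1.trans_le h, hN.2.trans_le h⟩
      simp [stabGL, stab, hN, hM]
    · by_cases hM : (i : ℕ) < M ∧ (j : ℕ) < M
      · simp [stabGL, stab, hN, hM, Fin.ext_iff]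
      · simp [stabGL, stab, hN, hM])

/-- The group `GL(A)`, the union of the groups `GL_N(A)`. -/
abbrev GLInf : Type u := DirectLimit (fun N => (Matrix (Fin N) (Fin N) A)ˣ) (stabGL A)

/-- The group `K₁(A)`, the abelianization of `GL(A)`, written additively. -/
abbrev KOne : Type u := Additive (Abelianization (GLInf A))

variable {A}

/-- The class in `K₁(A)` of an invertible matrix. -/
def KOne.cls {N : ℕ} (g : (Matrix (Fin N) (Fin N) A)ˣ) : KOne A :=
  Additive.ofMul (Abelianization.of (⟦⟨N, g⟩⟧ : GLInf A))

variable [Algebra ℂ A]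

variable (A) in
/-- The `IA`-adic completion of `RA`, the projective limit of the algebras `R_n`. -/
def RHat : Subalgebra ℂ (∀ n, Rn A n) where
  carrier := {x | ∀ n, RnMap A n (x (n + 1)) = x n}
  mul_mem' hx hy n := by simp only [Pi.mul_apply, map_mul, hx n, hy n]
  add_mem' hx hy n := by simp only [Pi.add_apply, map_add, hx n, hy n]
  algebraMap_mem' c n := by simp

variable (A) in
/-- The projection of the completion onto `R_n`. -/
def RHat.proj (n : ℕ) : RHat A →ₐ[ℂ] Rn A n :=
  (Pi.evalAlgHom ℂ (fun n => Rn A n) n).comp (RHat A).val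

variable (A) in
/-- The projection of the completion onto `A = RA / IA`. -/
def RHat.toBase : RHat A →ₐ[ℂ] A :=
  (Ideal.Quotient.liftₐ (IA A ^ (0 + 1)) (RA.toBase A) (fun a ha => by
    rw [zero_add, Submodule.pow_one] at ha; exact ha)).comp (RHat.proj A 0)

/-- The form `♮ Tr (u⁻¹ du)` for an invertible matrix `u` with entries in `R`. -/
def cartanForm {R : Type u} [Ring R] [Algebra ℂ R] {N : ℕ} (u : (Matrix (Fin N) (Fin N) R)ˣ) :
    XOdd R :=
  ∑ i, ∑ j, (OneForms.comm R).mkQ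
    (OneForms.mk R ((u⁻¹ : (Matrix (Fin N) (Fin N) R)ˣ).1 i j) (u.1 j i))

/-- `ch` is the Cuntz-Quillen Chern character `K₁(A) → HP₁(A)`: if an invertible matrix `u` over
the completion lifts `g`, then `ch [g]` is the class of the image of `♮ Tr (u⁻¹ du)` under the
canonical map from the `X`-complex of the completion to the limit of the complexes `X(R_n)`. -/
def IsChernCharacter (ch : KOne A →+ HPOne A) : Prop :=
  ∀ (N : ℕ) (u : (Matrix (Fin N) (Fin N) (RHat A))ˣ),
    ∃ h, ch (KOne.cls (Units.map (RHat.toBase A).mapMatrix.toMonoidHom u)) =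
      LimHomology.cls _ _ _ _ (fun n => XOdd.map (RHat.proj A n) (cartanForm u)) h

/-- The map `L_♮ → ℂ` induced by the trace of matrices, for `L = M_N(ℂ)` with `L₋ = 0`. -/
def matrixTrace {N : ℕ} (ℒ : ZMod 2 → Submodule ℂ (Matrix (Fin N) (Fin N) ℂ)) (hℒ : ℒ 1 = ⊥) :
    GradedAb ℒ →ₗ[ℂ] ℂ :=
  Submodule.liftQ _ (Matrix.traceLinearMap (Fin N) ℂ ℂ) (Submodule.span_le.2 (by
    rintro _ ⟨i, j, a, b, ha, hb, rfl⟩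
    rcases zmod_two_cases i with rfl | rfl
    · simp [Matrix.trace_mul_comm a b]
    · rw [hℒ, Submodule.mem_bot] at ha
      simp [ha]))

end KTheory

end BRS

end

open BRS

/-!
The class of the Chern-Simons forms is compared with the class `κ` of the traces of the
Maurer-Cartan forms `ω = g_n⁻¹ dg_n`, which are the Chern-Simons forms of the pair `D = θ = 0`.

*Independence of `D` and `θ`.* Put `β = θ^g`, `a = D + t β`, `ρ = a + t ω` and `F = dρ + ρ²`, so
that `∇² = F`, and let `P` be the projection onto the forms of degree one. Since
`[∇, a] = 2 F - P F` (`TracedForms.IsPotential.nabla`) and `∂F/∂t = [∇, β + ω]`, Duhamel's formula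
shows that the `t`-derivative of the trace of `a e^{-sF}` is the sum of a multiple of the trace of
`(β + ω) F e^{-sF}` and of the trace of an exact form. The boundary terms vanish, because the
curvatures at `t = 0` and `t = 1`, which are `D²` and `g⁻¹ (D + θ)² g`, have no component of degree
one. Integrating over `s` as well gives `TracedForms.τ_integral_eq`:
`cs_n = ♮ω - ½ ♮dy`, with `y` the integral of `a e^{-(1-v)sF} (β + ω) e^{-vsF}` over the unit cube.
The differential of the `X`-complex factors through the component of degree zero of `y`, and `y` is
compatible with the maps `R_{n+1} → R_n`, so that `cs_n` and `♮ω` define the same class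
(`cls_csn`). That `cs_n` is a cycle follows from the same formula and from `b̄ ♮(g⁻¹ dg) = 0`.

The multiplication is only sequentially continuous and integrals are weak, so the calculus is done
along curves: the exponentials are differentiable in the sense that slopes converge, which a mean
value argument deduces from the weak derivative (`tendsto_slope_of_weak_deriv`), and identities
between traces are tested on the continuous functionals that vanish on the closed kernel of
`♮ ⊗ ♮` (`exists_functional_ne_zero`).

*The Chern character.* An invertible matrix over `A` lifts to the completion of `RA`, the kernels of
`R_n → A` being nilpotent (`exists_units_RHat`). The form `♮ Tr (u⁻¹ du)` is additive in `u`, and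
for `u` reducing to `1` it is the boundary of `Tr log u`, a finite sum over each `R_n`
(`cartanClass_eq_zero`); hence its class depends only on the image of `u` in `K₁(A)`.

*Comparison.* For `L = M_N(ℂ)` in even degree, contraction of `♮(g_n⁻¹ dg_n)` with the trace is
`♮ Tr (u⁻¹ du)` for the lift `u` of `g` given by the inclusion of `A` in `RA`
(`contract_maurerCartanClass`), and `L_♮` is one-dimensional (`matrixTrace_bijective`).
-/

noncomputable section

namespace BRS

/-! ### Calculus of curves in a locally convex space -/

section WeakIntegral

variable {Q : Type*} [AddCommGroup Q] [Module ℂ Q] [TopologicalSpace Q]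

theorem IsWeakIntegral.map {Q' : Type*} [AddCommGroup Q'] [Module ℂ Q'] [TopologicalSpace Q']
    {f : ℝ → Q} {y : Q} (hy : IsWeakIntegral f y) (m : Q →L[ℂ] Q') :
    IsWeakIntegral (fun t => m (f t)) (m y) :=
  fun φ => hy (φ.comp m)

theorem IsWeakIntegral.congr {f g : ℝ → Q} {y : Q} (hy : IsWeakIntegral f y)
    (h : ∀ t ∈ Set.Icc (0 : ℝ) 1, f t = g t) : IsWeakIntegral g y := by
  intro φ
  have h' : Set.EqOn (fun t => φ (f t)) (fun t => φ (g t)) (Set.uIcc 0 1) := by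
    intro t ht
    rw [Set.uIcc_of_le zero_le_one] at ht
    simp only [h t ht]
  refine ⟨(intervalIntegrable_congr (h'.mono Set.uIoc_subset_uIcc)).1 (hy φ).1, ?_⟩
  rw [← intervalIntegral.integral_congr h', (hy φ).2]

theorem isWeakIntegral_weakIntegral {f : ℝ → Q} (h : ∃ y, IsWeakIntegral f y) :
    IsWeakIntegral f (weakIntegral f) := by
  rw [weakIntegral, dif_pos h]
  exact h.choose_spec

theorem isWeakIntegral_const (y : Q) : IsWeakIntegral (fun _ => y) y := fun φ => by simp

theorem IsWeakIntegral.sub {f g : ℝ → Q} {y z : Q} (hy : IsWeakIntegral f y)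
    (hz : IsWeakIntegral g z) : IsWeakIntegral (fun t => f t - g t) (y - z) := by
  intro φ
  simp only [map_sub]
  exact ⟨(hy φ).1.sub (hz φ).1, by
    rw [intervalIntegral.integral_sub (hy φ).1 (hz φ).1, (hy φ).2, (hz φ).2]⟩

end WeakIntegral

section LocallyConvex

variable {Q : Type*} [AddCommGroup Q] [Module ℂ Q] [TopologicalSpace Q]
  [IsTopologicalAddGroup Q] [ContinuousSMul ℂ Q] [LocallyConvexSpace ℝ Q]

theorem exists_functional_ne_zero (K : Submodule ℂ Q) (hK : IsClosed (K : Set Q)) {x : Q}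
    (hx : x ∉ K) : ∃ φ : Q →L[ℂ] ℂ, (∀ k ∈ K, φ k = 0) ∧ φ x ≠ 0 := by
  have hconv : Convex ℝ (K : Set Q) := (K.restrictScalars ℝ).convex
  obtain ⟨φ, c, hx', hφ⟩ := RCLike.geometric_hahn_banach_point_closed (𝕜 := ℂ) hconv hK hx
  have hc : c < 0 := by simpa using hφ 0 K.zero_mem
  have h0 : ∀ k ∈ K, φ k = 0 := by
    intro k hk
    by_contra hne
    -- the real part of `φ` would take every real value on the line spanned by `k`
    have h := hφ ((((c : ℂ) - 1) / φ k) • k) (K.smul_mem _ hk)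
    rw [map_smul, smul_eq_mul, div_mul_cancel₀ _ hne] at h
    have : RCLike.re ((c : ℂ) - 1) = c - 1 := by simp
    linarith
  refine ⟨φ, h0, fun h => ?_⟩
  rw [h] at hx'
  simp at hx'
  linarith

theorem eq_of_forall_functional_eq [T2Space Q] {x y : Q} (h : ∀ φ : Q →L[ℂ] ℂ, φ x = φ y) :
    x = y := by
  by_contra hne
  obtain ⟨φ, -, hφ⟩ := exists_functional_ne_zero (⊥ : Submodule ℂ Q)
    (by simp) (x := x - y) (by simpa [sub_eq_zero] using hne)
  exact hφ (by rw [map_sub, h φ, sub_self])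

theorem IsWeakIntegral.unique [T2Space Q] {f : ℝ → Q} {y z : Q} (hy : IsWeakIntegral f y)
    (hz : IsWeakIntegral f z) : y = z :=
  eq_of_forall_functional_eq fun φ => (hy φ).2.symm.trans (hz φ).2

theorem IsWeakIntegral.mem_of_convex {f : ℝ → Q} {y : Q} (hy : IsWeakIntegral f y) {C : Set Q}
    (hC : Convex ℝ C) (hC' : IsClosed C) (hf : ∀ t ∈ Set.Icc (0 : ℝ) 1, f t ∈ C) : y ∈ C := by
  by_contra hyC
  obtain ⟨φ, c, hlt, hφ⟩ := RCLike.geometric_hahn_banach_point_closed (𝕜 := ℂ) hC hC' hyC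
  obtain ⟨hint, heq⟩ := hy φ
  have h1 : ∫ t in (0 : ℝ)..1, (φ (f t)).re = (φ y).re := by
    rw [← heq]
    exact (Complex.reCLM.intervalIntegral_comp_comm hint)
  have h2 : ∫ _ in (0 : ℝ)..1, c ≤ ∫ t in (0 : ℝ)..1, (φ (f t)).re := by
    refine intervalIntegral.integral_mono_on zero_le_one (by simp) ?_
      fun t ht => (hφ _ (hf t ht)).le
    exact ⟨hint.1.re, hint.2.re⟩
  rw [h1] at h2
  simp only [intervalIntegral.integral_const, sub_zero, one_smul] at h2
  exact absurd hlt (not_lt.2 h2)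

theorem exists_closed_convex_mem_nhds {x : Q} {U : Set Q} (hU : U ∈ 𝓝 x) :
    ∃ C ∈ 𝓝 x, Convex ℝ C ∧ IsClosed C ∧ C ⊆ U := by
  have : ContinuousSMul ℝ Q := IsScalarTower.continuousSMul ℂ
  obtain ⟨W, ⟨hW, hWc⟩, hWU⟩ := (closed_nhds_basis x).mem_iff.1 hU
  obtain ⟨S, ⟨hS, hSc⟩, hSW⟩ := (LocallyConvexSpace.convex_basis (𝕜 := ℝ) x).mem_iff.1 hW
  exact ⟨closure S, mem_of_superset hS subset_closure, hSc.closure, isClosed_closure,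
    (closure_minimal hSW hWc).trans hWU⟩

theorem continuous_of_isWeakIntegral {X : Type*} [TopologicalSpace X] {f : X → ℝ → Q} {F : X → Q}
    (hf : Continuous fun p : X × ℝ => f p.1 p.2) (hF : ∀ x, IsWeakIntegral (f x) (F x)) :
    Continuous F := by
  refine continuous_iff_continuousAt.2 fun x₀ => ?_
  suffices h : Tendsto (fun x => F x - F x₀) (𝓝 x₀) (𝓝 0) by
    simpa [ContinuousAt] using h.add_const (F x₀)
  intro U hU
  obtain ⟨C, hC, hconv, hclosed, hCU⟩ := exists_closed_convex_mem_nhds hU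
  have h : ∀ᶠ x in 𝓝 x₀, ∀ v ∈ Set.Icc (0 : ℝ) 1, f x v - f x₀ v ∈ C := by
    refine isCompact_Icc.eventually_forall_of_forall_eventually fun v _ => ?_
    have hc : Continuous fun p : X × ℝ => f p.1 p.2 - f x₀ p.2 :=
      hf.sub (hf.comp (continuous_const.prodMk continuous_snd))
    have := hc.tendsto (x₀, v)
    simp only [sub_self] at this
    exact this hC
  refine mem_map.2 ?_
  filter_upwards [h] with x hx
  exact hCU (((hF x).sub (hF x₀)).mem_of_convex hconv hclosed hx)

/-- A curve whose weak derivative is continuous at a point is differentiable there. -/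
theorem tendsto_slope_of_weak_deriv {f v : ℝ → Q} {x : ℝ}
    (hf : ∀ᶠ y in 𝓝 x, ∀ φ : Q →L[ℂ] ℂ, HasDerivAt (fun z => φ (f z)) (φ (v y)) y)
    (hv : ContinuousAt v x) : Tendsto (slope f x) (𝓝[≠] x) (𝓝 (v x)) := by
  intro U hU
  obtain ⟨C, hC, hconv, hclosed, hCU⟩ := exists_closed_convex_mem_nhds hU
  obtain ⟨ε, hε, hball⟩ := Metric.eventually_nhds_iff_ball.1 (hf.and (hv hC))
  have key : ∀ a ∈ Metric.ball x ε, ∀ b ∈ Metric.ball x ε, a < b → slope f a b ∈ C := by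
    intro a ha b hb hab
    by_contra hnot
    obtain ⟨φ, c, hlt, hφ⟩ :=
      RCLike.geometric_hahn_banach_point_closed (𝕜 := ℂ) hconv hclosed hnot
    have hsub : ∀ z ∈ Set.Icc a b, z ∈ Metric.ball x ε := fun z hz =>
      (convex_ball x ε).ordConnected.out ha hb hz
    have hd : ∀ z ∈ Set.Icc a b, HasDerivAt (fun z => (φ (f z)).re) (φ (v z)).re z :=
      fun z hz =>
        Complex.reCLM.hasFDerivAt.comp_hasDerivAt z ((hball z (hsub z hz)).1 φ)
    obtain ⟨ξ, hξ, heq⟩ := exists_hasDerivAt_eq_slope (fun z => (φ (f z)).re)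
      (fun z => (φ (v z)).re) hab (fun z hz => (hd z hz).continuousAt.continuousWithinAt)
      (fun z hz => hd z (Set.Ioo_subset_Icc_self hz))
    have h1 := hφ _ (hball ξ (hsub ξ (Set.Ioo_subset_Icc_self hξ))).2
    have h2 : (φ (slope f a b)).re = ((φ (f b)).re - (φ (f a)).re) / (b - a) := by
      rw [slope_def_module, ← Complex.coe_smul, map_smul, map_sub, smul_eq_mul,
        Complex.re_ofReal_mul, Complex.sub_re, div_eq_inv_mul]
    change c < (φ (v ξ)).re at h1
    change (φ (slope f a b)).re < c at hlt
    linarith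
  have hmem : Metric.ball x ε \ {x} ∈ 𝓝[≠] x :=
    sdiff_mem_nhdsWithin_compl (Metric.ball_mem_nhds x hε) _
  refine mem_map.2 ?_
  filter_upwards [hmem] with y hy
  have hx : x ∈ Metric.ball x ε := Metric.mem_ball_self hε
  rcases lt_or_gt_of_ne hy.2 with h | h
  · rw [Set.mem_preimage, slope_comm]
    exact hCU (key y hy.1 x hx h)
  · exact hCU (key x hx y hy.1 h)

end LocallyConvex

section Curves

variable {Q : Type*} [AddCommGroup Q] [Module ℂ Q] [TopologicalSpace Q]

/-- The curve `f` is differentiable at `x` with derivative `v`. -/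
def HasCurveDeriv (f : ℝ → Q) (v : Q) (x : ℝ) : Prop :=
  Tendsto (slope f x) (𝓝[≠] x) (𝓝 v)

theorem hasCurveDeriv_const [T2Space Q] (y : Q) (x : ℝ) : HasCurveDeriv (fun _ => y) 0 x := by
  have : slope (fun _ : ℝ => y) x = fun _ => 0 := by
    ext b; simp [slope_def_module]
  rw [HasCurveDeriv, this]
  exact tendsto_const_nhds

theorem HasCurveDeriv.map {Q' : Type*} [AddCommGroup Q'] [Module ℂ Q'] [TopologicalSpace Q']
    {f : ℝ → Q} {v : Q} {x : ℝ} (h : HasCurveDeriv f v x) (m : Q →L[ℂ] Q') :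
    HasCurveDeriv (fun t => m (f t)) (m v) x := by
  have : slope (fun t => m (f t)) x = fun b => m (slope f x b) := by
    ext b
    rw [slope_def_module, slope_def_module, ← map_sub, ← Complex.coe_smul, ← Complex.coe_smul,
      map_smul]
  rw [HasCurveDeriv, this]
  exact (m.continuous.tendsto v).comp h

theorem HasCurveDeriv.hasDerivAt {f : ℝ → Q} {v : Q} {x : ℝ} (h : HasCurveDeriv f v x)
    (φ : Q →L[ℂ] ℂ) : HasDerivAt (fun t => φ (f t)) (φ v) x :=
  hasDerivAt_iff_tendsto_slope.2 (h.map φ)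

/-- The derivative of the reflected curve `t ↦ f (s - t)`. -/
theorem HasCurveDeriv.comp_const_sub [IsTopologicalAddGroup Q] {f : ℝ → Q} {v : Q} {s x : ℝ}
    (h : HasCurveDeriv f v (s - x)) : HasCurveDeriv (fun t => f (s - t)) (-v) x := by
  have h1 : slope (fun t => f (s - t)) x = fun b => -slope f (s - x) (s - b) := by
    ext b
    rw [slope_def_module, slope_def_module, show s - b - (s - x) = -(b - x) by ring, inv_neg,
      neg_smul, neg_neg]
  have h2 : Tendsto (fun b => s - b) (𝓝[≠] x) (𝓝[≠] (s - x)) := by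
    refine tendsto_nhdsWithin_iff.2 ⟨?_, ?_⟩
    · exact ((continuous_const.sub continuous_id).tendsto x).mono_left nhdsWithin_le_nhds
    · filter_upwards [self_mem_nhdsWithin] with b hb
      simpa [eq_comm] using hb
  rw [HasCurveDeriv, h1]
  exact (h.comp h2).neg

theorem integral_eq_sub_of_hasCurveDeriv {G G' : ℝ → Q} {s : ℝ} (hs : 0 ≤ s)
    (hG : ContinuousOn G (Set.Icc 0 s)) (hG' : ContinuousOn G' (Set.Icc 0 s))
    (h : ∀ r ∈ Set.Ioo 0 s, HasCurveDeriv G (G' r) r) (φ : Q →L[ℂ] ℂ) :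
    ∫ r in (0 : ℝ)..s, φ (G' r) = φ (G s) - φ (G 0) := by
  refine intervalIntegral.integral_eq_sub_of_hasDerivAt_of_le hs
    (φ.continuous.comp_continuousOn hG) (fun r hr => (h r hr).hasDerivAt φ) ?_
  refine ContinuousOn.intervalIntegrable ?_
  rw [Set.uIcc_of_le hs]
  exact φ.continuous.comp_continuousOn hG'

end Curves

/-! ### Algebras with sequentially continuous product -/

/-- A Hausdorff locally convex topology on a complex algebra for which the product is sequentially
continuous and continuous curves on the unit interval have weak integrals. -/
class SeqLCAlgebra (Q : Type*) [Ring Q] [Algebra ℂ Q] [TopologicalSpace Q] : Prop extends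
    T2Space Q, IsTopologicalAddGroup Q, ContinuousSMul ℂ Q, LocallyConvexSpace ℝ Q where
  tendsto_mul : ∀ (x y : ℕ → Q) (a b : Q), Tendsto x atTop (𝓝 a) → Tendsto y atTop (𝓝 b) →
    Tendsto (fun k => x k * y k) atTop (𝓝 (a * b))
  exists_weakIntegral : ∀ f : ℝ → Q, ContinuousOn f (Set.Icc 0 1) → ∃ y, IsWeakIntegral f y

section SeqLCAlgebra

variable {Q : Type*} [Ring Q] [Algebra ℂ Q] [TopologicalSpace Q] [SeqLCAlgebra Q]

theorem tendsto_mul_of_isCountablyGenerated {X : Type*} {l : Filter X} [l.IsCountablyGenerated]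
    {f g : X → Q} {a b : Q} (hf : Tendsto f l (𝓝 a)) (hg : Tendsto g l (𝓝 b)) :
    Tendsto (fun x => f x * g x) l (𝓝 (a * b)) :=
  tendsto_of_seq_tendsto fun _ hx =>
    SeqLCAlgebra.tendsto_mul _ _ a b (hf.comp hx) (hg.comp hx)

theorem continuous_curve_mul {X : Type*} [TopologicalSpace X] [FirstCountableTopology X]
    {f g : X → Q} (hf : Continuous f) (hg : Continuous g) : Continuous fun x => f x * g x :=
  continuous_iff_continuousAt.2 fun x =>
    tendsto_mul_of_isCountablyGenerated (hf.tendsto x) (hg.tendsto x)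

theorem HasCurveDeriv.tendsto {f : ℝ → Q} {v : Q} {x : ℝ} (h : HasCurveDeriv f v x) :
    Tendsto f (𝓝[≠] x) (𝓝 (f x)) := by
  have : ContinuousSMul ℝ Q := IsScalarTower.continuousSMul ℂ
  have h1 : Tendsto (fun y : ℝ => y - x) (𝓝[≠] x) (𝓝 0) := by
    have := (continuous_id.sub continuous_const : Continuous fun y : ℝ => y - x).tendsto x
    rw [Pi.sub_apply, id, sub_self] at this
    exact this.mono_left nhdsWithin_le_nhds
  have h2 := (h1.smul h).add_const (f x)
  rw [zero_smul, zero_add] at h2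
  refine h2.congr fun y => ?_
  rw [sub_smul_slope, vsub_eq_sub, sub_add_cancel]

theorem HasCurveDeriv.mul {f g : ℝ → Q} {v w : Q} {x : ℝ} (hf : HasCurveDeriv f v x)
    (hg : HasCurveDeriv g w x) :
    HasCurveDeriv (fun t => f t * g t) (v * g x + f x * w) x := by
  have h : slope (fun t => f t * g t) x = fun y => slope f x y * g y + f x * slope g x y := by
    ext y
    simp only [slope_def_module, smul_mul_assoc, mul_smul_comm, ← smul_add, sub_mul, mul_sub]
    congr 1
    abel
  rw [HasCurveDeriv, h]
  exact (tendsto_mul_of_isCountablyGenerated hf hg.tendsto).add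
    (tendsto_mul_of_isCountablyGenerated tendsto_const_nhds hg)

theorem HasCurveDeriv.const_mul {f : ℝ → Q} {v : Q} {x : ℝ} (hf : HasCurveDeriv f v x) (a : Q) :
    HasCurveDeriv (fun t => a * f t) (a * v) x := by
  simpa using (hasCurveDeriv_const a x).mul hf

theorem isWeakIntegral_of_continuous {f : ℝ → Q} (hf : Continuous f) :
    IsWeakIntegral f (weakIntegral f) :=
  isWeakIntegral_weakIntegral (SeqLCAlgebra.exists_weakIntegral f hf.continuousOn)

theorem continuous_weakIntegral {X : Type*} [TopologicalSpace X] {f : X → ℝ → Q}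
    (hf : Continuous fun p : X × ℝ => f p.1 p.2) : Continuous fun x => weakIntegral (f x) :=
  continuous_of_isWeakIntegral hf fun _ =>
    isWeakIntegral_of_continuous (hf.comp (continuous_const.prodMk continuous_id))

end SeqLCAlgebra

/-! ### Exponential curves -/

open Nat in
/-- Termwise differentiation of an exponential-type series which is only known to converge on the
unit interval. -/
theorem hasDerivAt_of_tendsto_exp_series {c : ℕ → ℂ} {u v : ℝ → ℂ}
    (hu : ∀ s ∈ Set.Icc (0 : ℝ) 1,
      Tendsto (fun N => ∑ j ∈ Finset.range N, ((j ! : ℂ))⁻¹ * ((-(s : ℂ)) ^ j * c j)) atTop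
        (𝓝 (u s)))
    (hv : ∀ s ∈ Set.Icc (0 : ℝ) 1,
      Tendsto (fun N => ∑ j ∈ Finset.range N, ((j ! : ℂ))⁻¹ * ((-(s : ℂ)) ^ j * c (j + 1))) atTop
        (𝓝 (v s)))
    {s : ℝ} (hs : s ∈ Set.Ioo (0 : ℝ) 1) : HasDerivAt u (-v s) s := by
  set g : ℕ → ℝ → ℂ := fun j y => ((j ! : ℂ))⁻¹ * ((-(y : ℂ)) ^ j * c j) with hg
  set g' : ℕ → ℝ → ℂ := fun j y => ((j ! : ℂ))⁻¹ * (((j : ℂ) * (-(y : ℂ)) ^ (j - 1) * (-1)) * c j)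
    with hg'
  -- convergence at the end point `1` bounds the coefficients
  obtain ⟨M, hM⟩ : ∃ M : ℝ, ∀ j, ‖((j ! : ℂ))⁻¹ * c j‖ ≤ M := by
    have h1 := hu 1 (by simp)
    have h2 : Tendsto (fun N => g N 1) atTop (𝓝 0) := by
      have h3 := (h1.comp (tendsto_add_atTop_nat 1)).sub h1
      rw [sub_self] at h3
      refine h3.congr fun N => ?_
      simp [Finset.sum_range_succ, hg]
    obtain ⟨M, hM⟩ := h2.norm.bddAbove_range
    refine ⟨M, fun j => ?_⟩
    have := hM ⟨j, rfl⟩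
    simpa [hg] using this
  have hM0 : 0 ≤ M := (norm_nonneg _).trans (hM 0)
  obtain ⟨r, hsr, hr1⟩ := exists_between hs.2
  have hr0 : 0 < r := hs.1.trans hsr
  have hrn : ‖r‖ < 1 := by rwa [Real.norm_of_nonneg hr0.le]
  have hbound : ∀ j, ∀ y ∈ Set.Ioo 0 r, ‖g' j y‖ ≤ M / r * ((j : ℝ) ^ 1 * r ^ j) := by
    intro j y hy
    have e1 : ‖g' j y‖ = ‖((j ! : ℂ))⁻¹ * c j‖ * (j * y ^ (j - 1)) := by
      simp only [hg', norm_mul, norm_pow, norm_neg, norm_one, Complex.norm_natCast,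
        Complex.norm_real, Real.norm_of_nonneg hy.1.le]
      ring
    rw [e1]
    have e2 : (j : ℝ) * y ^ (j - 1) ≤ r⁻¹ * ((j : ℝ) ^ 1 * r ^ j) := by
      rcases j with _ | j
      · simp
      · have : r⁻¹ * (((j + 1 : ℕ) : ℝ) ^ 1 * r ^ (j + 1)) = ((j + 1 : ℕ) : ℝ) * r ^ j := by
          field_simp
          ring
        rw [this, Nat.add_sub_cancel]
        gcongr
        · exact hy.1.le
        · exact hy.2.le
    calc _ ≤ M * (r⁻¹ * ((j : ℝ) ^ 1 * r ^ j)) := by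
            gcongr
            · exact mul_nonneg (by positivity) (pow_nonneg hy.1.le _)
            · exact hM j
      _ = _ := by ring
  have hsum : Summable fun j : ℕ => M / r * ((j : ℝ) ^ 1 * r ^ j) :=
    (summable_pow_mul_geometric_of_norm_lt_one 1 hrn).mul_left _
  have hgsum : ∀ y ∈ Set.Ioo 0 r, Summable fun j => g j y := by
    intro y hy
    refine Summable.of_norm_bounded (g := fun j => M * y ^ j)
      ((summable_geometric_of_lt_one hy.1.le (hy.2.trans hr1)).mul_left _) fun j => ?_
    have : ‖g j y‖ = ‖((j ! : ℂ))⁻¹ * c j‖ * y ^ j := by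
      simp only [hg, norm_mul, norm_pow, norm_neg, Complex.norm_real,
        Real.norm_of_nonneg hy.1.le]
      ring
    rw [this]
    exact mul_le_mul_of_nonneg_right (hM j) (pow_nonneg hy.1.le _)
  have hsmem : s ∈ Set.Ioo 0 r := ⟨hs.1, hsr⟩
  have hmain := hasDerivAt_tsum_of_isPreconnected (g := g) (g' := g') (y₀ := s) (y := s) hsum
    isOpen_Ioo isPreconnected_Ioo (fun j y _ => by
      have h1 : HasDerivAt (fun y : ℝ => -(y : ℂ)) (-1) y := (Complex.ofRealCLM.hasDerivAt).neg
      exact ((h1.pow j).mul_const (c j)).const_mul _) hbound hsmem (hgsum s hsmem) hsmem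
  have hval : (∑' j, g' j s) = -v s := by
    have h1 : Summable fun j => g' j s :=
      Summable.of_norm_bounded hsum fun j => hbound j s hsmem
    have h2 := h1.hasSum.tendsto_sum_nat.comp (tendsto_add_atTop_nat 1)
    refine tendsto_nhds_unique h2 ?_
    refine (hv s ⟨hs.1.le, hs.2.le⟩).neg.congr fun N => ?_
    simp only [Function.comp_apply, Finset.sum_range_succ']
    rw [← Finset.sum_neg_distrib]
    have h0 : g' 0 s = 0 := by simp [hg']
    rw [h0, add_zero]
    refine Finset.sum_congr rfl fun j _ => ?_
    have hj : ((j + 1 : ℕ) : ℂ) ≠ 0 := by exact_mod_cast Nat.succ_ne_zero j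
    simp only [hg', Nat.factorial_succ, Nat.add_sub_cancel, Nat.cast_mul]
    field_simp
  rw [hval] at hmain
  refine hmain.congr_of_eventuallyEq ?_
  filter_upwards [Ioo_mem_nhds hsmem.1 hsmem.2] with y hy
  exact tendsto_nhds_unique (hu y ⟨hy.1.le, (hy.2.trans hr1).le⟩)
    (hgsum y hy).hasSum.tendsto_sum_nat

section ExpCurve

variable {Q : Type*} [Ring Q] [Algebra ℂ Q] [TopologicalSpace Q]

/-- `E` is a continuous curve whose value at `s ∈ [0, 1]` is the sum of the exponential series of
`-s F`; the values of `E` outside `[0, 1]` do not matter. -/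
structure IsExpCurve (F : Q) (E : ℝ → Q) : Prop where
  continuous : Continuous E
  tendsto : ∀ s ∈ Set.Icc (0 : ℝ) 1, Tendsto (expPartial (-(s : ℂ) • F)) atTop (𝓝 (E s))

theorem expPartial_smul {Q : Type*} [Ring Q] [Algebra ℂ Q] (z : ℂ) (F : Q) (N : ℕ) :
    expPartial (z • F) N = ∑ j ∈ Finset.range N, ((j.factorial : ℂ)⁻¹ * z ^ j) • F ^ j := by
  simp [expPartial, smul_pow, smul_smul]

theorem tendsto_expPartial_zero : Tendsto (expPartial (0 : Q)) atTop (𝓝 1) := by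
  refine tendsto_const_nhds.congr' ?_
  filter_upwards [eventually_ge_atTop 1] with N hN
  obtain ⟨N, rfl⟩ := Nat.exists_eq_add_of_le' hN
  simp [expPartial, Finset.sum_range_succ']

theorem IsExpCurve.zero_eq [T2Space Q] {F : Q} {E : ℝ → Q} (h : IsExpCurve F E) : E 0 = 1 := by
  have := h.tendsto 0 (by simp)
  simp only [Complex.ofReal_zero, neg_zero, zero_smul] at this
  exact tendsto_nhds_unique this tendsto_expPartial_zero

/-- A sequentially closed subspace containing the powers of `F` contains the exponentials. -/
theorem IsExpCurve.mem {F : Q} {E : ℝ → Q} (h : IsExpCurve F E) (S : Submodule ℂ Q)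
    (hS : IsSeqClosed (S : Set Q)) (hF : ∀ j, F ^ j ∈ S) {s : ℝ} (hs : s ∈ Set.Icc (0 : ℝ) 1) :
    E s ∈ S :=
  hS (fun N => by
    rw [expPartial_smul]
    exact S.sum_mem fun j _ => S.smul_mem _ (hF j)) (h.tendsto s hs)

variable [SeqLCAlgebra Q]

theorem IsExpCurve.commute {F : Q} {E : ℝ → Q} (h : IsExpCurve F E) {s : ℝ}
    (hs : s ∈ Set.Icc (0 : ℝ) 1) : F * E s = E s * F := by
  let S : Submodule ℂ Q := LinearMap.ker (LinearMap.mulLeft ℂ F - LinearMap.mulRight ℂ F)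
  have hS : ∀ x, x ∈ S ↔ F * x = x * F := fun x => by simp [S, sub_eq_zero]
  refine (hS _).1 (h.mem S ?_ (fun j => (hS _).2 ?_) hs)
  · intro x a hx ha
    refine (hS _).2 (tendsto_nhds_unique
      (SeqLCAlgebra.tendsto_mul _ _ _ _ (tendsto_const_nhds (x := F)) ha) ?_)
    exact (SeqLCAlgebra.tendsto_mul _ _ _ _ ha (tendsto_const_nhds (x := F))).congr
      fun k => ((hS _).1 (hx k)).symm
  · exact (pow_succ' F j).symm.trans (pow_succ F j)

theorem IsExpCurve.continuous_mul {F : Q} {E : ℝ → Q} (h : IsExpCurve F E) :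
    Continuous fun s => F * E s :=
  continuous_curve_mul continuous_const h.continuous

theorem IsExpCurve.hasCurveDeriv {F : Q} {E : ℝ → Q} (h : IsExpCurve F E) {s : ℝ}
    (hs : s ∈ Set.Ioo (0 : ℝ) 1) : HasCurveDeriv E (-(F * E s)) s := by
  refine tendsto_slope_of_weak_deriv (v := fun s => -(F * E s)) ?_
    h.continuous_mul.neg.continuousAt
  filter_upwards [Ioo_mem_nhds hs.1 hs.2] with y hy φ
  rw [map_neg]
  refine hasDerivAt_of_tendsto_exp_series (c := fun j => φ (F ^ j)) (v := fun s => φ (F * E s))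
    (fun s hs => ?_) (fun s hs => ?_) hy
  · refine ((φ.continuous.tendsto _).comp (h.tendsto s hs)).congr fun N => ?_
    rw [Function.comp_apply, expPartial_smul]
    simp [map_sum, mul_assoc]
  · refine ((φ.continuous.tendsto _).comp (SeqLCAlgebra.tendsto_mul _ _ _ _
      (tendsto_const_nhds (x := F)) (h.tendsto s hs))).congr fun N => ?_
    rw [Function.comp_apply, expPartial_smul]
    simp [map_sum, Finset.mul_sum, pow_succ', mul_assoc]

/-- Duhamel's formula for two exponential curves. -/
theorem IsExpCurve.duhamel {F F' : Q} {E E' : ℝ → Q} (h : IsExpCurve F E) (h' : IsExpCurve F' E')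
    (a : Q) {s : ℝ} (hs : s ∈ Set.Icc (0 : ℝ) 1) (φ : Q →L[ℂ] ℂ) :
    φ (a * (E' s - E s)) = ∫ r in (0 : ℝ)..s, φ (a * E (s - r) * (F - F') * E' r) := by
  have hc : Continuous fun r => E (s - r) := h.continuous.comp (continuous_const.sub continuous_id)
  have hc1 := continuous_curve_mul (continuous_const (y := a)) hc
  have key := integral_eq_sub_of_hasCurveDeriv (G := fun r => a * E (s - r) * E' r)
    (G' := fun r => a * E (s - r) * (F - F') * E' r) hs.1
    (continuous_curve_mul hc1 h'.continuous).continuousOn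
    (continuous_curve_mul (continuous_curve_mul hc1 continuous_const) h'.continuous).continuousOn
    (fun r hr => ?_) φ
  · rw [key, sub_self, sub_zero, h.zero_eq, h'.zero_eq, mul_one, mul_one, mul_sub, map_sub]
  · have hr1 : r ∈ Set.Ioo (0 : ℝ) 1 := ⟨hr.1, hr.2.trans_le hs.2⟩
    have hr2 : s - r ∈ Set.Ioo (0 : ℝ) 1 := ⟨sub_pos.2 hr.2, by linarith [hs.2, hr.1]⟩
    have := ((h.hasCurveDeriv hr2).comp_const_sub.const_mul a).mul (h'.hasCurveDeriv hr1)
    convert this using 1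
    rw [neg_neg, h.commute ⟨hr2.1.le, hr2.2.le⟩]
    noncomm_ring

theorem IsExpCurve.mul_eq {F : Q} {E : ℝ → Q} (h : IsExpCurve F E) {r s : ℝ}
    (hr : 0 ≤ r) (hrs : r ≤ s) (hs : s ≤ 1) : E (s - r) * E r = E s := by
  refine eq_of_forall_functional_eq fun φ => ?_
  have key := integral_eq_sub_of_hasCurveDeriv (G := fun q => E (s - q) * E q)
    (G' := fun _ => 0) hr
    (continuous_curve_mul (h.continuous.comp (continuous_const.sub continuous_id))
      h.continuous).continuousOn continuousOn_const (fun q hq => ?_) φ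
  · have := sub_eq_zero.1 (key.symm.trans (by simp))
    simpa [h.zero_eq] using this
  · have hq1 : q ∈ Set.Ioo (0 : ℝ) 1 := ⟨hq.1, hq.2.trans_le (hrs.trans hs)⟩
    have hq2 : s - q ∈ Set.Ioo (0 : ℝ) 1 :=
      ⟨sub_pos.2 (hq.2.trans_le hrs), by linarith [hq.1]⟩
    have := (h.hasCurveDeriv hq2).comp_const_sub.mul (h.hasCurveDeriv hq1)
    convert this using 1
    rw [neg_neg, h.commute ⟨hq2.1.le, hq2.2.le⟩]
    noncomm_ring

/-- Duhamel's formula for the value of a continuous derivation on an exponential curve. -/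
theorem IsExpCurve.integral_derivation {F : Q} {E : ℝ → Q} (h : IsExpCurve F E) (P : Q →L[ℂ] Q)
    (hP : ∀ x y, P (x * y) = P x * y + x * P y) (a : Q) {s : ℝ} (hs : s ∈ Set.Icc (0 : ℝ) 1)
    (φ : Q →L[ℂ] ℂ) :
    ∫ r in (0 : ℝ)..s, φ (a * E r * P F * E (s - r)) = -φ (a * P (E s)) := by
  have hP1 : P 1 = 0 := by simpa using hP 1 1
  have hc : Continuous fun r => E (s - r) := h.continuous.comp (continuous_const.sub continuous_id)
  have hc1 := continuous_curve_mul (continuous_const (y := a)) h.continuous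
  have key := integral_eq_sub_of_hasCurveDeriv (G := fun r => a * E r * P (E (s - r)))
    (G' := fun r => a * E r * P F * E (s - r)) hs.1
    (continuous_curve_mul hc1 (P.continuous.comp hc)).continuousOn
    (continuous_curve_mul (continuous_curve_mul hc1 continuous_const) hc).continuousOn
    (fun r hr => ?_) φ
  · rw [key]
    simp [h.zero_eq, hP1]
  · have hr1 : r ∈ Set.Ioo (0 : ℝ) 1 := ⟨hr.1, hr.2.trans_le hs.2⟩
    have hr2 : s - r ∈ Set.Ioo (0 : ℝ) 1 := ⟨sub_pos.2 hr.2, by linarith [hs.2, hr.1]⟩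
    have := ((h.hasCurveDeriv hr1).const_mul a).mul ((h.hasCurveDeriv hr2).comp_const_sub.map P)
    convert this using 1
    rw [neg_neg, hP, h.commute ⟨hr1.1.le, hr1.2.le⟩]
    noncomm_ring

end ExpCurve

/-! ### Truncated differential graded algebras with a graded trace -/

/-- A differential `ℤ/2`-graded algebra whose forms have degree at most one, with a graded trace:
`d` is the differential, `P` the projection onto the forms of degree one, `ε` the grading operator
(`1` on even elements, `-1` on odd elements), and `τ` a graded trace supported on the forms of
degree one. -/
structure TracedForms (Q V : Type*) [Ring Q] [Algebra ℂ Q] [AddCommGroup V] [Module ℂ V] where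
  /-- The differential. -/
  d : Q →ₗ[ℂ] Q
  /-- The projection onto the forms of degree one. -/
  P : Q →ₗ[ℂ] Q
  /-- The grading operator. -/
  ε : Q →ₗ[ℂ] Q
  /-- The graded trace. -/
  τ : Q →ₗ[ℂ] V
  d_mul : ∀ x y, d (x * y) = d x * y + ε x * d y
  P_mul : ∀ x y, P (x * y) = P x * y + x * P y
  ε_one : ε 1 = 1
  ε_mul : ∀ x y, ε (x * y) = ε x * ε y
  P_d : ∀ x, P (d x) = d x
  d_P : ∀ x, d (P x) = 0
  P_mul_P : ∀ x y, P x * P y = 0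
  ε_d : ∀ x, ε (d x) = -d (ε x)
  τ_P : ∀ x, τ (P x) = τ x
  τ_mul : ∀ x y, (2 : ℂ) • τ (x * y) = τ (y * x) + τ (y * ε x) + τ (ε y * x) - τ (ε y * ε x)

namespace TracedForms

variable {Q V : Type*} [Ring Q] [Algebra ℂ Q] [AddCommGroup V] [Module ℂ V] (T : TracedForms Q V)

theorem d_d (x : Q) : T.d (T.d x) = 0 := by rw [← T.P_d x, T.d_P]

theorem τ_mul_comm {x : Q} (hx : T.ε x = x) (y : Q) : T.τ (x * y) = T.τ (y * x) := by
  have h := T.τ_mul x y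
  rw [hx, add_sub_assoc, sub_self, add_zero, ← two_smul ℂ] at h
  exact smul_right_injective V (two_ne_zero (α := ℂ)) h

/-- The components of the potentials `D + c (β + ω)`: odd elements `D` and `β` of form degree zero,
and an odd one-form `ω`. -/
structure IsPotential (D β ω : Q) : Prop where
  ε_D : T.ε D = -D
  ε_β : T.ε β = -β
  ε_ω : T.ε ω = -ω
  P_D : T.P D = 0
  P_β : T.P β = 0
  P_ω : T.P ω = ω

/-- The curvature `dρ + ρ²`. -/
def curv (ρ : Q) : Q := T.d ρ + ρ * ρ

variable {T} {D β ω : Q}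

theorem ε_curv {ρ : Q} (hρ : T.ε ρ = -ρ) : T.ε (T.curv ρ) = T.curv ρ := by
  rw [curv, map_add, T.ε_mul, T.ε_d, hρ, map_neg, neg_neg, neg_mul_neg]

/-- The Bianchi identity. -/
theorem d_curv {ρ : Q} (hρ : T.ε ρ = -ρ) :
    T.d (T.curv ρ) = T.curv ρ * ρ - ρ * T.curv ρ := by
  rw [curv, map_add, T.d_mul, T.d_d, hρ]
  noncomm_ring

theorem d_curv_pow {ρ : Q} (hρ : T.ε ρ = -ρ) (j : ℕ) :
    T.d (T.curv ρ ^ j) = T.curv ρ ^ j * ρ - ρ * T.curv ρ ^ j := by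
  induction j with
  | zero =>
    have h : T.d (1 : Q) = 0 := by simpa [T.ε_one] using T.d_mul 1 1
    simp [h]
  | succ j ih =>
    rw [pow_succ', T.d_mul, ih, d_curv hρ, ε_curv hρ]
    noncomm_ring

theorem ε_curv_pow {ρ : Q} (hρ : T.ε ρ = -ρ) (j : ℕ) : T.ε (T.curv ρ ^ j) = T.curv ρ ^ j := by
  induction j with
  | zero => simp [T.ε_one]
  | succ j ih => rw [pow_succ, T.ε_mul, ih, ε_curv hρ]

theorem P_pow {F : Q} (hF : T.P F = 0) (j : ℕ) : T.P (F ^ j) = 0 := by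
  induction j with
  | zero => simpa using T.P_mul 1 1
  | succ j ih => rw [pow_succ, T.P_mul, ih, hF, zero_mul, mul_zero, add_zero]

theorem curv_add_smul (ρ N : Q) (c : ℂ) :
    T.curv (ρ + c • N) = T.curv ρ + c • (T.d N + ρ * N + N * ρ + c • (N * N)) := by
  simp only [curv, map_add, map_smul, mul_add, add_mul, smul_mul_assoc, mul_smul_comm, smul_add]
  abel

/-- The covariant derivative of the component `D + c β` of degree zero of the potential
`D + c (β + ω)`. -/
theorem IsPotential.nabla (h : T.IsPotential D β ω) (c : ℂ) :
    T.d (D + c • β) + (D + c • (β + ω)) * (D + c • β) + (D + c • β) * (D + c • (β + ω)) =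
      (2 : ℂ) • T.curv (D + c • (β + ω)) - T.P (T.curv (D + c • (β + ω))) := by
  have hdω : T.d ω = 0 := by rw [← h.P_ω, T.d_P]
  have hωω : ω * ω = 0 := by simpa [h.P_ω] using T.P_mul_P ω ω
  have hPd : T.P (T.d (D + c • (β + ω))) = T.d (D + c • (β + ω)) := T.P_d _
  have hPρ : T.P (D + c • (β + ω)) = c • ω := by simp [h.P_D, h.P_β, h.P_ω]
  rw [curv, map_add T.P, hPd, T.P_mul, hPρ]
  simp only [map_add, map_smul, hdω, two_smul, smul_add, mul_add, add_mul, smul_mul_assoc,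
    mul_smul_comm, hωω, smul_zero, add_zero]
  abel

theorem IsPotential.ε_path (h : T.IsPotential D β ω) (c : ℂ) :
    T.ε (D + c • (β + ω)) = -(D + c • (β + ω)) := by
  simp only [map_add, map_smul, h.ε_D, h.ε_β, h.ε_ω]
  module

/-- A functional which vanishes on the kernel of the graded trace is a graded trace. -/
theorem functional_mul_comm {φ : Q →ₗ[ℂ] ℂ} (hφ : ∀ x, T.τ x = 0 → φ x = 0) {x : Q}
    (hx : T.ε x = x) (y : Q) : φ (x * y) = φ (y * x) := by
  rw [← sub_eq_zero, ← map_sub]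
  exact hφ _ (by rw [map_sub, T.τ_mul_comm hx, sub_self])

theorem functional_P {φ : Q →ₗ[ℂ] ℂ} (hφ : ∀ x, T.τ x = 0 → φ x = 0) (x : Q) :
    φ (T.P x) = φ x := by
  rw [← sub_eq_zero, ← map_sub]
  exact hφ _ (by rw [map_sub, T.τ_P, sub_self])

/-- The infinitesimal transgression formula. -/
theorem IsPotential.functional_d (h : T.IsPotential D β ω) {φ : Q →ₗ[ℂ] ℂ}
    (hφ : ∀ x, T.τ x = 0 → φ x = 0) (c : ℂ) {a ρ F X Z : Q} (ha : a = D + c • β)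
    (hρ : ρ = D + c • (β + ω)) (hF : F = T.curv ρ) (hX : T.ε X = X) (hZ : T.ε Z = Z)
    (hdX : T.d X = X * ρ - ρ * X) (hdZ : T.d Z = Z * ρ - ρ * Z)
    (hFZ : F * Z = Z * F) :
    φ (T.d (a * X * (β + ω) * Z)) =
      2 * φ ((β + ω) * F * (Z * X)) - φ ((β + ω) * Z * T.P F * X) -
        φ (a * X * (T.d (β + ω) + ρ * (β + ω) + (β + ω) * ρ) * Z) := by
  set N := β + ω with hN
  have hεN : T.ε N = -N := by rw [hN, map_add, h.ε_β, h.ε_ω, neg_add]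
  have hεa : T.ε a = -a := by rw [ha, map_add, map_smul, h.ε_β, h.ε_D, smul_neg, neg_add]
  have hερ : T.ε ρ = -ρ := by rw [hρ, map_add, map_smul, hεN, h.ε_D, smul_neg, neg_add]
  have hεF : T.ε F = F := by rw [hF]; exact ε_curv hερ
  have hεPF : T.ε (T.P F) = T.P F := by
    have h1 := h.nabla c
    rw [← ha, ← hρ, ← hF] at h1
    rw [eq_sub_iff_add_eq, ← eq_sub_iff_add_eq'] at h1
    rw [h1]
    simp only [map_sub, map_add, map_smul, T.ε_mul, T.ε_d, hεa, hερ, hεF, map_neg, neg_neg,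
      neg_mul_neg]
  have h1 : T.d (a * X * N * Z) = (T.d a + ρ * a + a * ρ) * X * N * Z -
      a * X * (T.d N + ρ * N + N * ρ) * Z + ((a * X * N * Z) * ρ - ρ * (a * X * N * Z)) := by
    simp only [T.d_mul, T.ε_mul, hεa, hX, hεN, hdX, hdZ]
    noncomm_ring
  have h2 : φ ((a * X * N * Z) * ρ - ρ * (a * X * N * Z)) = 0 := by
    rw [map_sub, functional_mul_comm hφ, sub_self]
    simp only [T.ε_mul, hεa, hX, hεN, hZ, neg_mul, mul_neg, neg_neg]
  have h3 : T.d a + ρ * a + a * ρ = (2 : ℂ) • F - T.P F := by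
    rw [ha, hρ, hF, hρ]; exact h.nabla c
  have h4 : φ (((2 : ℂ) • F - T.P F) * X * N * Z) =
      2 * φ (N * F * (Z * X)) - φ (N * Z * T.P F * X) := by
    have e1 : ((2 : ℂ) • F - T.P F) * X * N * Z = (((2 : ℂ) • F - T.P F) * X) * (N * Z) := by
      noncomm_ring
    rw [e1, functional_mul_comm hφ (by simp only [T.ε_mul, map_sub, map_smul, hεF, hεPF, hX])]
    have e2 : N * Z * (((2 : ℂ) • F - T.P F) * X) =
        (2 : ℂ) • (N * (Z * F) * X) - N * Z * T.P F * X := by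
      simp only [sub_mul, mul_sub, smul_mul_assoc, mul_smul_comm, mul_assoc]
    rw [e2, ← hFZ, map_sub, map_smul, smul_eq_mul]
    simp only [mul_assoc]
  rw [h1, map_add, h2, add_zero, map_sub, h3, h4]

theorem IsPotential.functional_mul_P (h : T.IsPotential D β ω) {φ : Q →ₗ[ℂ] ℂ}
    (hφ : ∀ x, T.τ x = 0 → φ x = 0) (x : Q) : φ ((β + ω) * T.P x) = φ (β * x) := by
  have h1 : ω * T.P x = 0 := by simpa [h.P_ω] using T.P_mul_P ω x
  rw [add_mul, h1, add_zero, ← functional_P hφ (β * x), T.P_mul, h.P_β, zero_mul, zero_add]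

end TracedForms

/-! ### The transgression formula -/

/-- Fubini's theorem for continuous functions on the unit square. -/
theorem integral_integral_swap_of_continuous {f : ℝ → ℝ → ℂ}
    (hf : Continuous fun p : ℝ × ℝ => f p.1 p.2) :
    ∫ s in (0 : ℝ)..1, ∫ t in (0 : ℝ)..1, f s t = ∫ t in (0 : ℝ)..1, ∫ s in (0 : ℝ)..1, f s t := by
  simp only [intervalIntegral.integral_of_le zero_le_one]
  refine MeasureTheory.integral_integral_swap ?_
  rw [MeasureTheory.Measure.prod_restrict]
  change MeasureTheory.IntegrableOn _ _ (MeasureTheory.volume : MeasureTheory.Measure (ℝ × ℝ))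
  exact (hf.continuousOn.integrableOn_compact (isCompact_Icc.prod isCompact_Icc)).mono_set
    (Set.prod_mono Set.Ioc_subset_Icc_self Set.Ioc_subset_Icc_self)

section Transgression

variable {Q : Type*} [Ring Q] [Algebra ℂ Q] [TopologicalSpace Q]

/-- The integrand `a e^{-(1-v)s∇²} N e^{-vs∇²}` of the transgression, where `a = D + t β` is the
component of degree zero of the potential and `E t s = e^{-s∇²}`. -/
def transgressionIntegrand (D β N : Q) (E : ℝ → ℝ → Q) (s t v : ℝ) : Q :=
  (D + (t : ℂ) • β) * E t (s - v * s) * N * E t (v * s)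

/-- The transgression, the integral of `a e^{-(1-v)s∇²} N e^{-vs∇²}` over the unit cube. -/
def transgression (D β N : Q) (E : ℝ → ℝ → Q) : Q :=
  weakIntegral fun s => weakIntegral fun t => weakIntegral fun v =>
    transgressionIntegrand D β N E s t v

variable [SeqLCAlgebra Q]

theorem continuous_linePath (x y : Q) : Continuous fun t : ℝ => x + (t : ℂ) • y :=
  continuous_const.add (Complex.continuous_ofReal.smul continuous_const)

section Continuity

variable {E : ℝ → ℝ → Q} (hE : Continuous fun p : ℝ × ℝ => E p.1 p.2)

include hE

theorem continuous_transgressionIntegrand (D β N : Q) :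
    Continuous fun p : (ℝ × ℝ) × ℝ => transgressionIntegrand D β N E p.1.1 p.1.2 p.2 := by
  have h1 : Continuous fun p : (ℝ × ℝ) × ℝ => D + (p.1.2 : ℂ) • β :=
    (continuous_linePath D β).comp (continuous_snd.comp continuous_fst)
  have h2 : Continuous fun p : (ℝ × ℝ) × ℝ => E p.1.2 (p.1.1 - p.2 * p.1.1) :=
    hE.comp (by fun_prop : Continuous fun p : (ℝ × ℝ) × ℝ => (p.1.2, p.1.1 - p.2 * p.1.1))
  have h3 : Continuous fun p : (ℝ × ℝ) × ℝ => E p.1.2 (p.2 * p.1.1) :=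
    hE.comp (by fun_prop : Continuous fun p : (ℝ × ℝ) × ℝ => (p.1.2, p.2 * p.1.1))
  exact continuous_curve_mul (continuous_curve_mul (continuous_curve_mul h1 h2) continuous_const) h3

theorem continuous_weakIntegral_transgressionIntegrand (D β N : Q) :
    Continuous fun p : ℝ × ℝ =>
      weakIntegral fun v => transgressionIntegrand D β N E p.1 p.2 v :=
  continuous_weakIntegral (continuous_transgressionIntegrand hE D β N)

theorem continuous_weakIntegral_weakIntegral_transgressionIntegrand (D β N : Q) :
    Continuous fun s : ℝ =>
      weakIntegral fun t => weakIntegral fun v => transgressionIntegrand D β N E s t v :=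
  continuous_weakIntegral (continuous_weakIntegral_transgressionIntegrand hE D β N)

theorem functional_transgression (D β N : Q) (φ : Q →L[ℂ] ℂ) :
    φ (transgression D β N E) = ∫ s in (0 : ℝ)..1, ∫ t in (0 : ℝ)..1,
      φ (weakIntegral fun v => transgressionIntegrand D β N E s t v) := by
  have h1 := continuous_weakIntegral_transgressionIntegrand hE D β N
  rw [transgression, ← (isWeakIntegral_of_continuous
    (continuous_weakIntegral_weakIntegral_transgressionIntegrand hE D β N) φ).2]
  refine intervalIntegral.integral_congr fun s _ => ?_
  exact (isWeakIntegral_of_continuous (h1.comp (by fun_prop : Continuous fun t => (s, t))) φ).2.symm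

theorem mul_functional_transgressionIntegrand (D β N : Q) (φ : Q →L[ℂ] ℂ) (s t : ℝ) :
    (s : ℂ) * φ (weakIntegral fun v => transgressionIntegrand D β N E s t v) =
      ∫ r in (0 : ℝ)..s, φ ((D + (t : ℂ) • β) * E t (s - r) * N * E t r) := by
  have hc : Continuous fun v => transgressionIntegrand D β N E s t v :=
    (continuous_transgressionIntegrand hE D β N).comp
      (by fun_prop : Continuous fun v => ((s, t), v))
  rw [← (isWeakIntegral_of_continuous hc φ).2]
  have := intervalIntegral.smul_integral_comp_mul_right (a := 0) (b := 1)
    (fun r => φ ((D + (t : ℂ) • β) * E t (s - r) * N * E t r)) s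
  rw [zero_mul, one_mul] at this
  rw [← this, Complex.real_smul]
  rfl

end Continuity

namespace TracedForms

variable {V : Type*} [AddCommGroup V] [Module ℂ V]

/-- The operations are continuous and the kernel of the trace is closed. -/
structure IsContinuous (T : TracedForms Q V) : Prop where
  d : Continuous T.d
  P : Continuous T.P
  ε : Continuous T.ε
  τ : IsClosed (LinearMap.ker T.τ : Set Q)

variable {T : TracedForms Q V} (hT : T.IsContinuous) {D β ω : Q} (h : T.IsPotential D β ω)
  {E : ℝ → ℝ → Q} (hE : Continuous fun p : ℝ × ℝ => E p.1 p.2)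
  (hexp : ∀ t ∈ Set.Icc (0 : ℝ) 1, IsExpCurve (T.curv (D + (t : ℂ) • (β + ω))) (E t))

theorem d_expCurve (hd : Continuous T.d) {ρ : Q} (hρ : T.ε ρ = -ρ) {e : ℝ → Q}
    (he : IsExpCurve (T.curv ρ) e) {s : ℝ} (hs : s ∈ Set.Icc (0 : ℝ) 1) :
    T.d (e s) = e s * ρ - ρ * e s := by
  let S : Submodule ℂ Q :=
    LinearMap.ker (T.d - (LinearMap.mulRight ℂ ρ - LinearMap.mulLeft ℂ ρ))
  have hS : ∀ x, x ∈ S ↔ T.d x = x * ρ - ρ * x := fun x => by simp [S, sub_eq_zero]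
  refine (hS _).1 (he.mem S ?_ (fun j => (hS _).2 (d_curv_pow hρ j)) hs)
  intro x a hx ha
  refine (hS _).2 (tendsto_nhds_unique ((hd.tendsto a).comp ha) ?_)
  refine ((SeqLCAlgebra.tendsto_mul _ _ _ _ ha (tendsto_const_nhds (x := ρ))).sub
    (SeqLCAlgebra.tendsto_mul _ _ _ _ (tendsto_const_nhds (x := ρ)) ha)).congr fun k => ?_
  exact ((hS _).1 (hx k)).symm

theorem ε_expCurve (hε : Continuous T.ε) {ρ : Q} (hρ : T.ε ρ = -ρ) {e : ℝ → Q}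
    (he : IsExpCurve (T.curv ρ) e) {s : ℝ} (hs : s ∈ Set.Icc (0 : ℝ) 1) : T.ε (e s) = e s := by
  let S : Submodule ℂ Q := LinearMap.ker (T.ε - LinearMap.id)
  have hS : ∀ x, x ∈ S ↔ T.ε x = x := fun x => by simp [S, sub_eq_zero]
  refine (hS _).1 (he.mem S ?_ (fun j => (hS _).2 (ε_curv_pow hρ j)) hs)
  have : IsClosed (S : Set Q) := by
    have : (S : Set Q) = {x | T.ε x = x} := Set.ext hS
    rw [this]
    exact isClosed_eq hε continuous_id
  exact this.isSeqClosed

theorem P_expCurve (hP : Continuous T.P) {F : Q} (hF : T.P F = 0) {e : ℝ → Q}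
    (he : IsExpCurve F e) {s : ℝ} (hs : s ∈ Set.Icc (0 : ℝ) 1) : T.P (e s) = 0 :=
  he.mem (LinearMap.ker T.P) (isClosed_singleton.preimage hP).isSeqClosed (P_pow hF) hs

theorem continuous_curv_path (D N : Q) : Continuous fun t : ℝ => T.curv (D + (t : ℂ) • N) := by
  simp only [curv_add_smul]
  exact continuous_const.add (Complex.continuous_ofReal.smul (continuous_linePath _ _))

include hT h hexp

/-- The integral over `[0, s]` of the infinitesimal transgression formula. -/
theorem integral_functional_d {φ : Q →L[ℂ] ℂ} (hφ : ∀ x, T.τ x = 0 → φ x = 0) {s t : ℝ}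
    (hs : s ∈ Set.Icc (0 : ℝ) 1) (ht : t ∈ Set.Icc (0 : ℝ) 1) :
    ∫ r in (0 : ℝ)..s, φ (T.d ((D + (t : ℂ) • β) * E t (s - r) * (β + ω) * E t r)) =
      2 * s * φ ((β + ω) * T.curv (D + (t : ℂ) • (β + ω)) * E t s) + φ (β * E t s) -
        ∫ r in (0 : ℝ)..s, φ ((D + (t : ℂ) • β) * E t (s - r) *
          (T.d (β + ω) + (D + (t : ℂ) • (β + ω)) * (β + ω) +
            (β + ω) * (D + (t : ℂ) • (β + ω))) * E t r) := by
  have he := hexp t ht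
  have hερ := h.ε_path (t : ℂ)
  set ρ := D + (t : ℂ) • (β + ω) with hρ
  set N := β + ω with hN
  have hc : Continuous fun r => E t (s - r) :=
    he.continuous.comp (continuous_const.sub continuous_id)
  have hc1 : Continuous fun r => φ (N * E t r * T.P (T.curv ρ) * E t (s - r)) :=
    φ.continuous.comp (continuous_curve_mul (continuous_curve_mul
      (continuous_curve_mul continuous_const he.continuous) continuous_const) hc)
  have hc2 : Continuous fun r => φ ((D + (t : ℂ) • β) * E t (s - r) *
      (T.d N + ρ * N + N * ρ) * E t r) :=
    φ.continuous.comp (continuous_curve_mul (continuous_curve_mul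
      (continuous_curve_mul continuous_const hc) continuous_const) he.continuous)
  have hc3 : Continuous fun r => 2 * φ (N * T.curv ρ * E t s) -
      φ (N * E t r * T.P (T.curv ρ) * E t (s - r)) := continuous_const.sub hc1
  have hpt : ∀ r ∈ Set.uIcc 0 s, φ (T.d ((D + (t : ℂ) • β) * E t (s - r) * N * E t r)) =
      2 * φ (N * T.curv ρ * E t s) - φ (N * E t r * T.P (T.curv ρ) * E t (s - r)) -
        φ ((D + (t : ℂ) • β) * E t (s - r) * (T.d N + ρ * N + N * ρ) * E t r) := by
    intro r hr
    rw [Set.uIcc_of_le hs.1] at hr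
    have hr1 : r ∈ Set.Icc (0 : ℝ) 1 := ⟨hr.1, hr.2.trans hs.2⟩
    have hr2 : s - r ∈ Set.Icc (0 : ℝ) 1 := ⟨sub_nonneg.2 hr.2, by linarith [hs.2, hr.1]⟩
    have key := h.functional_d (φ := (φ : Q →ₗ[ℂ] ℂ)) hφ (t : ℂ) rfl hρ rfl
      (ε_expCurve hT.ε hερ he hr2) (ε_expCurve hT.ε hερ he hr1)
      (d_expCurve hT.d hερ he hr2) (d_expCurve hT.d hερ he hr1) (he.commute hr1)
    have hmul : E t r * E t (s - r) = E t s := by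
      have := he.mul_eq (r := s - r) (s := s) hr2.1 (by linarith [hr.1]) hs.2
      rwa [sub_sub_cancel] at this
    rw [hmul] at key
    exact key
  have hder : ∫ r in (0 : ℝ)..s, φ (N * E t r * T.P (T.curv ρ) * E t (s - r)) =
      -φ (N * T.P (E t s)) := he.integral_derivation ⟨T.P, hT.P⟩ T.P_mul N hs φ
  rw [intervalIntegral.integral_congr hpt, intervalIntegral.integral_sub
    (hc3.intervalIntegrable _ _) (hc2.intervalIntegrable _ _),
    intervalIntegral.integral_sub intervalIntegrable_const (hc1.intervalIntegrable _ _),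
    hder]
  have hP : φ (N * T.P (E t s)) = φ (β * E t s) :=
    h.functional_mul_P (φ := (φ : Q →ₗ[ℂ] ℂ)) hφ (E t s)
  rw [hP, intervalIntegral.integral_const, sub_zero, sub_neg_eq_add, Complex.real_smul]
  ring

include hE

/-- The derivative in `t` of `φ (a e^{-s∇²})`, where `a` is the component of degree zero of the
potential. -/
theorem hasDerivAt_functional_mul {φ : Q →L[ℂ] ℂ} (hφ : ∀ x, T.τ x = 0 → φ x = 0) {s t : ℝ}
    (hs : s ∈ Set.Icc (0 : ℝ) 1) (ht : t ∈ Set.Ioo (0 : ℝ) 1) :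
    HasDerivAt (fun t : ℝ => φ ((D + (t : ℂ) • β) * E t s))
      (s * φ (T.d (weakIntegral fun v => transgressionIntegrand D β (β + ω) E s t v)) -
        2 * s * φ ((β + ω) * T.curv (D + (t : ℂ) • (β + ω)) * E t s)) t := by
  have htI : t ∈ Set.Icc (0 : ℝ) 1 := ⟨ht.1.le, ht.2.le⟩
  have he := hexp t htI
  have h1 := integral_functional_d hT h hexp hφ hs htI
  have h2 := mul_functional_transgressionIntegrand hE D β (β + ω)
    (φ.comp (⟨T.d, hT.d⟩ : Q →L[ℂ] Q)) s t
  change (s : ℂ) * φ (T.d (weakIntegral fun v => transgressionIntegrand D β (β + ω) E s t v)) =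
    ∫ r in (0 : ℝ)..s, φ (T.d ((D + (t : ℂ) • β) * E t (s - r) * (β + ω) * E t r)) at h2
  rw [h2, h1]
  set N := β + ω with hN
  set ρ := D + (t : ℂ) • N with hρ
  set K := T.d N + ρ * N + N * ρ with hK
  -- the difference quotient, rewritten by means of Duhamel's formula
  let S : ℝ → ℂ := fun t' => φ (β * E t' s) - ∫ r in (0 : ℝ)..s,
    φ ((D + (t : ℂ) • β) * E t (s - r) * (K + ((t' : ℂ) - t) • (N * N)) * E t' r)
  have hS : Continuous S := by
    have c1 : Continuous fun p : ℝ × ℝ => E t (s - p.2) :=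
      hE.comp (by fun_prop : Continuous fun p : ℝ × ℝ => (t, s - p.2))
    have c2 : Continuous fun p : ℝ × ℝ => K + ((p.1 : ℂ) - t) • (N * N) :=
      continuous_const.add ((by fun_prop : Continuous fun p : ℝ × ℝ => (p.1 : ℂ) - t).smul
        continuous_const)
    refine (φ.continuous.comp (continuous_curve_mul continuous_const
      (hE.comp (by fun_prop : Continuous fun t' : ℝ => (t', s))))).sub ?_
    refine intervalIntegral.continuous_parametric_intervalIntegral_of_continuous
      (f := fun (t' : ℝ) r => φ ((D + (t : ℂ) • β) * E t (s - r) *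
        (K + ((t' : ℂ) - t) • (N * N)) * E t' r)) ?_ continuous_const
    exact φ.continuous.comp (continuous_curve_mul (continuous_curve_mul
      (continuous_curve_mul continuous_const c1) c2) hE)
  rw [hasDerivAt_iff_tendsto_slope]
  have hSt : S t = 2 * s * φ (N * T.curv ρ * E t s) + φ (β * E t s) - (∫ r in (0 : ℝ)..s,
      φ ((D + (t : ℂ) • β) * E t (s - r) * K * E t r)) - 2 * s * φ (N * T.curv ρ * E t s) := by
    simp only [S, sub_self, zero_smul, add_zero]
    ring
  rw [← hSt]
  refine ((hS.tendsto t).mono_left nhdsWithin_le_nhds).congr' ?_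
  filter_upwards [self_mem_nhdsWithin,
    mem_nhdsWithin_of_mem_nhds (Ioo_mem_nhds ht.1 ht.2)] with t' hne ht'
  have hne' : (t' : ℂ) - t ≠ 0 := by
    rw [← Complex.ofReal_sub]
    exact Complex.ofReal_ne_zero.2 (sub_ne_zero.2 hne)
  have hduh := he.duhamel (hexp t' ⟨ht'.1.le, ht'.2.le⟩) (D + (t : ℂ) • β) hs φ
  have hcurv : T.curv ρ - T.curv (D + (t' : ℂ) • N) =
      -(((t' : ℂ) - t) • (K + ((t' : ℂ) - t) • (N * N))) := by
    have : D + (t' : ℂ) • N = ρ + ((t' : ℂ) - t) • N := by rw [hρ]; module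
    rw [this, curv_add_smul ρ N]
    abel
  rw [hcurv] at hduh
  have hint : ∫ r in (0 : ℝ)..s, φ ((D + (t : ℂ) • β) * E t (s - r) *
      -(((t' : ℂ) - t) • (K + ((t' : ℂ) - t) • (N * N))) * E t' r) =
      -(((t' : ℂ) - t) * ∫ r in (0 : ℝ)..s, φ ((D + (t : ℂ) • β) * E t (s - r) *
        (K + ((t' : ℂ) - t) • (N * N)) * E t' r)) := by
    rw [← intervalIntegral.integral_const_mul, ← intervalIntegral.integral_neg]
    refine intervalIntegral.integral_congr fun r _ => ?_
    simp only [mul_neg, neg_mul, mul_smul_comm, smul_mul_assoc, map_neg, map_smul, smul_eq_mul]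
  rw [hint] at hduh
  rw [slope_def_module, ← Complex.coe_smul, smul_eq_mul, Complex.ofReal_inv, Complex.ofReal_sub]
  have hexpand : φ ((D + (t' : ℂ) • β) * E t' s) - φ ((D + (t : ℂ) • β) * E t s) =
      ((t' : ℂ) - t) * φ (β * E t' s) + φ ((D + (t : ℂ) • β) * (E t' s - E t s)) := by
    have e : (D + (t' : ℂ) • β) * E t' s - (D + (t : ℂ) • β) * E t s =
        ((t' : ℂ) - t) • (β * E t' s) + (D + (t : ℂ) • β) * (E t' s - E t s) := by
      simp only [add_mul, mul_sub, smul_mul_assoc, sub_smul]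
      abel
    rw [← map_sub, e, map_add, map_smul, smul_eq_mul]
  rw [hexpand, hduh]
  simp only [S]
  field_simp
  ring

/-- If the one-form component of the curvature vanishes at both ends of the path, the integral of
the variation of the Chern character form is exact. -/
theorem two_mul_integral_functional (h0 : T.P (T.curv D) = 0) (h1 : T.P (T.curv (D + (β + ω))) = 0)
    {φ : Q →L[ℂ] ℂ} (hφ : ∀ x, T.τ x = 0 → φ x = 0) {s : ℝ} (hs : s ∈ Set.Ioc (0 : ℝ) 1) :
    2 * ∫ t in (0 : ℝ)..1, φ ((β + ω) * T.curv (D + (t : ℂ) • (β + ω)) * E t s) =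
      ∫ t in (0 : ℝ)..1,
        φ (T.d (weakIntegral fun v => transgressionIntegrand D β (β + ω) E s t v)) := by
  have hsI : s ∈ Set.Icc (0 : ℝ) 1 := ⟨hs.1.le, hs.2⟩
  have hEs : Continuous fun t => E t s := hE.comp (by fun_prop : Continuous fun t : ℝ => (t, s))
  have hc1 : Continuous fun t : ℝ => φ ((D + (t : ℂ) • β) * E t s) :=
    φ.continuous.comp (continuous_curve_mul (continuous_linePath D β) hEs)
  have hc0 := (continuous_weakIntegral_transgressionIntegrand hE D β (β + ω)).comp
    (by fun_prop : Continuous fun t : ℝ => (s, t))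
  have hc2 : Continuous fun t : ℝ =>
      φ (T.d (weakIntegral fun v => transgressionIntegrand D β (β + ω) E s t v)) :=
    φ.continuous.comp (hT.d.comp hc0)
  have hc3 : Continuous fun t : ℝ => φ ((β + ω) * T.curv (D + (t : ℂ) • (β + ω)) * E t s) :=
    φ.continuous.comp (continuous_curve_mul (continuous_curve_mul continuous_const
      (continuous_curv_path _ _)) hEs)
  have hzero : ∀ t ∈ Set.Icc (0 : ℝ) 1, T.P (T.curv (D + (t : ℂ) • (β + ω))) = 0 →
      φ ((D + (t : ℂ) • β) * E t s) = 0 := by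
    intro t ht hP
    have hφP := functional_P (φ := (φ : Q →ₗ[ℂ] ℂ)) hφ ((D + (t : ℂ) • β) * E t s)
    rw [T.P_mul, P_expCurve hT.P hP (hexp t ht) hsI] at hφP
    simpa [h.P_D, h.P_β] using hφP.symm
  have hd := fun (t : ℝ) (ht : t ∈ Set.Ioo (0 : ℝ) 1) =>
    hasDerivAt_functional_mul hT h hE hexp hφ hsI ht
  set f := fun t : ℝ => φ ((D + (t : ℂ) • β) * E t s) with hf
  set u := fun t : ℝ =>
    φ (T.d (weakIntegral fun v => transgressionIntegrand D β (β + ω) E s t v)) with hu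
  set w := fun t : ℝ => φ ((β + ω) * T.curv (D + (t : ℂ) • (β + ω)) * E t s) with hw
  have hsu : Continuous fun t => (s : ℂ) * u t := continuous_const.mul hc2
  have hsw : Continuous fun t => 2 * (s : ℂ) * w t := continuous_const.mul hc3
  have hftc := intervalIntegral.integral_eq_sub_of_hasDerivAt_of_le (f := f)
    (f' := fun t => s * u t - 2 * s * w t) zero_le_one hc1.continuousOn hd
    ((hsu.sub hsw).intervalIntegrable _ _)
  rw [show f 1 = 0 from hzero 1 (by simp) (by simpa using h1),
    show f 0 = 0 from hzero 0 (by simp) (by simpa using h0), sub_self,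
    intervalIntegral.integral_sub (hsu.intervalIntegrable _ _) (hsw.intervalIntegrable _ _),
    intervalIntegral.integral_const_mul, intervalIntegral.integral_const_mul] at hftc
  have hs0 : (s : ℂ) ≠ 0 := Complex.ofReal_ne_zero.2 hs.1.ne'
  have hcancel : ∀ x y : ℂ, 0 = s * y - 2 * s * x → 2 * x = y := fun x y hxy =>
    mul_left_cancel₀ hs0 (by linear_combination hxy)
  exact hcancel _ _ hftc.symm

/-- The transgression formula: up to the exact term `d` of the transgression, the trace of the
Chern-Simons integral is the trace of `ω`. -/
theorem τ_integral_eq (h0 : T.P (T.curv D) = 0) (h1 : T.P (T.curv (D + (β + ω))) = 0) {I : Q}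
    (hI : IsWeakIntegral (fun t => T.P ((β + ω) * E t 1)) I) :
    T.τ I = T.τ ω - (2⁻¹ : ℂ) • T.τ (T.d (transgression D β (β + ω) E)) := by
  set y := transgression D β (β + ω) E with hy
  suffices hx : I - ω + (2⁻¹ : ℂ) • T.d y ∈ LinearMap.ker T.τ by
    rw [LinearMap.mem_ker, map_add, map_sub, map_smul] at hx
    rw [← sub_eq_zero, ← hx]
    abel
  by_contra hx
  obtain ⟨φ, hφ, hne⟩ := exists_functional_ne_zero (LinearMap.ker T.τ) hT.τ hx
  replace hφ : ∀ x, T.τ x = 0 → φ x = 0 := fun x hx => hφ x hx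
  refine hne ?_
  have hφP := functional_P (φ := (φ : Q →ₗ[ℂ] ℂ)) hφ
  have hφω : φ (β + ω) = φ ω := by
    have := hφP (β + ω)
    rw [map_add, h.P_β, zero_add, h.P_ω] at this
    exact this.symm
  have hE1 : Continuous fun t => E t 1 := hE.comp (by fun_prop : Continuous fun t : ℝ => (t, (1 : ℝ)))
  have hNE : Continuous fun t => φ ((β + ω) * E t 1) :=
    φ.continuous.comp (continuous_curve_mul continuous_const hE1)
  have hG : Continuous fun p : ℝ × ℝ =>
      φ ((β + ω) * T.curv (D + (p.1 : ℂ) • (β + ω)) * E p.1 p.2) :=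
    φ.continuous.comp (continuous_curve_mul (continuous_curve_mul continuous_const
      ((continuous_curv_path _ _).comp continuous_fst)) hE)
  have hφI : φ I = ∫ t in (0 : ℝ)..1, φ ((β + ω) * E t 1) := by
    rw [← (hI φ).2]
    exact intervalIntegral.integral_congr fun t _ => hφP _
  have hs : ∀ t ∈ Set.uIcc (0 : ℝ) 1, φ ((β + ω) * E t 1) - φ ω =
      -∫ s in (0 : ℝ)..1, φ ((β + ω) * T.curv (D + (t : ℂ) • (β + ω)) * E t s) := by
    intro t ht
    rw [Set.uIcc_of_le zero_le_one] at ht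
    have he := hexp t ht
    have key := integral_eq_sub_of_hasCurveDeriv (G := fun s => (β + ω) * E t s)
      (G' := fun s => (β + ω) * -(T.curv (D + (t : ℂ) • (β + ω)) * E t s)) zero_le_one
      (continuous_curve_mul continuous_const he.continuous).continuousOn
      (continuous_curve_mul continuous_const he.continuous_mul.neg).continuousOn
      (fun r hr => (he.hasCurveDeriv hr).const_mul _) φ
    rw [he.zero_eq, mul_one, hφω] at key
    rw [← key, ← intervalIntegral.integral_neg]
    refine intervalIntegral.integral_congr fun s _ => ?_
    simp only [mul_neg, map_neg, mul_assoc]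
  have hsub : φ I - φ ω = -∫ t in (0 : ℝ)..1, ∫ s in (0 : ℝ)..1,
      φ ((β + ω) * T.curv (D + (t : ℂ) • (β + ω)) * E t s) := by
    rw [← intervalIntegral.integral_neg, ← intervalIntegral.integral_congr hs,
      intervalIntegral.integral_sub (hNE.intervalIntegrable _ _) intervalIntegrable_const, ← hφI]
    simp
  have hd : φ (T.d y) = ∫ s in (0 : ℝ)..1, ∫ t in (0 : ℝ)..1,
      φ (T.d (weakIntegral fun v => transgressionIntegrand D β (β + ω) E s t v)) :=
    functional_transgression hE D β (β + ω) (φ.comp (⟨T.d, hT.d⟩ : Q →L[ℂ] Q))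
  have hd2 : φ (T.d y) = 2 * ∫ s in (0 : ℝ)..1, ∫ t in (0 : ℝ)..1,
      φ ((β + ω) * T.curv (D + (t : ℂ) • (β + ω)) * E t s) := by
    rw [hd, ← intervalIntegral.integral_const_mul,
      intervalIntegral.integral_of_le zero_le_one, intervalIntegral.integral_of_le zero_le_one]
    refine MeasureTheory.setIntegral_congr_fun measurableSet_Ioc fun s hs => ?_
    exact (two_mul_integral_functional hT h hE hexp h0 h1 hφ hs).symm
  rw [integral_integral_swap_of_continuous hG] at hsub
  rw [map_add, map_sub, map_smul, hsub, hd2, smul_eq_mul]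
  ring

end TracedForms

end Transgression

/-! ### The graded tensor product of forms and coefficients -/

namespace FormsTensor

variable {R : Type u} [Ring R] [Algebra ℂ R]
variable {L : Type v} [Ring L] [Algebra ℂ L] (ℒ : ZMod 2 → Submodule ℂ L) [GradedAlgebra ℒ]

/-- The element `r ⊗ l` of degree zero. -/
def zeroForm (r : R) (l : L) : FormsTensor R ℒ :=
  (TrivSqZeroExt.inl r : TruncForms R) ᵍ⊗ₜ[ℂ] l

/-- The element `η ⊗ l` of degree one. -/
def oneForm (η : OneForms R) (l : L) : FormsTensor R ℒ :=
  (TrivSqZeroExt.inr η : TruncForms R) ᵍ⊗ₜ[ℂ] l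

/-- The sign `(-1)^j`. -/
def paritySign (j : ZMod 2) : ℂ := if j = 0 then 1 else -1

@[simp] theorem paritySign_zero : paritySign 0 = 1 := rfl

@[simp] theorem paritySign_one : paritySign 1 = -1 := rfl

variable {ℒ}

theorem hom_ext_of_mem {M : Type*} [AddCommGroup M] [Module ℂ M] {f g : FormsTensor R ℒ →ₗ[ℂ] M}
    (h0 : ∀ (r : R) (j : ZMod 2) (l : L), l ∈ ℒ j → f (zeroForm ℒ r l) = g (zeroForm ℒ r l))
    (h1 : ∀ (η : OneForms R) (j : ZMod 2) (l : L), l ∈ ℒ j →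
      f (oneForm ℒ η l) = g (oneForm ℒ η l)) : f = g := by
  refine GradedTensorProduct.hom_ext _ _ (TensorProduct.ext' fun x l => ?_)
  induction l using DirectSum.Decomposition.inductionOn ℒ with
  | zero => simp
  | @homogeneous j l =>
    have hx : x = TrivSqZeroExt.inl x.fst + TrivSqZeroExt.inr x.snd := by ext <;> simp
    rw [hx, TensorProduct.add_tmul, map_add, map_add]
    exact congrArg₂ (· + ·) (h0 _ j l l.2) (h1 _ j l l.2)
  | add l m hl hm => rw [TensorProduct.tmul_add, map_add, map_add, hl, hm]

theorem hom_ext₂ {M : Type*} [AddCommGroup M] [Module ℂ M]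
    {f g : FormsTensor R ℒ →ₗ[ℂ] FormsTensor R ℒ →ₗ[ℂ] M}
    (h00 : ∀ (r s : R) (i j : ZMod 2) (l m : L), l ∈ ℒ i → m ∈ ℒ j →
      f (zeroForm ℒ r l) (zeroForm ℒ s m) = g (zeroForm ℒ r l) (zeroForm ℒ s m))
    (h01 : ∀ (r : R) (η : OneForms R) (i j : ZMod 2) (l m : L), l ∈ ℒ i → m ∈ ℒ j →
      f (zeroForm ℒ r l) (oneForm ℒ η m) = g (zeroForm ℒ r l) (oneForm ℒ η m))
    (h10 : ∀ (η : OneForms R) (s : R) (i j : ZMod 2) (l m : L), l ∈ ℒ i → m ∈ ℒ j →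
      f (oneForm ℒ η l) (zeroForm ℒ s m) = g (oneForm ℒ η l) (zeroForm ℒ s m))
    (h11 : ∀ (η ξ : OneForms R) (i j : ZMod 2) (l m : L), l ∈ ℒ i → m ∈ ℒ j →
      f (oneForm ℒ η l) (oneForm ℒ ξ m) = g (oneForm ℒ η l) (oneForm ℒ ξ m)) : f = g :=
  hom_ext_of_mem
    (fun r i l hl => hom_ext_of_mem (fun s j m hm => h00 r s i j l m hl hm)
      fun η j m hm => h01 r η i j l m hl hm)
    (fun η i l hl => hom_ext_of_mem (fun s j m hm => h10 η s i j l m hl hm)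
      fun ξ j m hm => h11 η ξ i j l m hl hm)

theorem tmul_mul_inl (x : TruncForms R) (s : R) {j : ZMod 2} {l : L} (hl : l ∈ ℒ j) (m : L) :
    (x ᵍ⊗ₜ[ℂ] l * zeroForm ℒ s m : FormsTensor R ℒ) =
      (x * TrivSqZeroExt.inl s : TruncForms R) ᵍ⊗ₜ[ℂ] (l * m) := by
  have hs : (TrivSqZeroExt.inl s : TruncForms R) ∈ truncGrading R 0 := by
    rw [mem_truncGrading_zero]; simp
  exact GradedTensorProduct.tmul_coe_mul_zero_coe_tmul (truncGrading R) ℒ x ⟨l, hl⟩ ⟨_, hs⟩ m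

theorem tmul_mul_inr (x : TruncForms R) (η : OneForms R) {j : ZMod 2} {l : L} (hl : l ∈ ℒ j)
    (m : L) : (x ᵍ⊗ₜ[ℂ] l * oneForm ℒ η m : FormsTensor R ℒ) =
      paritySign j • ((x * TrivSqZeroExt.inr η : TruncForms R) ᵍ⊗ₜ[ℂ] (l * m)) := by
  have hs : (TrivSqZeroExt.inr η : TruncForms R) ∈ truncGrading R 1 := by
    rw [mem_truncGrading_one]; simp
  have h := GradedTensorProduct.tmul_coe_mul_coe_tmul (R := ℂ) (truncGrading R) ℒ x ⟨l, hl⟩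
    ⟨_, hs⟩ m
  refine h.trans ?_
  rcases zmod_two_cases j with rfl | rfl
  · simp
  · simp [mul_one, uzpow_one]

theorem zeroForm_mul_zeroForm (r s : R) {j : ZMod 2} {l : L} (hl : l ∈ ℒ j) (m : L) :
    zeroForm ℒ r l * zeroForm ℒ s m = zeroForm ℒ (r * s) (l * m) := by
  rw [zeroForm, tmul_mul_inl _ _ hl, ← TrivSqZeroExt.inl_mul]
  rfl

theorem oneForm_mul_zeroForm (η : OneForms R) (s : R) {j : ZMod 2} {l : L} (hl : l ∈ ℒ j) (m : L) :
    oneForm ℒ η l * zeroForm ℒ s m = oneForm ℒ (MulOpposite.op s • η) (l * m) := by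
  rw [oneForm, tmul_mul_inl _ _ hl, TrivSqZeroExt.inr_mul_inl]
  rfl

theorem zeroForm_mul_oneForm (r : R) (η : OneForms R) {j : ZMod 2} {l : L} (hl : l ∈ ℒ j) (m : L) :
    zeroForm ℒ r l * oneForm ℒ η m = paritySign j • oneForm ℒ (r • η) (l * m) := by
  rw [zeroForm, tmul_mul_inr _ _ hl, TrivSqZeroExt.inl_mul_inr]
  rfl

theorem oneForm_mul_oneForm (η ξ : OneForms R) {j : ZMod 2} {l : L} (hl : l ∈ ℒ j) (m : L) :
    oneForm ℒ η l * oneForm ℒ ξ m = 0 := by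
  rw [oneForm, tmul_mul_inr _ _ hl, TrivSqZeroExt.inr_mul_inr]
  simp [TensorProduct.zero_tmul]

variable (ℒ)

theorem oneForm_zero (l : L) : oneForm ℒ (0 : OneForms R) l = 0 := by
  rw [oneForm, TrivSqZeroExt.inr_zero]
  simp [TensorProduct.zero_tmul]

theorem oneForm_add (η ξ : OneForms R) (l : L) :
    oneForm ℒ (η + ξ) l = oneForm ℒ η l + oneForm ℒ ξ l := by
  rw [oneForm, TrivSqZeroExt.inr_add, GradedTensorProduct.tmul, TensorProduct.add_tmul, map_add]
  rfl

theorem d_zeroForm (r : R) (l : L) :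
    d R ℒ (zeroForm ℒ r l) = oneForm ℒ (OneForms.mk R 1 r) l := rfl

theorem d_oneForm (η : OneForms R) (l : L) : d R ℒ (oneForm ℒ η l) = 0 := by
  have : d R ℒ (oneForm ℒ η l) = oneForm ℒ (OneForms.mk R 1 0) l := rfl
  rw [this, map_zero, oneForm_zero]

theorem projOne_zeroForm (r : R) (l : L) : projOne R ℒ (zeroForm ℒ r l) = 0 :=
  oneForm_zero ℒ l

theorem projOne_oneForm (η : OneForms R) (l : L) :
    projOne R ℒ (oneForm ℒ η l) = oneForm ℒ η l := rfl

theorem natTrace_zeroForm (r : R) (l : L) : natTrace R ℒ (zeroForm ℒ r l) = 0 := by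
  have : natTrace R ℒ (zeroForm ℒ r l) =
      (OneForms.comm R).mkQ (0 : OneForms R) ⊗ₜ gradedTr ℒ l := rfl
  rw [this, map_zero, TensorProduct.zero_tmul]

theorem natTrace_oneForm (η : OneForms R) (l : L) :
    natTrace R ℒ (oneForm ℒ η l) = (OneForms.comm R).mkQ η ⊗ₜ gradedTr ℒ l := rfl

theorem ofDegZero_tmul (r : R) (l : L) : ofDegZero R ℒ (r ⊗ₜ l) = zeroForm ℒ r l := rfl

theorem ofL_eq_zeroForm (l : L) : ofL R ℒ l = zeroForm ℒ 1 l := rfl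

theorem one_eq_zeroForm : (1 : FormsTensor R ℒ) = zeroForm ℒ 1 1 := rfl

variable {ℒ}

theorem projEven_tmul (x : TruncForms R) {j : ZMod 2} {l : L} (hl : l ∈ ℒ j) :
    projEven R ℒ (x ᵍ⊗ₜ[ℂ] l) = ((1 + paritySign j) / 2) • (x ᵍ⊗ₜ[ℂ] l) := by
  have h : projEven R ℒ (x ᵍ⊗ₜ[ℂ] l) = x ᵍ⊗ₜ[ℂ] (GradedAlgebra.proj ℒ 0 l) := rfl
  rw [h, GradedAlgebra.proj_apply]
  rcases zmod_two_cases j with rfl | rfl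
  · rw [DirectSum.decompose_of_mem_same ℒ hl, paritySign_zero]
    norm_num
  · rw [DirectSum.decompose_of_mem_ne ℒ hl one_ne_zero, paritySign_one]
    simp

variable (R ℒ) in
/-- The grading operator of the total parity, form degree plus degree in `L`. -/
def parity : FormsTensor R ℒ →ₗ[ℂ] FormsTensor R ℒ :=
  (LinearMap.id - (2 : ℂ) • projOne R ℒ) ∘ₗ ((2 : ℂ) • projEven R ℒ - LinearMap.id)

theorem parity_tmul (x : TruncForms R) {j : ZMod 2} {l : L} (hl : l ∈ ℒ j) :
    parity R ℒ (x ᵍ⊗ₜ[ℂ] l) =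
      paritySign j • (x ᵍ⊗ₜ[ℂ] l - (2 : ℂ) • projOne R ℒ (x ᵍ⊗ₜ[ℂ] l)) := by
  simp only [parity, LinearMap.comp_apply, LinearMap.sub_apply, LinearMap.smul_apply,
    LinearMap.id_apply, projEven_tmul x hl, map_sub, map_smul]
  module

theorem parity_zeroForm (r : R) {j : ZMod 2} {l : L} (hl : l ∈ ℒ j) :
    parity R ℒ (zeroForm ℒ r l) = paritySign j • zeroForm ℒ r l := by
  rw [zeroForm, parity_tmul _ hl, ← zeroForm, projOne_zeroForm, smul_zero, sub_zero]

theorem parity_oneForm (η : OneForms R) {j : ZMod 2} {l : L} (hl : l ∈ ℒ j) :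
    parity R ℒ (oneForm ℒ η l) = -(paritySign j • oneForm ℒ η l) := by
  rw [oneForm, parity_tmul _ hl, ← oneForm, projOne_oneForm]
  module

theorem paritySign_add (i j : ZMod 2) : paritySign (i + j) = paritySign i * paritySign j := by
  rcases zmod_two_cases i with rfl | rfl <;> rcases zmod_two_cases j with rfl | rfl <;>
    simp [show (1 : ZMod 2) + 1 = 0 from rfl]

theorem gradedTr_mul_comm {L : Type v} [Ring L] [Algebra ℂ L] {ℒ : ZMod 2 → Submodule ℂ L}
    {i j : ZMod 2} {l m : L} (hl : l ∈ ℒ i) (hm : m ∈ ℒ j) :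
    (2 : ℂ) • gradedTr ℒ (l * m) = (1 + paritySign i + paritySign j - paritySign i * paritySign j) •
      gradedTr ℒ (m * l) := by
  have h : gradedTr ℒ (l * m) = gradedTr ℒ ((-1 : ℤˣ) ^ (i * j) • (m * l)) := by
    rw [← sub_eq_zero, ← map_sub]
    exact (Submodule.Quotient.mk_eq_zero _).2 (Submodule.subset_span ⟨i, j, l, m, hl, hm, rfl⟩)
  rw [h]
  rcases zmod_two_cases i with rfl | rfl <;> rcases zmod_two_cases j with rfl | rfl <;>
    norm_num [uzpow_one]

theorem mkQ_op_smul (r : R) (η : OneForms R) :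
    (OneForms.comm R).mkQ (MulOpposite.op r • η) = (OneForms.comm R).mkQ (r • η) := by
  rw [eq_comm, ← sub_eq_zero, ← map_sub]
  exact (Submodule.Quotient.mk_eq_zero _).2 (Submodule.subset_span ⟨r, η, rfl⟩)

theorem d_mul (x y : FormsTensor R ℒ) :
    d R ℒ (x * y) = d R ℒ x * y + parity R ℒ x * d R ℒ y := by
  have : (LinearMap.mul ℂ (FormsTensor R ℒ)).compr₂ (d R ℒ) =
      (LinearMap.mul ℂ (FormsTensor R ℒ)) ∘ₗ d R ℒ +
        (LinearMap.mul ℂ (FormsTensor R ℒ)).compl₁₂ (parity R ℒ) (d R ℒ) := by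
    refine hom_ext₂ ?_ ?_ ?_ ?_
    · intro r s i j l m hl hm
      simp only [LinearMap.compr₂_apply, LinearMap.mul_apply', LinearMap.add_apply,
        LinearMap.comp_apply, LinearMap.compl₁₂_apply, zeroForm_mul_zeroForm _ _ hl, d_zeroForm,
        oneForm_mul_zeroForm _ _ hl, parity_zeroForm _ hl, smul_mul_assoc,
        zeroForm_mul_oneForm _ _ hl, smul_smul]
      have h1 : paritySign i * paritySign i = 1 := by
        rcases zmod_two_cases i with rfl | rfl <;> simp
      rw [h1, one_smul, ← oneForm_add]
      congr 1
      rw [OneForms.op_smul_def, MulOpposite.unop_op, OneForms.rmul_mk, OneForms.smul_mk]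
      simp
    · intro r η i j l m hl hm
      simp only [LinearMap.compr₂_apply, LinearMap.mul_apply', LinearMap.add_apply,
        LinearMap.comp_apply, LinearMap.compl₁₂_apply, zeroForm_mul_oneForm _ _ hl, d_zeroForm,
        map_smul, d_oneForm, oneForm_mul_oneForm _ _ hl, mul_zero, smul_zero, add_zero]
    · intro η s i j l m hl hm
      simp only [LinearMap.compr₂_apply, LinearMap.mul_apply', LinearMap.add_apply,
        LinearMap.comp_apply, LinearMap.compl₁₂_apply, oneForm_mul_zeroForm _ _ hl, d_zeroForm,
        d_oneForm, parity_oneForm _ hl, smul_mul_assoc, neg_mul, oneForm_mul_oneForm _ _ hl,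
        zero_mul, smul_zero, add_zero, neg_zero]
    · intro η ξ i j l m hl hm
      simp [oneForm_mul_oneForm _ _ hl, d_oneForm]
  exact LinearMap.congr_fun₂ this x y

theorem projOne_mul (x y : FormsTensor R ℒ) :
    projOne R ℒ (x * y) = projOne R ℒ x * y + x * projOne R ℒ y := by
  have : (LinearMap.mul ℂ (FormsTensor R ℒ)).compr₂ (projOne R ℒ) =
      (LinearMap.mul ℂ (FormsTensor R ℒ)) ∘ₗ projOne R ℒ +
        (LinearMap.mul ℂ (FormsTensor R ℒ)).compl₂ (projOne R ℒ) := by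
    refine hom_ext₂ ?_ ?_ ?_ ?_ <;> intro _ _ _ _ _ _ hl _ <;>
    simp [zeroForm_mul_zeroForm _ _ hl, projOne_zeroForm, projOne_oneForm,
      oneForm_mul_zeroForm _ _ hl, zeroForm_mul_oneForm _ _ hl, oneForm_mul_oneForm _ _ hl]
  exact LinearMap.congr_fun₂ this x y

theorem parity_mul (x y : FormsTensor R ℒ) :
    parity R ℒ (x * y) = parity R ℒ x * parity R ℒ y := by
  have : (LinearMap.mul ℂ (FormsTensor R ℒ)).compr₂ (parity R ℒ) =
        (LinearMap.mul ℂ (FormsTensor R ℒ)).compl₁₂ (parity R ℒ) (parity R ℒ) := by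
    refine hom_ext₂ ?_ ?_ ?_ ?_ <;> intro a b i j l m hl hm <;>
    have hlm := SetLike.GradedMul.mul_mem hl hm
    · change parity R ℒ (zeroForm ℒ a l * zeroForm ℒ b m) =
        parity R ℒ (zeroForm ℒ a l) * parity R ℒ (zeroForm ℒ b m)
      rw [parity_zeroForm _ hl, parity_zeroForm _ hm, zeroForm_mul_zeroForm _ _ hl,
        parity_zeroForm _ hlm, smul_mul_assoc, mul_smul_comm, zeroForm_mul_zeroForm _ _ hl,
        paritySign_add, mul_smul]
    · change parity R ℒ (zeroForm ℒ a l * oneForm ℒ b m) =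
        parity R ℒ (zeroForm ℒ a l) * parity R ℒ (oneForm ℒ b m)
      rw [parity_zeroForm _ hl, parity_oneForm _ hm, zeroForm_mul_oneForm _ _ hl, map_smul,
        parity_oneForm _ hlm, mul_neg, smul_mul_assoc, mul_smul_comm,
        zeroForm_mul_oneForm _ _ hl, paritySign_add]
      module
    · change parity R ℒ (oneForm ℒ a l * zeroForm ℒ b m) =
        parity R ℒ (oneForm ℒ a l) * parity R ℒ (zeroForm ℒ b m)
      rw [parity_oneForm _ hl, parity_zeroForm _ hm, oneForm_mul_zeroForm _ _ hl,
        parity_oneForm _ hlm, neg_mul, smul_mul_assoc, mul_smul_comm,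
        oneForm_mul_zeroForm _ _ hl, paritySign_add, mul_smul]
    · change parity R ℒ (oneForm ℒ a l * oneForm ℒ b m) =
        parity R ℒ (oneForm ℒ a l) * parity R ℒ (oneForm ℒ b m)
      rw [parity_oneForm _ hl, parity_oneForm _ hm, oneForm_mul_oneForm _ _ hl, map_zero,
        neg_mul_neg, smul_mul_assoc, mul_smul_comm, oneForm_mul_oneForm _ _ hl, smul_zero,
        smul_zero]
  exact LinearMap.congr_fun₂ this x y

theorem projOne_mul_projOne (x y : FormsTensor R ℒ) : projOne R ℒ x * projOne R ℒ y = 0 := by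
  have : (LinearMap.mul ℂ (FormsTensor R ℒ)).compl₁₂ (projOne R ℒ) (projOne R ℒ) = 0 := by
    refine hom_ext₂ ?_ ?_ ?_ ?_ <;> intro _ _ _ _ _ _ hl _ <;>
    simp only [LinearMap.mul_apply', LinearMap.compl₁₂_apply, projOne_zeroForm, projOne_oneForm,
      oneForm_mul_oneForm _ _ hl, zero_mul, mul_zero, LinearMap.zero_apply]
  exact LinearMap.congr_fun₂ this x y

theorem natTrace_mul (x y : FormsTensor R ℒ) :
    (2 : ℂ) • natTrace R ℒ (x * y) = natTrace R ℒ (y * x) + natTrace R ℒ (y * parity R ℒ x) +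
      natTrace R ℒ (parity R ℒ y * x) - natTrace R ℒ (parity R ℒ y * parity R ℒ x) := by
  have : (2 : ℂ) • (LinearMap.mul ℂ (FormsTensor R ℒ)).compr₂ (natTrace R ℒ) +
        ((LinearMap.mul ℂ (FormsTensor R ℒ)).flip.compl₁₂ (parity R ℒ) (parity R ℒ)).compr₂
          (natTrace R ℒ) =
      (LinearMap.mul ℂ (FormsTensor R ℒ)).flip.compr₂ (natTrace R ℒ) +
        ((LinearMap.mul ℂ (FormsTensor R ℒ)).flip ∘ₗ parity R ℒ).compr₂ (natTrace R ℒ) +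
        ((LinearMap.mul ℂ (FormsTensor R ℒ)).flip.compl₂ (parity R ℒ)).compr₂ (natTrace R ℒ) := by
    refine hom_ext₂ ?_ ?_ ?_ ?_ <;> intro a b i j l m hl hm
    · simp [parity_zeroForm _ hl, parity_zeroForm _ hm, zeroForm_mul_zeroForm _ _ hl,
        zeroForm_mul_zeroForm _ _ hm, natTrace_zeroForm]
    · change (2 : ℂ) • natTrace R ℒ (zeroForm ℒ a l * oneForm ℒ b m) +
          natTrace R ℒ (parity R ℒ (oneForm ℒ b m) * parity R ℒ (zeroForm ℒ a l)) =
        natTrace R ℒ (oneForm ℒ b m * zeroForm ℒ a l) +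
          natTrace R ℒ (oneForm ℒ b m * parity R ℒ (zeroForm ℒ a l)) +
          natTrace R ℒ (parity R ℒ (oneForm ℒ b m) * zeroForm ℒ a l)
      simp only [parity_zeroForm _ hl, parity_oneForm _ hm, mul_smul_comm, smul_mul_assoc, neg_mul,
        zeroForm_mul_oneForm _ _ hl, oneForm_mul_zeroForm _ _ hm, map_smul, map_neg,
        natTrace_oneForm, mkQ_op_smul]
      rw [smul_comm, ← TensorProduct.tmul_smul, gradedTr_mul_comm hl hm, TensorProduct.tmul_smul]
      rcases zmod_two_cases i with rfl | rfl <;> rcases zmod_two_cases j with rfl | rfl <;>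
        simp only [paritySign_zero, paritySign_one] <;> module
    · change (2 : ℂ) • natTrace R ℒ (oneForm ℒ a l * zeroForm ℒ b m) +
          natTrace R ℒ (parity R ℒ (zeroForm ℒ b m) * parity R ℒ (oneForm ℒ a l)) =
        natTrace R ℒ (zeroForm ℒ b m * oneForm ℒ a l) +
          natTrace R ℒ (zeroForm ℒ b m * parity R ℒ (oneForm ℒ a l)) +
          natTrace R ℒ (parity R ℒ (zeroForm ℒ b m) * oneForm ℒ a l)
      simp only [parity_zeroForm _ hm, parity_oneForm _ hl, mul_smul_comm, smul_mul_assoc, mul_neg,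
        zeroForm_mul_oneForm _ _ hm, oneForm_mul_zeroForm _ _ hl, map_smul, map_neg,
        natTrace_oneForm, mkQ_op_smul]
      rw [← TensorProduct.tmul_smul, gradedTr_mul_comm hl hm, TensorProduct.tmul_smul]
      rcases zmod_two_cases i with rfl | rfl <;> rcases zmod_two_cases j with rfl | rfl <;>
        simp only [paritySign_zero, paritySign_one] <;> module
    · simp [parity_oneForm _ hl, parity_oneForm _ hm, oneForm_mul_oneForm _ _ hl,
        oneForm_mul_oneForm _ _ hm]
  exact eq_sub_of_add_eq (LinearMap.congr_fun₂ this x y)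

variable (R ℒ) in
/-- The graded tensor product of `Ω(R)` and `L`, in degrees at most one, with the trace `♮ ⊗ ♮`. -/
def tracedForms : TracedForms (FormsTensor R ℒ) (XOdd R ⊗[ℂ] GradedAb ℒ) where
  d := d R ℒ
  P := projOne R ℒ
  ε := parity R ℒ
  τ := natTrace R ℒ
  d_mul := d_mul
  P_mul := projOne_mul
  ε_one := by
    rw [one_eq_zeroForm, parity_zeroForm _ (SetLike.GradedOne.one_mem (A := ℒ)), paritySign_zero,
      one_smul]
  ε_mul := parity_mul
  P_d := LinearMap.congr_fun (show projOne R ℒ ∘ₗ d R ℒ = d R ℒ from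
    hom_ext_of_mem (fun _ _ _ _ => rfl) (fun _ _ _ _ => by simp [d_oneForm]))
  d_P := LinearMap.congr_fun (show d R ℒ ∘ₗ projOne R ℒ = 0 from
    hom_ext_of_mem (fun _ _ _ _ => by simp [projOne_zeroForm])
      (fun _ _ _ _ => by simp [projOne_oneForm, d_oneForm]))
  P_mul_P := projOne_mul_projOne
  ε_d := LinearMap.congr_fun (show parity R ℒ ∘ₗ d R ℒ = -(d R ℒ ∘ₗ parity R ℒ) from
    hom_ext_of_mem
      (fun _ _ _ hl => by simp [d_zeroForm, parity_oneForm _ hl, parity_zeroForm _ hl])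
      (fun _ _ _ hl => by simp [d_oneForm, parity_oneForm _ hl]))
  τ_P := LinearMap.congr_fun (show natTrace R ℒ ∘ₗ projOne R ℒ = natTrace R ℒ from
    hom_ext_of_mem (fun _ _ _ _ => by simp [projOne_zeroForm, natTrace_zeroForm])
      (fun _ _ _ _ => rfl))
  τ_mul := natTrace_mul

end FormsTensor

/-! ### Gauge transforms -/

namespace TracedForms

variable {Q V : Type*} [Ring Q] [Algebra ℂ Q] [AddCommGroup V] [Module ℂ V] (T : TracedForms Q V)

theorem P_one : T.P 1 = 0 := by simpa using T.P_mul 1 1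

theorem d_one : T.d 1 = 0 := by simpa [T.ε_one] using T.d_mul 1 1

/-- `G` is an even element of form degree zero with inverse `G'`. -/
structure IsGauge (G G' : Q) : Prop where
  ε_eq : T.ε G = G
  P_eq : T.P G = 0
  mul_inv : G * G' = 1
  inv_mul : G' * G = 1

variable {T} {G G' : Q}

theorem IsGauge.ε_inv (h : T.IsGauge G G') : T.ε G' = G' := by
  have : T.ε (G' * G) * G' = T.ε G' := by rw [T.ε_mul, h.ε_eq, mul_assoc, h.mul_inv, mul_one]
  rw [← this, h.inv_mul, T.ε_one, one_mul]

theorem IsGauge.P_inv (h : T.IsGauge G G') : T.P G' = 0 := by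
  have : T.P (G' * G) * G' = T.P G' := by
    rw [T.P_mul, h.P_eq, mul_zero, add_zero, mul_assoc, h.mul_inv, mul_one]
  rw [← this, h.inv_mul, P_one, zero_mul]

theorem IsGauge.d_inv (h : T.IsGauge G G') : T.d G' = -(G' * T.d G * G') := by
  have h1 : T.d (G' * G) = 0 := by rw [h.inv_mul, d_one]
  rw [T.d_mul, h.ε_inv] at h1
  calc T.d G' = T.d G' * G * G' := by rw [mul_assoc, h.mul_inv, mul_one]
    _ = -(G' * T.d G * G') := by rw [eq_neg_of_add_eq_zero_left h1, neg_mul]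

/-- A constant odd element of form degree zero. -/
structure IsOddConstant (T : TracedForms Q V) (D : Q) : Prop where
  ε_eq : T.ε D = -D
  P_eq : T.P D = 0
  d_eq : T.d D = 0

variable {D θ : Q}

theorem IsGauge.isPotential (h : T.IsGauge G G') (hD : T.IsOddConstant D)
    (hθ : T.IsOddConstant θ) :
    T.IsPotential D (G' * θ * G + G' * (D * G - G * D)) (G' * T.d G) where
  ε_D := hD.ε_eq
  ε_β := by
    simp only [map_add, map_sub, T.ε_mul, h.ε_eq, h.ε_inv, hD.ε_eq, hθ.ε_eq]
    noncomm_ring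
  ε_ω := by rw [T.ε_mul, h.ε_inv, T.ε_d, h.ε_eq, mul_neg]
  P_D := hD.P_eq
  P_β := by simp [T.P_mul, h.P_eq, h.P_inv, hD.P_eq, hθ.P_eq]
  P_ω := by rw [T.P_mul, h.P_inv, T.P_d, zero_mul, zero_add]

theorem IsOddConstant.P_curv (hD : T.IsOddConstant D) : T.P (T.curv D) = 0 := by
  simp [curv, hD.d_eq, T.P_mul, hD.P_eq]

theorem IsOddConstant.add (hD : T.IsOddConstant D) (hθ : T.IsOddConstant θ) :
    T.IsOddConstant (D + θ) where
  ε_eq := by rw [map_add, hD.ε_eq, hθ.ε_eq, neg_add]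
  P_eq := by rw [map_add, hD.P_eq, hθ.P_eq, add_zero]
  d_eq := by rw [map_add, hD.d_eq, hθ.d_eq, add_zero]

/-- The curvature of a gauge transform is conjugate to the curvature. -/
theorem IsGauge.curv_eq (h : T.IsGauge G G') (hD : T.IsOddConstant D) :
    T.curv (G' * D * G + G' * T.d G) = G' * (D * D) * G := by
  have e1 : G' * D * G * (G' * D * G) = G' * (D * D) * G := by
    rw [show G' * D * G * (G' * D * G) = G' * D * (G * G') * (D * G) by noncomm_ring, h.mul_inv]
    noncomm_ring
  have e2 : G' * D * G * (G' * T.d G) = G' * D * T.d G := by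
    rw [show G' * D * G * (G' * T.d G) = G' * D * (G * G') * T.d G by noncomm_ring, h.mul_inv,
      mul_one]
  simp only [curv, map_add, T.d_mul, T.ε_mul, h.ε_inv, h.d_inv, T.d_d, hD.d_eq, hD.ε_eq, mul_add,
    add_mul, e1, e2]
  noncomm_ring

/-- At the end point `t = 1` of the path of potentials, the curvature `g⁻¹ (D + θ)² g` has no
component of degree one. -/
theorem IsGauge.P_curv_one (h : T.IsGauge G G') (hD : T.IsOddConstant D)
    (hθ : T.IsOddConstant θ) :
    T.P (T.curv (D + (G' * θ * G + G' * (D * G - G * D) + G' * T.d G))) = 0 := by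
  have h1 : D + (G' * θ * G + G' * (D * G - G * D) + G' * T.d G) =
      G' * (θ + D) * G + G' * T.d G := by
    rw [mul_sub, ← mul_assoc G' G D, h.inv_mul]
    noncomm_ring
  rw [h1, h.curv_eq (hθ.add hD)]
  simp [T.P_mul, h.P_eq, h.P_inv, (hθ.add hD).P_eq]

end TracedForms

namespace FormsTensor

variable {R : Type u} [Ring R] [Algebra ℂ R]
variable {L : Type v} [Ring L] [Algebra ℂ L] (ℒ : ZMod 2 → Submodule ℂ L) [GradedAlgebra ℒ]

theorem zeroForm_add (r : R) (l m : L) :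
    zeroForm ℒ r (l + m) = zeroForm ℒ r l + zeroForm ℒ r m := by
  rw [← ofDegZero_tmul, ← ofDegZero_tmul, ← ofDegZero_tmul, TensorProduct.tmul_add, map_add]

theorem ofDegZero_one : ofDegZero R ℒ 1 = 1 := rfl

theorem ofDegZero_mul (x y : R ⊗[ℂ] L) :
    ofDegZero R ℒ (x * y) = ofDegZero R ℒ x * ofDegZero R ℒ y := by
  induction x using TensorProduct.induction_on with
  | zero => simp
  | add x x' hx hx' => rw [add_mul, map_add, map_add, add_mul, hx, hx']
  | tmul r l =>
    induction y using TensorProduct.induction_on with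
    | zero => simp
    | add y y' hy hy' => rw [mul_add, map_add, map_add, mul_add, hy, hy']
    | tmul s m =>
      rw [Algebra.TensorProduct.tmul_mul_tmul]
      simp only [ofDegZero_tmul]
      induction l using DirectSum.Decomposition.inductionOn ℒ with
      | zero => simp [← ofDegZero_tmul]
      | @homogeneous j l => rw [zeroForm_mul_zeroForm _ _ l.2]
      | add l l' hl hl' => rw [add_mul, zeroForm_add, zeroForm_add, add_mul, hl, hl']

theorem projOne_ofDegZero (x : R ⊗[ℂ] L) : projOne R ℒ (ofDegZero R ℒ x) = 0 :=
  LinearMap.congr_fun (show projOne R ℒ ∘ₗ ofDegZero R ℒ = 0 from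
    TensorProduct.ext' fun r l => projOne_zeroForm ℒ r l) x

variable {ℒ}

theorem parity_ofDegZero {x : R ⊗[ℂ] L} (hx : x ∈ evenPart R ℒ) :
    parity R ℒ (ofDegZero R ℒ x) = ofDegZero R ℒ x := by
  obtain ⟨y, rfl⟩ := hx
  exact LinearMap.congr_fun (show parity R ℒ ∘ₗ ofDegZero R ℒ ∘ₗ (ℒ 0).subtype.lTensor R =
      ofDegZero R ℒ ∘ₗ (ℒ 0).subtype.lTensor R from
    TensorProduct.ext' fun r l => by
      change parity R ℒ (zeroForm ℒ r (l : L)) = zeroForm ℒ r l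
      rw [parity_zeroForm _ l.2, paritySign_zero, one_smul]) y

theorem isOddConstant_ofL {D : L} (hD : D ∈ ℒ 1) : (tracedForms R ℒ).IsOddConstant (ofL R ℒ D) where
  ε_eq := by
    change parity R ℒ (zeroForm ℒ 1 D) = -zeroForm ℒ 1 D
    rw [parity_zeroForm _ hD, paritySign_one, neg_one_smul]
  P_eq := projOne_zeroForm ℒ 1 D
  d_eq := by
    change d R ℒ (zeroForm ℒ 1 D) = 0
    rw [d_zeroForm, OneForms.mk_one, oneForm_zero]

theorem isGauge_ofDegZero {g : R ⊗[ℂ] L} (hg : g ∈ evenPart R ℒ) (hu : IsUnit g) :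
    (tracedForms R ℒ).IsGauge (ofDegZero R ℒ g) (ofDegZero R ℒ (Ring.inverse g)) where
  ε_eq := parity_ofDegZero hg
  P_eq := projOne_ofDegZero ℒ g
  mul_inv := by rw [← ofDegZero_mul, Ring.mul_inverse_cancel g hu, ofDegZero_one]
  inv_mul := by rw [← ofDegZero_mul, Ring.inverse_mul_cancel g hu, ofDegZero_one]

theorem potential_eq (D θ : L) (g : R ⊗[ℂ] L) (t : ℝ) :
    potential ℒ D θ g t =
      ofL R ℒ D + (t : ℂ) • (gaugeTransform ℒ D θ g + maurerCartan ℒ g) := by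
  rw [potential, add_comm (maurerCartan ℒ g)]

theorem curvature_eq (D θ : L) (g : R ⊗[ℂ] L) (t : ℝ) :
    curvature ℒ D θ g t = (tracedForms R ℒ).curv
      (ofL R ℒ D + (t : ℂ) • (gaugeTransform ℒ D θ g + maurerCartan ℒ g)) := by
  rw [← potential_eq]
  rfl

variable {S : Type u} [Ring S] [Algebra ℂ S] (f : R →ₐ[ℂ] S)

theorem map_zeroForm (r : R) (l : L) : map ℒ f (zeroForm ℒ r l) = zeroForm ℒ (f r) l := by
  have h : map ℒ f (zeroForm ℒ r l) = (TrivSqZeroExt.inl (f r) + TrivSqZeroExt.inr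
    (OneForms.map f (0 : OneForms R)) : TruncForms S) ᵍ⊗ₜ[ℂ] l := rfl
  rw [h, map_zero, TrivSqZeroExt.inr_zero, add_zero]
  rfl

theorem map_oneForm (η : OneForms R) (l : L) :
    map ℒ f (oneForm ℒ η l) = oneForm ℒ (OneForms.map f η) l := by
  have h : map ℒ f (oneForm ℒ η l) = (TrivSqZeroExt.inl (f 0) + TrivSqZeroExt.inr
    (OneForms.map f η) : TruncForms S) ᵍ⊗ₜ[ℂ] l := rfl
  rw [h, map_zero, TrivSqZeroExt.inl_zero, zero_add]
  rfl

theorem oneForms_map_smul (r : R) (η : OneForms R) :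
    OneForms.map f (r • η) = f r • OneForms.map f η :=
  LinearMap.congr_fun (show OneForms.map f ∘ₗ Module.toModuleEnd ℂ (S := R) (OneForms R) r =
      Module.toModuleEnd ℂ (S := S) (OneForms S) (f r) ∘ₗ OneForms.map f from
    OneForms.hom_ext fun x y => by simp [OneForms.smul_mk, OneForms.map_mk]) η

theorem oneForms_map_op_smul (r : R) (η : OneForms R) :
    OneForms.map f (MulOpposite.op r • η) = MulOpposite.op (f r) • OneForms.map f η :=
  LinearMap.congr_fun (show OneForms.map f ∘ₗ OneForms.rmul r =
      OneForms.rmul (f r) ∘ₗ OneForms.map f from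
    OneForms.hom_ext fun x y => by simp [OneForms.rmul_mk, OneForms.map_mk]) η

theorem map_mul (x y : FormsTensor R ℒ) : map ℒ f (x * y) = map ℒ f x * map ℒ f y := by
  have : (LinearMap.mul ℂ (FormsTensor R ℒ)).compr₂ (map ℒ f) =
        (LinearMap.mul ℂ (FormsTensor S ℒ)).compl₁₂ (map ℒ f) (map ℒ f) := by
    refine hom_ext₂ ?_ ?_ ?_ ?_ <;> intro a b i j l m hl hm
    · change map ℒ f (zeroForm ℒ a l * zeroForm ℒ b m) =
        map ℒ f (zeroForm ℒ a l) * map ℒ f (zeroForm ℒ b m)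
      simp only [zeroForm_mul_zeroForm _ _ hl, map_zeroForm, _root_.map_mul]
    · change map ℒ f (zeroForm ℒ a l * oneForm ℒ b m) =
        map ℒ f (zeroForm ℒ a l) * map ℒ f (oneForm ℒ b m)
      simp only [zeroForm_mul_oneForm _ _ hl, map_zeroForm, map_oneForm, map_smul,
        oneForms_map_smul]
    · change map ℒ f (oneForm ℒ a l * zeroForm ℒ b m) =
        map ℒ f (oneForm ℒ a l) * map ℒ f (zeroForm ℒ b m)
      simp only [oneForm_mul_zeroForm _ _ hl, map_zeroForm, map_oneForm, oneForms_map_op_smul]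
    · change map ℒ f (oneForm ℒ a l * oneForm ℒ b m) =
        map ℒ f (oneForm ℒ a l) * map ℒ f (oneForm ℒ b m)
      simp only [oneForm_mul_oneForm _ _ hl, map_oneForm, map_zero]
  exact LinearMap.congr_fun₂ this x y

theorem map_one : map ℒ f 1 = 1 := by
  rw [one_eq_zeroForm, map_zeroForm, _root_.map_one, one_eq_zeroForm]

theorem map_pow (x : FormsTensor R ℒ) (j : ℕ) : map ℒ f (x ^ j) = map ℒ f x ^ j := by
  induction j with
  | zero => rw [pow_zero, pow_zero, map_one]
  | succ j ih => rw [pow_succ, pow_succ, map_mul, ih]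

theorem map_d (x : FormsTensor R ℒ) : map ℒ f (d R ℒ x) = d S ℒ (map ℒ f x) :=
  LinearMap.congr_fun (show map ℒ f ∘ₗ d R ℒ = d S ℒ ∘ₗ map ℒ f from hom_ext_of_mem
    (fun r _ l _ => by simp [d_zeroForm, map_oneForm, map_zeroForm, OneForms.map_mk])
    (fun η _ l _ => by simp [d_oneForm, map_oneForm])) x

theorem natTrace_map (x : FormsTensor R ℒ) :
    natTrace S ℒ (map ℒ f x) = (XOdd.map f).rTensor (GradedAb ℒ) (natTrace R ℒ x) :=
  LinearMap.congr_fun (show natTrace S ℒ ∘ₗ map ℒ f =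
    (XOdd.map f).rTensor (GradedAb ℒ) ∘ₗ natTrace R ℒ from hom_ext_of_mem
    (fun r _ l _ => by simp [natTrace_zeroForm, map_zeroForm])
    (fun η _ l _ => by
      simp only [LinearMap.comp_apply, natTrace_oneForm, map_oneForm, LinearMap.rTensor_tmul]
      rfl)) x

theorem map_ofL (l : L) : map ℒ f (ofL R ℒ l) = ofL S ℒ l := by
  rw [ofL_eq_zeroForm, map_zeroForm, _root_.map_one, ofL_eq_zeroForm]

theorem map_ofDegZero (x : R ⊗[ℂ] L) :
    map ℒ f (ofDegZero R ℒ x) = ofDegZero S ℒ (Algebra.TensorProduct.map f (AlgHom.id ℂ L) x) :=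
  LinearMap.congr_fun (show map ℒ f ∘ₗ ofDegZero R ℒ =
      ofDegZero S ℒ ∘ₗ (Algebra.TensorProduct.map f (AlgHom.id ℂ L)).toLinearMap from
    TensorProduct.ext' fun r l => map_zeroForm f r l) x

section MapGauge

variable (ℒ)
variable {g : R ⊗[ℂ] L} (hg : IsUnit g)

include hg

theorem map_ofDegZero_inverse : map ℒ f (ofDegZero R ℒ (Ring.inverse g)) =
    ofDegZero S ℒ (Ring.inverse (Algebra.TensorProduct.map f (AlgHom.id ℂ L) g)) := by
  obtain ⟨u, rfl⟩ := hg
  rw [map_ofDegZero, Ring.inverse_unit]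
  congr 1
  exact (Ring.inverse_unit (Units.map (Algebra.TensorProduct.map f (AlgHom.id ℂ L)).toMonoidHom
    u)).symm

theorem map_maurerCartan : map ℒ f (maurerCartan ℒ g) =
    maurerCartan ℒ (Algebra.TensorProduct.map f (AlgHom.id ℂ L) g) := by
  rw [maurerCartan, map_mul, map_ofDegZero_inverse ℒ f hg, map_d, map_ofDegZero, maurerCartan]

theorem map_gaugeTransform (D θ : L) : map ℒ f (gaugeTransform ℒ D θ g) =
    gaugeTransform ℒ D θ (Algebra.TensorProduct.map f (AlgHom.id ℂ L) g) := by
  simp only [gaugeTransform, map_add, map_sub, map_mul, map_ofDegZero_inverse ℒ f hg,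
    map_ofDegZero, map_ofL]

theorem map_curvature (D θ : L) (t : ℝ) : map ℒ f (curvature ℒ D θ g t) =
    curvature ℒ D θ (Algebra.TensorProduct.map f (AlgHom.id ℂ L) g) t := by
  have h : map ℒ f (potential ℒ D θ g t) =
      potential ℒ D θ (Algebra.TensorProduct.map f (AlgHom.id ℂ L) g) t := by
    simp only [potential, map_add, map_smul, map_maurerCartan ℒ f hg,
      map_gaugeTransform ℒ f hg, map_ofL]
  simp only [curvature, map_add, map_mul, map_d, h]

end MapGauge

variable (R ℒ) in
/-- The projection `x ⊗ l ↦ x₀ ⊗ ♮ l`, where `x₀` is the component of degree zero of `x`. -/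
def degZeroTrace : FormsTensor R ℒ →ₗ[ℂ] R ⊗[ℂ] GradedAb ℒ :=
  TensorProduct.map (TrivSqZeroExt.fstHom ℂ R (OneForms R)).toLinearMap (gradedTr ℒ) ∘ₗ
    (GradedTensorProduct.of ℂ (truncGrading R) ℒ).symm.toLinearMap

theorem degZeroTrace_zeroForm (r : R) (l : L) :
    degZeroTrace R ℒ (zeroForm ℒ r l) = r ⊗ₜ gradedTr ℒ l := rfl

theorem degZeroTrace_oneForm (η : OneForms R) (l : L) : degZeroTrace R ℒ (oneForm ℒ η l) = 0 := by
  have : degZeroTrace R ℒ (oneForm ℒ η l) = (0 : R) ⊗ₜ gradedTr ℒ l := rfl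
  rw [this, TensorProduct.zero_tmul]

theorem natTrace_d (x : FormsTensor R ℒ) :
    natTrace R ℒ (d R ℒ x) = (natD R).rTensor (GradedAb ℒ) (degZeroTrace R ℒ x) :=
  LinearMap.congr_fun (show natTrace R ℒ ∘ₗ d R ℒ =
    (natD R).rTensor (GradedAb ℒ) ∘ₗ degZeroTrace R ℒ from hom_ext_of_mem
    (fun r _ l _ => by
      simp only [LinearMap.comp_apply, d_zeroForm, natTrace_oneForm, degZeroTrace_zeroForm,
        LinearMap.rTensor_tmul]
      rfl)
    (fun η _ l _ => by simp [d_oneForm, degZeroTrace_oneForm])) x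

theorem degZeroTrace_map (x : FormsTensor R ℒ) : degZeroTrace S ℒ (map ℒ f x) =
    f.toLinearMap.rTensor (GradedAb ℒ) (degZeroTrace R ℒ x) :=
  LinearMap.congr_fun (show degZeroTrace S ℒ ∘ₗ map ℒ f =
    f.toLinearMap.rTensor (GradedAb ℒ) ∘ₗ degZeroTrace R ℒ from hom_ext_of_mem
    (fun r _ l _ => by simp [degZeroTrace_zeroForm, map_zeroForm])
    (fun η _ l _ => by simp [degZeroTrace_oneForm, map_oneForm])) x

/-- The boundary `x dy ↦ [x, y]` for coefficients in `L`; the factor `y + ε y` makes the second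
argument even, so that `♮` identifies the two orders of the product in `L`. -/
theorem bBar_natTrace_mul_d (x y : FormsTensor R ℒ) :
    (bBar R).rTensor (GradedAb ℒ) (natTrace R ℒ (x * d R ℒ (y + parity R ℒ y))) =
      degZeroTrace R ℒ (parity R ℒ x * (y + parity R ℒ y)) -
        degZeroTrace R ℒ ((y + parity R ℒ y) * parity R ℒ x) := by
  have : ((LinearMap.mul ℂ (FormsTensor R ℒ)).compl₂
          (d R ℒ ∘ₗ (LinearMap.id + parity R ℒ))).compr₂
            ((bBar R).rTensor (GradedAb ℒ) ∘ₗ natTrace R ℒ) +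
        ((LinearMap.mul ℂ (FormsTensor R ℒ)).flip.compl₁₂ (parity R ℒ)
          (LinearMap.id + parity R ℒ)).compr₂ (degZeroTrace R ℒ) =
      ((LinearMap.mul ℂ (FormsTensor R ℒ)).compl₁₂ (parity R ℒ)
          (LinearMap.id + parity R ℒ)).compr₂ (degZeroTrace R ℒ) := by
    refine hom_ext₂ ?_ ?_ ?_ ?_ <;> intro a b i j l m hl hm
    · change (bBar R).rTensor (GradedAb ℒ)
          (natTrace R ℒ (zeroForm ℒ a l * d R ℒ (zeroForm ℒ b m + parity R ℒ (zeroForm ℒ b m)))) +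
          degZeroTrace R ℒ ((zeroForm ℒ b m + parity R ℒ (zeroForm ℒ b m)) *
            parity R ℒ (zeroForm ℒ a l)) =
        degZeroTrace R ℒ (parity R ℒ (zeroForm ℒ a l) *
          (zeroForm ℒ b m + parity R ℒ (zeroForm ℒ b m)))
      rw [parity_zeroForm _ hl, parity_zeroForm _ hm]
      rcases zmod_two_cases j with rfl | rfl
      · have hlm : gradedTr ℒ (l * m) = gradedTr ℒ (m * l) := by
          have h := gradedTr_mul_comm hl hm
          rw [paritySign_zero, show 1 + paritySign i + 1 - paritySign i * 1 = 2 by ring] at h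
          exact smul_right_injective _ (two_ne_zero (α := ℂ)) h
        have hb : bBar R ((OneForms.comm R).mkQ (a • OneForms.mk R 1 b)) = a * b - b * a := by
          rw [OneForms.smul_mk, mul_one]
          rfl
        simp only [paritySign_zero, one_smul, map_add, mul_add, add_mul, d_zeroForm,
          mul_smul_comm, smul_mul_assoc, zeroForm_mul_oneForm _ _ hl, zeroForm_mul_zeroForm _ _ hl,
          zeroForm_mul_zeroForm _ _ hm, map_smul, natTrace_oneForm, degZeroTrace_zeroForm,
          LinearMap.rTensor_tmul, hb, hlm, TensorProduct.sub_tmul]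
        module
      · simp
    · change (bBar R).rTensor (GradedAb ℒ)
          (natTrace R ℒ (zeroForm ℒ a l * d R ℒ (oneForm ℒ b m + parity R ℒ (oneForm ℒ b m)))) +
          degZeroTrace R ℒ ((oneForm ℒ b m + parity R ℒ (oneForm ℒ b m)) *
            parity R ℒ (zeroForm ℒ a l)) =
        degZeroTrace R ℒ (parity R ℒ (zeroForm ℒ a l) *
          (oneForm ℒ b m + parity R ℒ (oneForm ℒ b m)))
      simp [parity_zeroForm _ hl, parity_oneForm _ hm, d_oneForm, zeroForm_mul_oneForm _ _ hl,
        oneForm_mul_zeroForm _ _ hm, degZeroTrace_oneForm, mul_add, add_mul]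
    · change (bBar R).rTensor (GradedAb ℒ)
          (natTrace R ℒ (oneForm ℒ a l * d R ℒ (zeroForm ℒ b m + parity R ℒ (zeroForm ℒ b m)))) +
          degZeroTrace R ℒ ((zeroForm ℒ b m + parity R ℒ (zeroForm ℒ b m)) *
            parity R ℒ (oneForm ℒ a l)) =
        degZeroTrace R ℒ (parity R ℒ (oneForm ℒ a l) *
          (zeroForm ℒ b m + parity R ℒ (zeroForm ℒ b m)))
      simp [parity_zeroForm _ hm, parity_oneForm _ hl, d_zeroForm, zeroForm_mul_oneForm _ _ hm,
        oneForm_mul_zeroForm _ _ hl, oneForm_mul_oneForm _ _ hl, degZeroTrace_oneForm, mul_add,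
        add_mul]
    · change (bBar R).rTensor (GradedAb ℒ)
          (natTrace R ℒ (oneForm ℒ a l * d R ℒ (oneForm ℒ b m + parity R ℒ (oneForm ℒ b m)))) +
          degZeroTrace R ℒ ((oneForm ℒ b m + parity R ℒ (oneForm ℒ b m)) *
            parity R ℒ (oneForm ℒ a l)) =
        degZeroTrace R ℒ (parity R ℒ (oneForm ℒ a l) *
          (oneForm ℒ b m + parity R ℒ (oneForm ℒ b m)))
      simp [parity_oneForm _ hl, parity_oneForm _ hm, d_oneForm,
        oneForm_mul_oneForm _ _ hl, oneForm_mul_oneForm _ _ hm, mul_add, add_mul]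
  exact eq_sub_of_add_eq (LinearMap.congr_fun₂ this x y)

/-- The trace of `g⁻¹ dg` is a cycle of the `X`-complex. -/
theorem bBar_natTrace_maurerCartan {g : R ⊗[ℂ] L} (hg : g ∈ evenPart R ℒ) (hu : IsUnit g) :
    (bBar R).rTensor (GradedAb ℒ) (natTrace R ℒ (maurerCartan ℒ g)) = 0 := by
  have h := isGauge_ofDegZero hg hu
  have hi : parity R ℒ (ofDegZero R ℒ (Ring.inverse g)) = ofDegZero R ℒ (Ring.inverse g) := h.ε_inv
  have key := bBar_natTrace_mul_d (ofDegZero R ℒ (Ring.inverse g)) (ofDegZero R ℒ g)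
  rw [hi, parity_ofDegZero hg, ← two_smul ℂ, mul_smul_comm, smul_mul_assoc, h.inv_mul, h.mul_inv,
    sub_self, map_smul, mul_smul_comm, map_smul, map_smul] at key
  exact (smul_eq_zero.1 key).resolve_left two_ne_zero

end FormsTensor

/-! ### The Chern-Simons form of an exponentiable pair -/

theorem map_weakIntegral {Q Q' : Type*} [AddCommGroup Q] [Module ℂ Q] [TopologicalSpace Q]
    [Ring Q'] [Algebra ℂ Q'] [TopologicalSpace Q'] [SeqLCAlgebra Q'] {f : ℝ → Q}
    (hf : IsWeakIntegral f (weakIntegral f)) (m : Q →L[ℂ] Q') :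
    m (weakIntegral f) = weakIntegral fun t => m (f t) :=
  (hf.map m).unique (isWeakIntegral_weakIntegral ⟨_, hf.map m⟩)

theorem map_transgression {Q Q' : Type*} [Ring Q] [Algebra ℂ Q] [TopologicalSpace Q]
    [SeqLCAlgebra Q] [Ring Q'] [Algebra ℂ Q'] [TopologicalSpace Q'] [SeqLCAlgebra Q']
    (m : Q →L[ℂ] Q') (hm : ∀ x y, m (x * y) = m x * m y) (D β N : Q) {E : ℝ → ℝ → Q}
    (hE : Continuous fun p : ℝ × ℝ => E p.1 p.2) :
    m (transgression D β N E) = transgression (m D) (m β) (m N) fun t s => m (E t s) := by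
  have h1 := continuous_transgressionIntegrand hE D β N
  have h2 := continuous_weakIntegral_transgressionIntegrand hE D β N
  have h3 := continuous_weakIntegral_weakIntegral_transgressionIntegrand hE D β N
  rw [transgression, map_weakIntegral (isWeakIntegral_of_continuous h3)]
  refine congrArg weakIntegral (funext fun s => ?_)
  have h2' := h2.comp (by fun_prop : Continuous fun t : ℝ => (s, t))
  refine (map_weakIntegral (isWeakIntegral_of_continuous h2') m).trans ?_
  refine congrArg weakIntegral (funext fun t => ?_)
  have h1' := h1.comp (by fun_prop : Continuous fun v : ℝ => ((s, t), v))
  refine (map_weakIntegral (isWeakIntegral_of_continuous h1') m).trans ?_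
  refine congrArg weakIntegral (funext fun v => ?_)
  simp only [Function.comp_apply, transgressionIntegrand, hm, map_add, map_smul]

namespace FormsTensor

variable {R : Type u} [Ring R] [Algebra ℂ R]
variable {L : Type v} [Ring L] [Algebra ℂ L] {ℒ : ZMod 2 → Submodule ℂ L} [GradedAlgebra ℒ]

theorem projEven_zeroForm (r : R) {j : ZMod 2} {l : L} (hl : l ∈ ℒ j) :
    projEven R ℒ (zeroForm ℒ r l) = ((1 + paritySign j) / 2) • zeroForm ℒ r l :=
  projEven_tmul _ hl

theorem projEven_oneForm (η : OneForms R) {j : ZMod 2} {l : L} (hl : l ∈ ℒ j) :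
    projEven R ℒ (oneForm ℒ η l) = ((1 + paritySign j) / 2) • oneForm ℒ η l :=
  projEven_tmul _ hl

theorem projEven_eq_of_parity {x : FormsTensor R ℒ} (h1 : projOne R ℒ x = x)
    (h2 : parity R ℒ x = -x) : projEven R ℒ x = x := by
  have hc : projOne R ℒ (projEven R ℒ x) = projEven R ℒ (projOne R ℒ x) :=
    LinearMap.congr_fun (show projOne R ℒ ∘ₗ projEven R ℒ = projEven R ℒ ∘ₗ projOne R ℒ from
      hom_ext_of_mem
        (fun r j l hl => by
          simp only [LinearMap.comp_apply, projEven_zeroForm r hl, map_smul, projOne_zeroForm,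
            map_zero, smul_zero])
        (fun η j l hl => by
          simp only [LinearMap.comp_apply, projEven_oneForm η hl, map_smul, projOne_oneForm])) x
  rw [h1] at hc
  simp only [parity, LinearMap.comp_apply, LinearMap.sub_apply, LinearMap.smul_apply,
    LinearMap.id_apply, map_sub, map_smul, hc, h1] at h2
  have h3 : (2 : ℂ) • (x - projEven R ℒ x) = 0 := by
    have h4 := add_eq_zero_iff_eq_neg.2 h2
    rw [← h4]
    module
  rw [eq_comm, ← sub_eq_zero]
  exact (smul_eq_zero.1 h3).resolve_left two_ne_zero

theorem natTrace_projEven_mem (x : FormsTensor R ℒ) : natTrace R ℒ (projEven R ℒ x) ∈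
    LinearMap.range ((gradedTr ℒ ∘ₗ (ℒ 0).subtype).lTensor (XOdd R)) := by
  set W := LinearMap.range ((gradedTr ℒ ∘ₗ (ℒ 0).subtype).lTensor (XOdd R))
  refine (Submodule.Quotient.mk_eq_zero W).1 ?_
  refine LinearMap.congr_fun (show W.mkQ ∘ₗ natTrace R ℒ ∘ₗ projEven R ℒ = 0 from
    hom_ext_of_mem (fun r j l hl => ?_) (fun η j l hl => ?_)) x
  · simp only [LinearMap.comp_apply, projEven_zeroForm r hl, map_smul, natTrace_zeroForm, map_zero,
      smul_zero, LinearMap.zero_apply]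
  · rcases zmod_two_cases j with rfl | rfl
    · simp only [LinearMap.comp_apply, projEven_oneForm η hl, map_smul, natTrace_oneForm]
      have : W.mkQ ((OneForms.comm R).mkQ η ⊗ₜ[ℂ] gradedTr ℒ l) = 0 :=
        (Submodule.Quotient.mk_eq_zero W).2 ⟨(OneForms.comm R).mkQ η ⊗ₜ[ℂ] (⟨l, hl⟩ : ℒ 0), rfl⟩
      rw [this, smul_zero, LinearMap.zero_apply]
    · simp [projEven_oneForm η hl]

section Admissible

variable [TopologicalSpace (FormsTensor R ℒ)]

theorem seqLCAlgebra_of_isAdmissible (h : IsAdmissible R ℒ) : SeqLCAlgebra (FormsTensor R ℒ) :=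
  { h.t2, h.isTopologicalAddGroup, h.continuousSMul, h.locallyConvex with
    tendsto_mul := h.tendsto_mul
    exists_weakIntegral := h.exists_weakIntegral }

theorem isContinuous_tracedForms (h : IsAdmissible R ℒ) : (tracedForms R ℒ).IsContinuous where
  d := h.continuous_d
  P := h.continuous_projOne
  ε := by
    have := h.isTopologicalAddGroup
    have := h.continuousSMul
    have h1 : Continuous fun x => projOne R ℒ x := h.continuous_projOne
    have h2 : Continuous fun x => projEven R ℒ x := h.continuous_projEven
    have h3 := (h2.const_smul (2 : ℂ)).sub continuous_id
    exact h3.sub ((h1.comp h3).const_smul (2 : ℂ))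
  τ := h.isClosed_ker

variable (ℒ) in
/-- The exponentials `e^{-s∇²}` of the curvature at `t`, extended to all real `s` and `t` by their
values at the nearest points of the unit interval. -/
def expCurve (D θ : L) (g : R ⊗[ℂ] L) (t s : ℝ) : FormsTensor R ℒ :=
  expSum (-((Set.projIcc (0 : ℝ) 1 zero_le_one s : ℝ) : ℂ) •
    curvature ℒ D θ g (Set.projIcc (0 : ℝ) 1 zero_le_one t))

variable {D θ : L} {g : R ⊗[ℂ] L}

theorem continuous_expCurve (hexp : Exponentiable ℒ D θ g) :
    Continuous fun p : ℝ × ℝ => expCurve ℒ D θ g p.1 p.2 := by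
  have h : Continuous fun p : ℝ × ℝ => ((Set.projIcc (0 : ℝ) 1 zero_le_one p.2 : ℝ),
      (Set.projIcc (0 : ℝ) 1 zero_le_one p.1 : ℝ)) :=
    ((continuous_subtype_val.comp continuous_projIcc).comp continuous_snd).prodMk
      ((continuous_subtype_val.comp continuous_projIcc).comp continuous_fst)
  have key := hexp.2.comp_continuous h fun p => ⟨Subtype.property _, Subtype.property _⟩
  exact key

theorem tendsto_expCurve (hexp : Exponentiable ℒ D θ g) (t s : ℝ) :
    Tendsto (expPartial (-((Set.projIcc (0 : ℝ) 1 zero_le_one s : ℝ) : ℂ) •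
      curvature ℒ D θ g (Set.projIcc (0 : ℝ) 1 zero_le_one t))) atTop
        (𝓝 (expCurve ℒ D θ g t s)) :=
  tendsto_nhds_limUnder (hexp.1 _ (Subtype.property _) _ (Subtype.property _))

theorem isExpCurve_expCurve (hexp : Exponentiable ℒ D θ g) {t : ℝ} (ht : t ∈ Set.Icc (0 : ℝ) 1) :
    IsExpCurve ((tracedForms R ℒ).curv
      (ofL R ℒ D + (t : ℂ) • (gaugeTransform ℒ D θ g + maurerCartan ℒ g)))
      (expCurve ℒ D θ g t) := by
  have hc := (continuous_expCurve hexp).comp (by fun_prop : Continuous fun s : ℝ => (t, s))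
  refine ⟨hc, fun s hs => ?_⟩
  have key := tendsto_expCurve hexp t s
  rwa [Set.projIcc_of_mem _ hs, Set.projIcc_of_mem _ ht, curvature_eq] at key

theorem muOne_eq {t : ℝ} (ht : t ∈ Set.Icc (0 : ℝ) 1) :
    muOne ℒ D θ g t = projOne R ℒ ((gaugeTransform ℒ D θ g + maurerCartan ℒ g) *
      expCurve ℒ D θ g t 1) := by
  rw [muOne, expCurve, Set.projIcc_of_mem _ ht, Set.projIcc_of_mem _ ⟨zero_le_one, le_rfl⟩,
    add_comm (maurerCartan ℒ g)]
  simp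

theorem isWeakIntegral_muOne (h : IsAdmissible R ℒ) (hexp : Exponentiable ℒ D θ g) :
    IsWeakIntegral (muOne ℒ D θ g) (weakIntegral (muOne ℒ D θ g)) := by
  have := seqLCAlgebra_of_isAdmissible h
  have hE := (continuous_expCurve hexp).comp
    (by fun_prop : Continuous fun t : ℝ => (t, (1 : ℝ)))
  have hP : Continuous (projOne R ℒ) := h.continuous_projOne
  have hc := hP.comp (continuous_curve_mul
    (continuous_const (y := gaugeTransform ℒ D θ g + maurerCartan ℒ g)) hE)
  exact isWeakIntegral_weakIntegral
    ⟨_, (isWeakIntegral_of_continuous hc).congr fun t ht => (muOne_eq ht).symm⟩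

end Admissible

section Gauge

variable {D θ : L} (hD : D ∈ ℒ 1) (hθ : θ ∈ ℒ 1) {g : R ⊗[ℂ] L} (hg : g ∈ evenPart R ℒ)
  (hu : IsUnit g)

include hD hθ hg hu

theorem isPotential_gaugeTransform : (tracedForms R ℒ).IsPotential (ofL R ℒ D)
    (gaugeTransform ℒ D θ g) (maurerCartan ℒ g) :=
  (isGauge_ofDegZero hg hu).isPotential (isOddConstant_ofL hD) (isOddConstant_ofL hθ)

variable [TopologicalSpace (FormsTensor R ℒ)] (h : IsAdmissible R ℒ)
  (hexp : Exponentiable ℒ D θ g)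

include h hexp

theorem projEven_muOne {t : ℝ} (ht : t ∈ Set.Icc (0 : ℝ) 1) :
    projEven R ℒ (muOne ℒ D θ g t) = muOne ℒ D θ g t := by
  have := seqLCAlgebra_of_isAdmissible h
  have hpot := isPotential_gaugeTransform hD hθ hg hu
  have hE : parity R ℒ (expCurve ℒ D θ g t 1) = expCurve ℒ D θ g t 1 :=
    TracedForms.ε_expCurve (isContinuous_tracedForms h).ε (hpot.ε_path t)
      (isExpCurve_expCurve hexp ht) ⟨zero_le_one, le_rfl⟩
  have hβ : parity R ℒ (gaugeTransform ℒ D θ g) = -gaugeTransform ℒ D θ g := hpot.ε_β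
  have hω : parity R ℒ (maurerCartan ℒ g) = -maurerCartan ℒ g := hpot.ε_ω
  have hPP : ∀ x, projOne R ℒ (projOne R ℒ x) = projOne R ℒ x :=
    LinearMap.congr_fun (show projOne R ℒ ∘ₗ projOne R ℒ = projOne R ℒ from
      hom_ext_of_mem (fun _ _ _ _ => by simp [projOne_zeroForm])
        (fun _ _ _ _ => by simp [projOne_oneForm]))
  have hεP : ∀ x, parity R ℒ (projOne R ℒ x) = projOne R ℒ (parity R ℒ x) :=
    LinearMap.congr_fun (show parity R ℒ ∘ₗ projOne R ℒ = projOne R ℒ ∘ₗ parity R ℒ from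
      hom_ext_of_mem (fun _ _ _ hl => by simp [projOne_zeroForm, parity_zeroForm _ hl])
        (fun _ _ _ hl => by simp [projOne_oneForm, parity_oneForm _ hl]))
  rw [muOne_eq ht]
  refine projEven_eq_of_parity (hPP _) ?_
  rw [hεP, parity_mul, hE, map_add, hβ, hω, ← neg_add, neg_mul, map_neg]

/-- The Chern-Simons form has coefficients in the even part of `L`. -/
theorem chernSimons_mem_range : chernSimons ℒ D θ g ∈
    LinearMap.range ((gradedTr ℒ ∘ₗ (ℒ 0).subtype).lTensor (XOdd R)) := by
  have := h.t2
  have := seqLCAlgebra_of_isAdmissible h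
  have hI := isWeakIntegral_muOne h hexp
  have hI2 := (hI.map ⟨projEven R ℒ, h.continuous_projEven⟩).congr
    fun t ht => projEven_muOne hD hθ hg hu h hexp ht
  rw [chernSimons, hI.unique hI2]
  exact natTrace_projEven_mem _

/-- The Chern-Simons form differs from the trace of the Maurer-Cartan form by the boundary of the
component of degree zero of the transgression. -/
theorem chernSimons_eq : chernSimons ℒ D θ g = natTrace R ℒ (maurerCartan ℒ g) +
    (natD R).rTensor (GradedAb ℒ) (-(2⁻¹ : ℂ) • degZeroTrace R ℒ
      (transgression (ofL R ℒ D) (gaugeTransform ℒ D θ g)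
        (gaugeTransform ℒ D θ g + maurerCartan ℒ g) (expCurve ℒ D θ g))) := by
  have := seqLCAlgebra_of_isAdmissible h
  have hpot := isPotential_gaugeTransform hD hθ hg hu
  have hgauge := isGauge_ofDegZero hg hu
  have key := TracedForms.τ_integral_eq (isContinuous_tracedForms h) hpot
    (continuous_expCurve hexp) (fun t ht => isExpCurve_expCurve hexp ht)
    (isOddConstant_ofL hD).P_curv
    (hgauge.P_curv_one (isOddConstant_ofL hD) (isOddConstant_ofL hθ))
    ((isWeakIntegral_muOne h hexp).congr fun t ht => muOne_eq ht)
  change natTrace R ℒ _ = natTrace R ℒ _ - (2⁻¹ : ℂ) • natTrace R ℒ (d R ℒ _) at key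
  rw [chernSimons, key, natTrace_d, map_smul]
  module

end Gauge

section Map

variable {S : Type u} [Ring S] [Algebra ℂ S] (f : R →ₐ[ℂ] S)
  [TopologicalSpace (FormsTensor R ℒ)] [TopologicalSpace (FormsTensor S ℒ)]
  {D θ : L} {g : R ⊗[ℂ] L}

theorem map_expCurve [T2Space (FormsTensor S ℒ)] (hf : Continuous (map ℒ f)) (hu : IsUnit g)
    (hexp : Exponentiable ℒ D θ g)
    (hexp' : Exponentiable ℒ D θ (Algebra.TensorProduct.map f (AlgHom.id ℂ L) g)) (t s : ℝ) :
    map ℒ f (expCurve ℒ D θ g t s) =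
      expCurve ℒ D θ (Algebra.TensorProduct.map f (AlgHom.id ℂ L) g) t s := by
  refine tendsto_nhds_unique ((hf.tendsto _).comp (tendsto_expCurve hexp t s))
    ((tendsto_expCurve hexp' t s).congr fun N => ?_)
  simp only [Function.comp_apply, expPartial, map_sum, map_smul, map_pow, map_curvature ℒ f hu]

theorem map_degZeroTrace_transgression (hR : IsAdmissible R ℒ) (hS : IsAdmissible S ℒ)
    (hf : Continuous (map ℒ f)) (hu : IsUnit g) (hexp : Exponentiable ℒ D θ g)
    (hexp' : Exponentiable ℒ D θ (Algebra.TensorProduct.map f (AlgHom.id ℂ L) g)) :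
    f.toLinearMap.rTensor (GradedAb ℒ) (degZeroTrace R ℒ
      (transgression (ofL R ℒ D) (gaugeTransform ℒ D θ g)
        (gaugeTransform ℒ D θ g + maurerCartan ℒ g) (expCurve ℒ D θ g))) =
    degZeroTrace S ℒ (transgression (ofL S ℒ D)
      (gaugeTransform ℒ D θ (Algebra.TensorProduct.map f (AlgHom.id ℂ L) g))
      (gaugeTransform ℒ D θ (Algebra.TensorProduct.map f (AlgHom.id ℂ L) g) +
        maurerCartan ℒ (Algebra.TensorProduct.map f (AlgHom.id ℂ L) g))
      (expCurve ℒ D θ (Algebra.TensorProduct.map f (AlgHom.id ℂ L) g))) := by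
  have := seqLCAlgebra_of_isAdmissible hR
  have := seqLCAlgebra_of_isAdmissible hS
  rw [← degZeroTrace_map]
  congr 1
  refine (map_transgression (⟨map ℒ f, hf⟩ : FormsTensor R ℒ →L[ℂ] FormsTensor S ℒ) (map_mul f)
    _ _ _ (continuous_expCurve hexp)).trans ?_
  simp only [ContinuousLinearMap.coe_mk', map_add, map_ofL, map_gaugeTransform ℒ f hu,
    map_maurerCartan ℒ f hu, map_expCurve f hf hu hexp hexp']

end Map

end FormsTensor

/-! ### Lifting units along nilpotent extensions -/

/-- Units lift along a homomorphism with nil kernel, for candidates `a` and `b` of the lift and of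
its inverse. -/
theorem isUnit_of_isUnit_map_of_isNilpotent {S T : Type*} [Ring S] [Ring T] (F : S →+* T)
    (hF : ∀ x, F x = 0 → IsNilpotent x) {a b : S} (hab : F (a * b) = 1) (hba : F (b * a) = 1) :
    IsUnit a := by
  have key : ∀ x, F x = 1 → IsUnit x := fun x hx => by
    have := (hF (1 - x) (by rw [map_sub, map_one, hx, sub_self])).isUnit_one_sub
    rwa [sub_sub_cancel] at this
  obtain ⟨u, hu⟩ := key _ hab
  obtain ⟨v, hv⟩ := key _ hba
  have h1 : a * (b * ↑u⁻¹) = 1 := by rw [← mul_assoc, ← hu, Units.mul_inv]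
  have h2 : (↑v⁻¹ * b) * a = 1 := by rw [mul_assoc, ← hv, Units.inv_mul]
  exact ⟨⟨a, b * ↑u⁻¹, h1, by rw [← left_inv_eq_right_inv h2 h1]; exact h2⟩, rfl⟩

section Rn

variable (A : Type u) [Ring A] [Algebra ℂ A]

/-- The projection `R_n → A`. -/
def RnToBase (n : ℕ) : Rn A n →ₐ[ℂ] A :=
  Ideal.Quotient.liftₐ (IA A ^ (n + 1)) (RA.toBase A)
    (fun _ ha => Ideal.pow_le_self n.succ_ne_zero ha)

theorem RA.toBase_incl (a : A) : RA.toBase A (RA.incl A a) = a := by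
  change Forms.aug A (Forms.mk a 1) = a
  simp [Forms.aug_mk]

theorem RnToBase_surjective (n : ℕ) : Function.Surjective (RnToBase A n) :=
  fun a => ⟨Ideal.Quotient.mkₐ ℂ _ (RA.incl A a), RA.toBase_incl A a⟩

theorem RnToBase_RnMap (n : ℕ) (x : Rn A (n + 1)) :
    RnToBase A n (RnMap A n x) = RnToBase A (n + 1) x := by
  obtain ⟨x, rfl⟩ := Ideal.Quotient.mk_surjective x
  rfl

variable (L : Type v) [Ring L] [Algebra ℂ L]

/-- The subspace of `R_n ⊗ L` spanned by the `x ⊗ l` with `x` in the image of `IAᵏ`. -/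
def tensorFiltration (n k : ℕ) : Submodule ℂ (Rn A n ⊗[ℂ] L) :=
  Submodule.span ℂ {x | ∃ r ∈ IA A ^ k, ∃ l : L, x = Ideal.Quotient.mkₐ ℂ (IA A ^ (n + 1)) r ⊗ₜ l}

variable {A L}

theorem mul_mem_tensorFiltration {n j k : ℕ} {x y : Rn A n ⊗[ℂ] L}
    (hx : x ∈ tensorFiltration A L n j) (hy : y ∈ tensorFiltration A L n k) :
    x * y ∈ tensorFiltration A L n (j + k) := by
  induction hx using Submodule.span_induction with
  | zero => rw [zero_mul]; exact zero_mem _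
  | add x x' _ _ h h' => rw [add_mul]; exact add_mem h h'
  | smul c x _ h => rw [smul_mul_assoc]; exact Submodule.smul_mem _ _ h
  | mem x hx =>
    obtain ⟨r, hr, l, rfl⟩ := hx
    induction hy using Submodule.span_induction with
    | zero => rw [mul_zero]; exact zero_mem _
    | add x x' _ _ h h' => rw [mul_add]; exact add_mem h h'
    | smul c x _ h => rw [mul_smul_comm]; exact Submodule.smul_mem _ _ h
    | mem y hy =>
      obtain ⟨s, hs, m, rfl⟩ := hy
      refine Submodule.subset_span ⟨r * s, ?_, l * m, ?_⟩
      · rw [Ideal.IsTwoSided.pow_add]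
        exact Ideal.mul_mem_mul hr hs
      · rw [Algebra.TensorProduct.tmul_mul_tmul, map_mul]

theorem pow_mem_tensorFiltration {n : ℕ} {x : Rn A n ⊗[ℂ] L} (hx : x ∈ tensorFiltration A L n 1)
    (k : ℕ) : x ^ k ∈ tensorFiltration A L n k := by
  induction k with
  | zero =>
    refine Submodule.subset_span ⟨1, ?_, 1, ?_⟩
    · rw [Submodule.pow_zero, Ideal.one_eq_top]
      trivial
    · rw [pow_zero, map_one]
      rfl
  | succ k ih => rw [pow_succ]; exact mul_mem_tensorFiltration ih hx

variable (A L) in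
theorem tensorFiltration_eq_bot (n : ℕ) : tensorFiltration A L n (n + 1) = ⊥ := by
  refine Submodule.span_eq_bot.2 ?_
  rintro _ ⟨r, hr, l, rfl⟩
  have : Ideal.Quotient.mkₐ ℂ (IA A ^ (n + 1)) r = 0 := Ideal.Quotient.eq_zero_iff_mem.2 hr
  rw [this, TensorProduct.zero_tmul]

theorem pow_eq_zero_of_map_RnToBase_eq_zero {n : ℕ} {x : Rn A n ⊗[ℂ] L}
    (hx : Algebra.TensorProduct.map (RnToBase A n) (AlgHom.id ℂ L) x = 0) : x ^ (n + 1) = 0 := by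
  have hex : Function.Exact (LinearMap.ker (RnToBase A n).toLinearMap).subtype
      (RnToBase A n).toLinearMap := LinearMap.exact_subtype_ker_map _
  obtain ⟨y, rfl⟩ := (rTensor_exact L hex (RnToBase_surjective A n) x).1 hx
  suffices h : (LinearMap.ker (RnToBase A n).toLinearMap).subtype.rTensor L y ∈
      tensorFiltration A L n 1 by
    have := pow_mem_tensorFiltration h (n + 1)
    rwa [tensorFiltration_eq_bot] at this
  clear hx
  induction y using TensorProduct.induction_on with
  | zero => rw [map_zero]; exact zero_mem _
  | add y y' hy hy' => rw [map_add]; exact add_mem hy hy'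
  | tmul r l =>
    obtain ⟨r, hr⟩ := r
    obtain ⟨r, rfl⟩ := Ideal.Quotient.mk_surjective r
    exact Submodule.subset_span ⟨r, by rw [Submodule.pow_one]; exact hr, l, rfl⟩

theorem map_RnToBase_liftRn (n : ℕ) (g : A ⊗[ℂ] L) :
    Algebra.TensorProduct.map (RnToBase A n) (AlgHom.id ℂ L) (liftRn A n g) = g :=
  LinearMap.congr_fun (show (Algebra.TensorProduct.map (RnToBase A n)
      (AlgHom.id ℂ L)).toLinearMap ∘ₗ liftRn A n = LinearMap.id from
    TensorProduct.ext' fun a l => congrArg (· ⊗ₜ[ℂ] l) (RA.toBase_incl A a)) g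

theorem map_RnMap_liftRn (n : ℕ) (g : A ⊗[ℂ] L) :
    Algebra.TensorProduct.map (RnMap A n) (AlgHom.id ℂ L) (liftRn A (n + 1) g) = liftRn A n g :=
  LinearMap.congr_fun (show (Algebra.TensorProduct.map (RnMap A n)
      (AlgHom.id ℂ L)).toLinearMap ∘ₗ liftRn A (n + 1) = liftRn A n from
    TensorProduct.ext' fun _ _ => rfl) g

theorem isUnit_liftRn (g : (A ⊗[ℂ] L)ˣ) (n : ℕ) : IsUnit (liftRn A n (g : A ⊗[ℂ] L)) :=
  isUnit_of_isUnit_map_of_isNilpotent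
    (Algebra.TensorProduct.map (RnToBase A n) (AlgHom.id ℂ L)).toRingHom
    (fun _ hx => ⟨n + 1, pow_eq_zero_of_map_RnToBase_eq_zero hx⟩) (b := liftRn A n ((g⁻¹ : _ˣ) : A ⊗[ℂ] L))
    (by
      change Algebra.TensorProduct.map (RnToBase A n) (AlgHom.id ℂ L) _ = 1
      rw [map_mul, map_RnToBase_liftRn, map_RnToBase_liftRn, Units.mul_inv])
    (by
      change Algebra.TensorProduct.map (RnToBase A n) (AlgHom.id ℂ L) _ = 1
      rw [map_mul, map_RnToBase_liftRn, map_RnToBase_liftRn, Units.inv_mul])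

theorem liftRn_mem_evenPart {ℒ : ZMod 2 → Submodule ℂ L} {g : A ⊗[ℂ] L} (hg : g ∈ evenPart A ℒ)
    (n : ℕ) : liftRn A n g ∈ evenPart (Rn A n) ℒ := by
  obtain ⟨y, rfl⟩ := hg
  refine ⟨((Ideal.Quotient.mkₐ ℂ (IA A ^ (n + 1))).toLinearMap ∘ₗ RA.incl A).rTensor (ℒ 0) y, ?_⟩
  exact LinearMap.congr_fun (show (ℒ 0).subtype.lTensor (Rn A n) ∘ₗ
    ((Ideal.Quotient.mkₐ ℂ (IA A ^ (n + 1))).toLinearMap ∘ₗ RA.incl A).rTensor (ℒ 0) =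
      liftRn A n ∘ₗ (ℒ 0).subtype.lTensor A from TensorProduct.ext' fun _ _ => rfl) y

end Rn

/-! ### The class of the Chern-Simons forms -/

theorem XOdd.map_natD {R : Type u} [Ring R] [Algebra ℂ R] {S : Type v} [Ring S] [Algebra ℂ S]
    (f : R →ₐ[ℂ] S) (x : R) : XOdd.map f (natD R x) = natD S (f x) := by
  change (OneForms.comm _).mkQ (OneForms.map f (OneForms.mk _ 1 x)) =
    (OneForms.comm _).mkQ (OneForms.mk _ 1 (f x))
  rw [OneForms.map_mk, map_one]

section LimHomology

variable {E O : ℕ → Type u} [∀ n, AddCommGroup (E n)] [∀ n, Module ℂ (E n)]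
  [∀ n, AddCommGroup (O n)] [∀ n, Module ℂ (O n)]
  {πE : ∀ n, E (n + 1) →ₗ[ℂ] E n} {πO : ∀ n, O (n + 1) →ₗ[ℂ] O n}
  {δ : ∀ n, E n →ₗ[ℂ] O n} {β : ∀ n, O n →ₗ[ℂ] E n}

theorem mem_limCycles {c : ∀ n, O n} (h1 : ∀ n, πO n (c (n + 1)) = c n) (h2 : ∀ n, β n (c n) = 0) :
    c ∈ limCycles πO β :=
  ⟨h1, LinearMap.mem_ker.2 (funext h2)⟩

theorem LimHomology.cls_eq_cls {c c' : ∀ n, O n} {hc : c ∈ limCycles πO β}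
    {hc' : c' ∈ limCycles πO β} {e : ∀ n, E n} (he : ∀ n, πE n (e (n + 1)) = e n)
    (h : ∀ n, c n = c' n + δ n (e n)) :
    LimHomology.cls πE πO δ β c hc = LimHomology.cls πE πO δ β c' hc' := by
  refine (Submodule.Quotient.eq _).2 ⟨e, he, funext fun n => ?_⟩
  change δ n (e n) = c n - c' n
  rw [h n, add_sub_cancel_left]

end LimHomology

section Class

open FormsTensor

variable {A : Type u} [Ring A] [Algebra ℂ A] {L : Type v} [Ring L] [Algebra ℂ L]
  (ℒ : ZMod 2 → Submodule ℂ L) [GradedAlgebra ℒ]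

/-- The traces of the Maurer-Cartan forms of the `g_n` form a cycle of the limit. -/
theorem natTrace_maurerCartan_mem_limCycles (g : (A ⊗[ℂ] L)ˣ)
    (hg : (g : A ⊗[ℂ] L) ∈ evenPart A ℒ) :
    (fun n => natTrace (Rn A n) ℒ (maurerCartan ℒ (liftRn A n (g : A ⊗[ℂ] L)))) ∈
      limCycles (fun n => (XOdd.map (RnMap A n)).rTensor (GradedAb ℒ))
        (fun n => (bBar (Rn A n)).rTensor (GradedAb ℒ)) := by
  refine mem_limCycles (fun n => ?_)
    fun n => bBar_natTrace_maurerCartan (liftRn_mem_evenPart hg n) (isUnit_liftRn g n)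
  rw [← natTrace_map, map_maurerCartan ℒ (RnMap A n) (isUnit_liftRn g (n + 1)), map_RnMap_liftRn]

/-- The class of the traces of the Maurer-Cartan forms `g_n⁻¹ dg_n`, which are the Chern-Simons
forms for `D = θ = 0`. -/
def maurerCartanClass (g : (A ⊗[ℂ] L)ˣ) (hg : (g : A ⊗[ℂ] L) ∈ evenPart A ℒ) :
    HMinus A (GradedAb ℒ) :=
  LimHomology.cls _ _ _ _ _ (natTrace_maurerCartan_mem_limCycles ℒ g hg)

variable [∀ n, TopologicalSpace (FormsTensor (Rn A n) ℒ)] (h : ∀ n, IsAdmissible (Rn A n) ℒ)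
  (hmap : ∀ n, Continuous (FormsTensor.map ℒ (RnMap A n))) {D θ : L} (hD : D ∈ ℒ 1)
  (hθ : θ ∈ ℒ 1) {g : (A ⊗[ℂ] L)ˣ} (hg : (g : A ⊗[ℂ] L) ∈ evenPart A ℒ)
  (hexp : ∀ n, Exponentiable ℒ D θ (liftRn A n (g : A ⊗[ℂ] L)))

include h hmap hD hθ hg hexp

/-- The boundary by which the Chern-Simons forms differ from the traces of the Maurer-Cartan forms
is a boundary in the projective limit. -/
theorem exists_csn_eq : ∃ e : ∀ n, Rn A n ⊗[ℂ] GradedAb ℒ,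
    (∀ n, (RnMap A n).toLinearMap.rTensor (GradedAb ℒ) (e (n + 1)) = e n) ∧
    ∀ n, csn ℒ D θ (g : A ⊗[ℂ] L) n =
      natTrace (Rn A n) ℒ (maurerCartan ℒ (liftRn A n (g : A ⊗[ℂ] L))) +
        (natD (Rn A n)).rTensor (GradedAb ℒ) (e n) := by
  refine ⟨_, fun n => ?_, fun n => chernSimons_eq hD hθ (liftRn_mem_evenPart hg n)
    (isUnit_liftRn g n) (h n) (hexp n)⟩
  have hexp' := hexp n
  rw [← map_RnMap_liftRn] at hexp'
  rw [map_smul, map_degZeroTrace_transgression (RnMap A n) (h (n + 1)) (h n) (hmap n)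
    (isUnit_liftRn g (n + 1)) (hexp (n + 1)) hexp', map_RnMap_liftRn]

theorem csn_mem_limCycles : csn ℒ D θ (g : A ⊗[ℂ] L) ∈
    limCycles (fun n => (XOdd.map (RnMap A n)).rTensor (GradedAb ℒ))
      (fun n => (bBar (Rn A n)).rTensor (GradedAb ℒ)) := by
  obtain ⟨e, he, hcs⟩ := exists_csn_eq ℒ h hmap hD hθ hg hexp
  obtain ⟨h1, h2⟩ := natTrace_maurerCartan_mem_limCycles ℒ g hg
  have hd : ∀ n x, (XOdd.map (RnMap A n)).rTensor (GradedAb ℒ)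
      ((natD (Rn A (n + 1))).rTensor (GradedAb ℒ) x) =
        (natD (Rn A n)).rTensor (GradedAb ℒ) ((RnMap A n).toLinearMap.rTensor (GradedAb ℒ) x) := by
    intro n x
    rw [← LinearMap.rTensor_comp_apply, ← LinearMap.rTensor_comp_apply,
      show XOdd.map (RnMap A n) ∘ₗ natD (Rn A (n + 1)) = natD (Rn A n) ∘ₗ (RnMap A n).toLinearMap
        from LinearMap.ext (XOdd.map_natD _)]
  have hb : ∀ n x, (bBar (Rn A n)).rTensor (GradedAb ℒ)
      ((natD (Rn A n)).rTensor (GradedAb ℒ) x) = 0 := by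
    intro n x
    rw [← LinearMap.rTensor_comp_apply,
      show bBar (Rn A n) ∘ₗ natD (Rn A n) = 0 from LinearMap.ext (bBar_natD _),
      LinearMap.rTensor_zero, LinearMap.zero_apply]
  refine mem_limCycles (fun n => ?_) fun n => ?_
  · rw [hcs, hcs, map_add, hd, he]
    exact congrArg (· + _) (h1 n)
  · rw [hcs, map_add, hb, add_zero]
    exact congrFun (LinearMap.mem_ker.1 h2) n

/-- The class of the Chern-Simons forms of an exponentiable pair is the class of the Maurer-Cartan
forms. -/
theorem cls_csn : LimHomology.cls _ _ _ _ (csn ℒ D θ (g : A ⊗[ℂ] L))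
    (csn_mem_limCycles ℒ h hmap hD hθ hg hexp) = maurerCartanClass ℒ g hg := by
  obtain ⟨e, he, hcs⟩ := exists_csn_eq ℒ h hmap hD hθ hg hexp
  exact LimHomology.cls_eq_cls he hcs

end Class

/-! ### The trace of matrix-valued one-forms -/

section TraceForm

variable {R : Type u} [Ring R] [Algebra ℂ R] {S : Type v} [Ring S] [Algebra ℂ S]

theorem mkQ_mk_mul (x y z : R) : (OneForms.comm R).mkQ (OneForms.mk R x (y * z)) =
    (OneForms.comm R).mkQ (OneForms.mk R (z * x) y) +
      (OneForms.comm R).mkQ (OneForms.mk R (x * y) z) := by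
  have h : OneForms.mk R x (y * z) =
      MulOpposite.op z • OneForms.mk R x y + OneForms.mk R (x * y) z := by
    rw [OneForms.op_smul_def, MulOpposite.unop_op, OneForms.rmul_mk, sub_add_cancel]
  rw [h, map_add, FormsTensor.mkQ_op_smul, OneForms.smul_mk]

/-- The pairing `♮ Tr (X dY)` of matrices. -/
def traceForm {ι : Type*} [Fintype ι] :
    Matrix ι ι R →ₗ[ℂ] Matrix ι ι R →ₗ[ℂ] XOdd R :=
  LinearMap.mk₂ ℂ (fun X Y => ∑ i, ∑ j, (OneForms.comm R).mkQ (OneForms.mk R (X i j) (Y j i)))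
    (fun X X' Y => by simp only [Matrix.add_apply, map_add, LinearMap.add_apply,
      Finset.sum_add_distrib])
    (fun c X Y => by simp only [Matrix.smul_apply, map_smul, LinearMap.smul_apply,
      Finset.smul_sum])
    (fun X Y Y' => by simp only [Matrix.add_apply, map_add, Finset.sum_add_distrib])
    (fun c X Y => by simp only [Matrix.smul_apply, map_smul, Finset.smul_sum])

variable {ι : Type*} [Fintype ι]

theorem traceForm_apply (X Y : Matrix ι ι R) : traceForm X Y =
    ∑ i, ∑ j, (OneForms.comm R).mkQ (OneForms.mk R (X i j) (Y j i)) := rfl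

theorem traceForm_mul (X Y Z : Matrix ι ι R) :
    traceForm X (Y * Z) = traceForm (Z * X) Y + traceForm (X * Y) Z := by
  simp only [traceForm_apply, Matrix.mul_apply, map_sum, mkQ_mk_mul, LinearMap.sum_apply,
    Finset.sum_add_distrib]
  congr 1
  · rw [Finset.sum_comm_cycle]
    exact Finset.sum_congr rfl fun i _ => Finset.sum_comm
  · exact Finset.sum_congr rfl fun i _ => Finset.sum_comm

theorem traceForm_one_right [DecidableEq ι] (X : Matrix ι ι R) : traceForm X 1 = 0 := by
  refine Finset.sum_eq_zero fun i _ => Finset.sum_eq_zero fun j _ => ?_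
  rcases eq_or_ne j i with rfl | h
  · rw [Matrix.one_apply_eq, OneForms.mk_one, map_zero]
  · rw [Matrix.one_apply_ne h, map_zero, map_zero]

theorem natD_trace [DecidableEq ι] (X : Matrix ι ι R) : natD R X.trace = traceForm 1 X := by
  rw [traceForm_apply, Matrix.trace, map_sum]
  refine Finset.sum_congr rfl fun i _ => ?_
  rw [Finset.sum_eq_single i (fun j _ hj => by
    rw [Matrix.one_apply_ne hj.symm, map_zero, LinearMap.zero_apply, map_zero]) (by simp),
    Matrix.one_apply_eq]
  rfl

theorem traceForm_pow_pow_succ [DecidableEq ι] (X : Matrix ι ι R) (i j : ℕ) :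
    traceForm (X ^ i) (X ^ (j + 1)) = ((j : ℂ) + 1) • traceForm (X ^ (i + j)) X := by
  induction j generalizing i with
  | zero => simp
  | succ j ih =>
    rw [pow_succ' X (j + 1), traceForm_mul, ← pow_add, ← pow_succ, ih, add_comm (j + 1) i,
      add_right_comm i 1 j]
    push_cast
    rw [add_assoc i j 1]
    module

theorem XOdd.map_traceForm (f : R →ₐ[ℂ] S) (X Y : Matrix ι ι R) :
    XOdd.map f (traceForm X Y) = traceForm (X.map f) (Y.map f) := by
  simp only [traceForm_apply, map_sum]
  rfl

theorem bBar_traceForm (X Y : Matrix ι ι R) :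
    bBar R (traceForm X Y) = (X * Y).trace - (Y * X).trace := by
  have h : ∀ x y : R, bBar R ((OneForms.comm R).mkQ (OneForms.mk R x y)) = x * y - y * x :=
    fun _ _ => rfl
  simp only [traceForm_apply, map_sum, h, Finset.sum_sub_distrib, Matrix.trace, Matrix.diag_apply,
    Matrix.mul_apply]
  rw [Finset.sum_comm (f := fun i j => Y j i * X i j)]

/-- The logarithm: for `k` nilpotent, `♮ Tr ((1 + k)⁻¹ dk)` is the boundary of
`Tr log (1 + k)`. -/
theorem traceForm_geom_sum [DecidableEq ι] (k : Matrix ι ι R) (m : ℕ) :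
    traceForm (∑ j ∈ Finset.range m, (-k) ^ j) k =
      natD R (∑ j ∈ Finset.range m, ((-1) ^ j / ((j : ℂ) + 1)) • (k ^ (j + 1)).trace) := by
  simp only [map_sum, LinearMap.sum_apply, map_smul]
  refine Finset.sum_congr rfl fun j _ => ?_
  have h := traceForm_pow_pow_succ k 0 j
  rw [pow_zero, zero_add] at h
  have hj : ((j : ℂ) + 1) ≠ 0 := by exact_mod_cast j.succ_ne_zero
  rw [natD_trace, h, smul_smul, div_mul_cancel₀ _ hj, neg_pow k]
  have : ((-1 : Matrix ι ι R) ^ j * k ^ j) = ((-1 : ℂ) ^ j) • k ^ j := by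
    rcases j.even_or_odd with h | h <;> simp [h.neg_one_pow]
  rw [this, map_smul, LinearMap.smul_apply]

variable {N : ℕ}

theorem cartanForm_eq (u : (Matrix (Fin N) (Fin N) R)ˣ) :
    cartanForm u = traceForm ((u⁻¹ : _ˣ) : Matrix (Fin N) (Fin N) R) u := rfl

theorem cartanForm_mul (u v : (Matrix (Fin N) (Fin N) R)ˣ) :
    cartanForm (u * v) = cartanForm u + cartanForm v := by
  rw [cartanForm_eq, Units.val_mul, traceForm_mul, mul_inv_rev, ← Units.val_mul, ← Units.val_mul,
    mul_inv_cancel_left, inv_mul_cancel_right]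
  rfl

theorem bBar_cartanForm (u : (Matrix (Fin N) (Fin N) R)ˣ) : bBar R (cartanForm u) = 0 := by
  rw [cartanForm_eq, bBar_traceForm, Units.inv_mul, Units.mul_inv, sub_self]

theorem XOdd.map_cartanForm (f : R →ₐ[ℂ] S) (u : (Matrix (Fin N) (Fin N) R)ˣ) :
    XOdd.map f (cartanForm u) = cartanForm (Units.map f.mapMatrix.toMonoidHom u) :=
  XOdd.map_traceForm f (u⁻¹ : _ˣ).1 u.1

theorem cartanForm_of_nilpotent (u : (Matrix (Fin N) (Fin N) R)ˣ) {m : ℕ}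
    (h : (u.1 - 1) ^ m = 0) : cartanForm u =
      natD R (∑ j ∈ Finset.range m, ((-1) ^ j / ((j : ℂ) + 1)) • ((u.1 - 1) ^ (j + 1)).trace) := by
  rw [← traceForm_geom_sum, cartanForm_eq]
  have h1 : (∑ j ∈ Finset.range m, (-(u.1 - 1)) ^ j) * u.1 = 1 := by
    have := geom_sum_mul_neg (-(u.1 - 1)) m
    rw [neg_pow, h, mul_zero, sub_zero, sub_neg_eq_add, add_sub_cancel] at this
    exact this
  rw [← Units.inv_eq_of_mul_eq_one_left h1, map_sub, traceForm_one_right, sub_zero]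

theorem traceForm_stab {M : ℕ} (h : N ≤ M) (X Y : Matrix (Fin N) (Fin N) R) :
    traceForm (stab R N M h X) (stab R N M h Y) = traceForm X Y := by
  have hz : ∀ x : R, ∀ i j : Fin M, ¬((i : ℕ) < N ∧ (j : ℕ) < N) →
      (OneForms.comm R).mkQ (OneForms.mk R x (stab R N M h Y i j)) = 0 := by
    intro x i j hij
    have : stab R N M h Y i j = if i = j then 1 else 0 := by simp [stab, hij]
    rw [this]
    split_ifs
    · rw [OneForms.mk_one, map_zero]
    · rw [map_zero, map_zero]
  rw [traceForm_apply, traceForm_apply, eq_comm]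
  refine Fintype.sum_of_injective (Fin.castLE h) (Fin.castLE_injective h) _ _ (fun i hi => ?_)
    fun i => ?_
  · refine Finset.sum_eq_zero fun j _ => hz _ _ _ fun hij => hi ⟨⟨i, hij.2⟩, Fin.ext rfl⟩
  · refine Fintype.sum_of_injective (Fin.castLE h) (Fin.castLE_injective h) _ _ (fun j hj => ?_)
      fun j => ?_
    · exact hz _ _ _ fun hij => hj ⟨⟨j, hij.1⟩, Fin.ext rfl⟩
    · simp [stab]

theorem cartanForm_stabGL {M : ℕ} (h : N ≤ M) (u : (Matrix (Fin N) (Fin N) R)ˣ) :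
    cartanForm (stabGL R N M h u) = cartanForm u :=
  traceForm_stab h _ _

end TraceForm

/-! ### The Cuntz-Quillen Chern character -/

section Completion

variable {A : Type u} [Ring A] [Algebra ℂ A]

theorem RHat.RnMap_proj (n : ℕ) (x : RHat A) :
    RnMap A n (RHat.proj A (n + 1) x) = RHat.proj A n x := x.2 n

theorem RHat.RnToBase_proj (n : ℕ) (x : RHat A) :
    RnToBase A n (RHat.proj A n x) = RHat.toBase A x := by
  induction n with
  | zero => rfl
  | succ n ih => rw [← ih, ← RnToBase_RnMap, RHat.RnMap_proj]

theorem RHat.ext_proj {x y : RHat A} (h : ∀ n, RHat.proj A n x = RHat.proj A n y) : x = y :=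
  Subtype.ext (funext h)

variable (A) in
/-- The inclusion of `A` in the completion of `RA`, as a linear map. -/
def RHat.incl : A →ₗ[ℂ] RHat A where
  toFun a := ⟨fun n => Ideal.Quotient.mkₐ ℂ (IA A ^ (n + 1)) (RA.incl A a), fun _ => rfl⟩
  map_add' a b := Subtype.ext (funext fun n => by simp)
  map_smul' c a := Subtype.ext (funext fun n => by simp)

theorem RHat.toBase_incl (a : A) : RHat.toBase A (RHat.incl A a) = a := RA.toBase_incl A a

variable {N : ℕ}

theorem matrixEquivTensor_symm_tmul_apply {R : Type*} [Ring R] [Algebra ℂ R] (r : R)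
    (M : Matrix (Fin N) (Fin N) ℂ) (i j : Fin N) :
    (matrixEquivTensor (Fin N) ℂ R).symm (r ⊗ₜ M) i j = M i j • r := by
  rw [matrixEquivTensor_apply_symm, Algebra.smul_def, Algebra.commutes]
  rfl

theorem rTensor_matrixEquivTensor {R S : Type*} [Ring R] [Algebra ℂ R] [Ring S] [Algebra ℂ S]
    (f : R →ₗ[ℂ] S) (X : Matrix (Fin N) (Fin N) R) :
    f.rTensor _ (matrixEquivTensor (Fin N) ℂ R X) = matrixEquivTensor (Fin N) ℂ S (X.map f) := by
  obtain ⟨x, rfl⟩ := (matrixEquivTensor (Fin N) ℂ R).symm.surjective X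
  rw [AlgEquiv.apply_symm_apply, eq_comm, ← AlgEquiv.eq_symm_apply]
  induction x using TensorProduct.induction_on with
  | zero => simp
  | add x y hx hy =>
    rw [map_add, map_add, map_add, ← hx, ← hy]
    exact Matrix.map_add _ (map_add f) _ _
  | tmul r M =>
    ext i j
    rw [LinearMap.rTensor_tmul, Matrix.map_apply, matrixEquivTensor_symm_tmul_apply,
      matrixEquivTensor_symm_tmul_apply, map_smul]

theorem pow_eq_zero_of_map_RnToBase_matrix {n : ℕ} {X : Matrix (Fin N) (Fin N) (Rn A n)}
    (hX : X.map (RnToBase A n) = 0) : X ^ (n + 1) = 0 := by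
  apply (matrixEquivTensor (Fin N) ℂ (Rn A n)).injective
  rw [map_pow, map_zero]
  refine pow_eq_zero_of_map_RnToBase_eq_zero
    ((rTensor_matrixEquivTensor (RnToBase A n).toLinearMap X).trans ?_)
  exact (congrArg _ hX).trans (map_zero _)

/-- The image of an invertible matrix under the inclusion of `A` in the completion is
invertible. -/
theorem exists_units_RHat (g : (Matrix (Fin N) (Fin N) A)ˣ) :
    ∃ u : (Matrix (Fin N) (Fin N) (RHat A))ˣ, u.1 = g.1.map (RHat.incl A) ∧
      Units.map (RHat.toBase A).mapMatrix.toMonoidHom u = g := by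
  have hu : ∀ n, IsUnit ((g.1.map (RHat.incl A)).map (RHat.proj A n)) := fun n => by
    have key : ∀ x : Matrix (Fin N) (Fin N) A,
        ((x.map (RHat.incl A)).map (RHat.proj A n)).map (RnToBase A n) = x := fun x => by
      ext i j
      exact RA.toBase_incl A _
    refine isUnit_of_isUnit_map_of_isNilpotent (RnToBase A n).mapMatrix.toRingHom
      (fun X hX => ⟨n + 1, pow_eq_zero_of_map_RnToBase_matrix hX⟩)
      (b := ((g⁻¹ : _ˣ).1.map (RHat.incl A)).map (RHat.proj A n)) ?_ ?_
    · rw [map_mul]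
      exact (congrArg₂ (· * ·) (key _) (key _)).trans g.mul_inv
    · rw [map_mul]
      exact (congrArg₂ (· * ·) (key _) (key _)).trans g.inv_mul
  choose v hv using hu
  have hcompat : ∀ n, Units.map (RnMap A n).mapMatrix.toMonoidHom (v (n + 1)) = v n := fun n => by
    refine Units.ext ?_
    rw [hv]
    change (v (n + 1)).1.map (RnMap A n) = _
    rw [hv]
    rfl
  let w : Matrix (Fin N) (Fin N) (RHat A) := Matrix.of fun i j =>
    ⟨fun n => ((v n)⁻¹ : _ˣ).1 i j, fun n => by
      change RnMap A n (((v (n + 1))⁻¹ : _ˣ).1 i j) = ((v n)⁻¹ : _ˣ).1 i j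
      rw [← hcompat n]
      rfl⟩
  have hext : ∀ {X Y : Matrix (Fin N) (Fin N) (RHat A)},
      (∀ n, X.map (RHat.proj A n) = Y.map (RHat.proj A n)) → X = Y := fun h =>
    Matrix.ext fun i j => RHat.ext_proj fun n => congrFun (congrFun (h n) i) j
  have hw : ∀ n, w.map (RHat.proj A n) = ((v n)⁻¹ : _ˣ).1 := fun n => rfl
  refine ⟨⟨g.1.map (RHat.incl A), w, hext fun n => ?_, hext fun n => ?_⟩, rfl, Units.ext ?_⟩
  · rw [Matrix.map_mul, hw, ← hv, Units.mul_inv]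
    simp
  · rw [Matrix.map_mul, hw, ← hv, Units.inv_mul]
    simp
  · exact Matrix.ext fun i j => RHat.toBase_incl _

end Completion

theorem KOne.exists_eq_cls {A : Type u} [Ring A] (x : KOne A) :
    ∃ (N : ℕ) (g : (Matrix (Fin N) (Fin N) A)ˣ), x = KOne.cls g := by
  obtain ⟨y, hy⟩ := QuotientGroup.mk_surjective (Additive.toMul x)
  obtain ⟨N, g, rfl⟩ := DirectLimit.exists_eq_mk _ y
  exact ⟨N, g, hy.symm⟩

section ChernCharacter

variable {A : Type u} [Ring A] [Algebra ℂ A] {N : ℕ}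

theorem XOdd.map_comp_apply {R S T : Type*} [Ring R] [Algebra ℂ R] [Ring S] [Algebra ℂ S] [Ring T]
    [Algebra ℂ T] (f : S →ₐ[ℂ] T) (g : R →ₐ[ℂ] S) (ξ : XOdd R) :
    XOdd.map f (XOdd.map g ξ) = XOdd.map (f.comp g) ξ := by
  obtain ⟨η, rfl⟩ := (OneForms.comm R).mkQ_surjective ξ
  have : OneForms.map f ∘ₗ OneForms.map g = OneForms.map (f.comp g) :=
    OneForms.hom_ext fun _ _ => rfl
  exact congrArg (OneForms.comm T).mkQ (LinearMap.congr_fun this η)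

theorem bBar_map {R S : Type*} [Ring R] [Algebra ℂ R] [Ring S] [Algebra ℂ S] (f : R →ₐ[ℂ] S)
    (ξ : XOdd R) : bBar S (XOdd.map f ξ) = f (bBar R ξ) := by
  obtain ⟨η, rfl⟩ := (OneForms.comm R).mkQ_surjective ξ
  have : hochschildB S ∘ₗ OneForms.map f = f.toLinearMap ∘ₗ hochschildB R :=
    OneForms.hom_ext fun x y => by simp [OneForms.map_mk, hochschildB_mk]
  exact LinearMap.congr_fun this η

theorem cartanForm_mem_limCycles (u : (Matrix (Fin N) (Fin N) (RHat A))ˣ) :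
    (fun n => XOdd.map (RHat.proj A n) (cartanForm u)) ∈
      limCycles (fun n => XOdd.map (RnMap A n)) (fun n => bBar (Rn A n)) := by
  refine mem_limCycles (fun n => ?_) fun n => ?_
  · rw [XOdd.map_comp_apply,
      show (RnMap A n).comp (RHat.proj A (n + 1)) = RHat.proj A n from
        AlgHom.ext (RHat.RnMap_proj n)]
  · rw [bBar_map, bBar_cartanForm, map_zero]

/-- The class of `♮ Tr (u⁻¹ du)` in `HP₁(A)`. -/
def cartanClass (u : (Matrix (Fin N) (Fin N) (RHat A))ˣ) : HPOne A :=
  LimHomology.cls _ _ _ _ _ (cartanForm_mem_limCycles u)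

theorem cartanClass_mul (u v : (Matrix (Fin N) (Fin N) (RHat A))ˣ) :
    cartanClass (u * v) = cartanClass u + cartanClass v := by
  refine congrArg Submodule.Quotient.mk (Subtype.ext (funext fun n => ?_))
  exact (congrArg (XOdd.map (RHat.proj A n)) (cartanForm_mul u v)).trans
    (map_add (XOdd.map (RHat.proj A n)) _ _)

theorem cartanClass_stabGL {M : ℕ} (h : N ≤ M) (u : (Matrix (Fin N) (Fin N) (RHat A))ˣ) :
    cartanClass (stabGL (RHat A) N M h u) = cartanClass u := by
  refine congrArg Submodule.Quotient.mk (Subtype.ext (funext fun n => ?_))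
  exact congrArg (XOdd.map (RHat.proj A n)) (cartanForm_stabGL h u)

/-- A matrix over the completion which reduces to the identity is unipotent over each `R_n`, so
that its class vanishes: `♮ Tr (u⁻¹ du)` is the boundary of `Tr log u`. -/
theorem cartanClass_eq_zero {u : (Matrix (Fin N) (Fin N) (RHat A))ˣ}
    (hu : Units.map (RHat.toBase A).mapMatrix.toMonoidHom u = 1) : cartanClass u = 0 := by
  let k : ∀ n, Matrix (Fin N) (Fin N) (Rn A n) := fun n => u.1.map (RHat.proj A n) - 1
  have hk : ∀ n, k n ^ (n + 1) = 0 := fun n => by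
    refine pow_eq_zero_of_map_RnToBase_matrix ?_
    ext i j
    have h1 : RHat.toBase A (u.1 i j) = (1 : Matrix (Fin N) (Fin N) A) i j :=
      congrArg (fun v : (Matrix (Fin N) (Fin N) A)ˣ => v.1 i j) hu
    change RnToBase A n (RHat.proj A n (u.1 i j) - (1 : Matrix (Fin N) (Fin N) (Rn A n)) i j) = 0
    rw [map_sub, RHat.RnToBase_proj, h1, sub_eq_zero]
    rcases eq_or_ne i j with rfl | hij
    · simp
    · simp [Matrix.one_apply_ne hij]
  have hkmap : ∀ n, (k (n + 1)).map (RnMap A n) = k n := fun n => by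
    change (RnMap A n).mapMatrix (u.1.map (RHat.proj A (n + 1)) - 1) = _
    rw [map_sub, map_one]
    congr 1
    ext i j
    exact RHat.RnMap_proj n _
  let e : ∀ n, Rn A n := fun n =>
    ∑ j ∈ Finset.range (n + 1), ((-1) ^ j / ((j : ℂ) + 1)) • (k n ^ (j + 1)).trace
  have h0 : (0 : ∀ n, XOdd (Rn A n)) ∈
      limCycles (fun n => XOdd.map (RnMap A n)) (fun n => bBar (Rn A n)) := zero_mem _
  refine (LimHomology.cls_eq_cls (hc' := h0) (e := e) (fun n => ?_) fun n => ?_).trans ?_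
  · have htr : ∀ j, RnMap A n (k (n + 1) ^ j).trace = (k n ^ j).trace := fun j => by
      rw [← hkmap n, ← AlgHom.mapMatrix_apply, ← map_pow]
      exact AddMonoidHom.map_trace (RnMap A n) _
    change RnMap A n (e (n + 1)) = e n
    simp only [e, map_sum, map_smul, htr]
    rw [Finset.sum_range_succ, pow_succ (k n) (n + 1), hk, zero_mul, Matrix.trace_zero, smul_zero,
      add_zero]
  · rw [Pi.zero_apply, zero_add, XOdd.map_cartanForm]
    exact cartanForm_of_nilpotent _ (hk n)
  · exact map_zero (Submodule.mkQ _)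

theorem cartanClass_eq_of_toBase_eq {u v : (Matrix (Fin N) (Fin N) (RHat A))ˣ}
    (h : Units.map (RHat.toBase A).mapMatrix.toMonoidHom u =
      Units.map (RHat.toBase A).mapMatrix.toMonoidHom v) : cartanClass u = cartanClass v := by
  have h1 : cartanClass (v⁻¹ * u) = 0 := cartanClass_eq_zero (by
    rw [map_mul, map_inv, h, inv_mul_cancel])
  rw [← mul_inv_cancel_left v u, cartanClass_mul, h1, add_zero]

/-- The class of `♮ Tr (u⁻¹ du)` for a lift `u` of an invertible matrix over `A`. -/
def chGL (g : (Matrix (Fin N) (Fin N) A)ˣ) : HPOne A := cartanClass (exists_units_RHat g).choose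

theorem chGL_map_toBase (u : (Matrix (Fin N) (Fin N) (RHat A))ˣ) :
    chGL (Units.map (RHat.toBase A).mapMatrix.toMonoidHom u) = cartanClass u :=
  cartanClass_eq_of_toBase_eq (exists_units_RHat _).choose_spec.2

theorem chGL_mul (g h : (Matrix (Fin N) (Fin N) A)ˣ) : chGL (g * h) = chGL g + chGL h := by
  obtain ⟨u, _, rfl⟩ := exists_units_RHat g
  obtain ⟨v, _, rfl⟩ := exists_units_RHat h
  rw [← map_mul, chGL_map_toBase, chGL_map_toBase, chGL_map_toBase, cartanClass_mul]

theorem chGL_stabGL {M : ℕ} (h : N ≤ M) (g : (Matrix (Fin N) (Fin N) A)ˣ) :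
    chGL (stabGL A N M h g) = chGL g := by
  obtain ⟨u, _, rfl⟩ := exists_units_RHat g
  have hs : stabGL A N M h (Units.map (RHat.toBase A).mapMatrix.toMonoidHom u) =
      Units.map (RHat.toBase A).mapMatrix.toMonoidHom (stabGL (RHat A) N M h u) := by
    refine Units.ext (Matrix.ext fun i j => ?_)
    change stab A N M h (u.1.map (RHat.toBase A)) i j =
      RHat.toBase A (stab (RHat A) N M h u.1 i j)
    simp only [stab, MonoidHom.coe_mk, OneHom.coe_mk, Matrix.of_apply, Matrix.map_apply]
    split_ifs <;> simp
  rw [hs, chGL_map_toBase, chGL_map_toBase, cartanClass_stabGL]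

variable (A) in
/-- The Chern character on `GL(A)`. -/
def chGLInf : GLInf A →* Multiplicative (HPOne A) where
  toFun := DirectLimit.lift (stabGL A) (fun _ g => Multiplicative.ofAdd (chGL g))
    (fun _ _ h g => congrArg Multiplicative.ofAdd (chGL_stabGL h g).symm)
  map_one' := by
    rw [DirectLimit.one_def 0]
    refine congrArg Multiplicative.ofAdd ?_
    simpa using chGL_mul (1 : (Matrix (Fin 0) (Fin 0) A)ˣ) 1
  map_mul' := DirectLimit.induction₂ _ fun i x y => by
    rw [DirectLimit.mul_def]
    exact congrArg Multiplicative.ofAdd (chGL_mul x y)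

variable (A) in
/-- The Chern character on `K₁(A)`. -/
def chKOne : KOne A →+ HPOne A := MonoidHom.toAdditiveLeft (Abelianization.lift (chGLInf A))

theorem chKOne_cls (g : (Matrix (Fin N) (Fin N) A)ˣ) : chKOne A (KOne.cls g) = chGL g := rfl

theorem isChernCharacter_iff {ch : KOne A →+ HPOne A} :
    IsChernCharacter ch ↔ ∀ (N : ℕ) (g : (Matrix (Fin N) (Fin N) A)ˣ),
      ch (KOne.cls g) = chGL g := by
  refine ⟨fun h N g => ?_, fun h N u => ⟨cartanForm_mem_limCycles u, ?_⟩⟩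
  · obtain ⟨u, _, rfl⟩ := exists_units_RHat g
    obtain ⟨_, hu⟩ := h N u
    rw [hu, chGL_map_toBase]
    rfl
  · rw [h, chGL_map_toBase]
    rfl

theorem existsUnique_isChernCharacter : ∃! ch : KOne A →+ HPOne A, IsChernCharacter ch := by
  refine ⟨chKOne A, isChernCharacter_iff.2 fun N g => chKOne_cls g, fun ch hch => ?_⟩
  refine AddMonoidHom.ext fun x => ?_
  obtain ⟨N, g, rfl⟩ := KOne.exists_eq_cls x
  rw [isChernCharacter_iff.1 hch, chKOne_cls]

end ChernCharacter

/-! ### Matrix coefficients -/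

section Contract

variable {V : Type v} [AddCommGroup V] [Module ℂ V] {f : V →ₗ[ℂ] ℂ}

theorem contract_bijective (hf : Function.Bijective f) (M : Type u) [AddCommGroup M] [Module ℂ M] :
    Function.Bijective (contract M f) :=
  ((LinearEquiv.lTensor M (LinearEquiv.ofBijective f hf)).trans (TensorProduct.rid ℂ M)).bijective

theorem HMinus.contract_bijective (A : Type u) [Ring A] [Algebra ℂ A] (hf : Function.Bijective f) :
    Function.Bijective (HMinus.contract A f) := by
  constructor
  · refine (injective_iff_map_eq_zero _).2 fun x hx => ?_
    obtain ⟨⟨c, hc⟩, rfl⟩ := Submodule.mkQ_surjective _ x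
    obtain ⟨e, he, hec⟩ := (Submodule.Quotient.mk_eq_zero _).1 hx
    choose e' he' using fun n => (BRS.contract_bijective hf (Rn A n)).2 (e n)
    refine (Submodule.Quotient.mk_eq_zero _).2 ⟨e', fun n => ?_, funext fun n => ?_⟩
    · apply (BRS.contract_bijective hf (Rn A n)).1
      rw [contract_rTensor, he', he']
      exact he n
    · apply (BRS.contract_bijective hf (XOdd (Rn A n))).1
      change BRS.contract _ f ((natD (Rn A n)).rTensor V (e' n)) = _
      rw [contract_rTensor, he']
      exact congrFun hec n
  · intro y
    obtain ⟨⟨c, hc⟩, rfl⟩ := Submodule.mkQ_surjective _ y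
    choose c' hc' using fun n => (BRS.contract_bijective hf (XOdd (Rn A n))).2 (c n)
    have hmem : c' ∈ limCycles (fun n => (XOdd.map (RnMap A n)).rTensor V)
        (fun n => (bBar (Rn A n)).rTensor V) := by
      refine mem_limCycles (fun n => ?_) fun n => ?_
      · apply (BRS.contract_bijective hf (XOdd (Rn A n))).1
        rw [contract_rTensor, hc', hc']
        exact hc.1 n
      · apply (BRS.contract_bijective hf (Rn A n)).1
        rw [contract_rTensor, hc', map_zero]
        exact congrFun (LinearMap.mem_ker.1 hc.2) n
    exact ⟨LimHomology.cls _ _ _ _ c' hmem,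
      congrArg Submodule.Quotient.mk (Subtype.ext (funext hc'))⟩

end Contract

section Matrix

variable {N : ℕ} {ℒ : ZMod 2 → Submodule ℂ (Matrix (Fin N) (Fin N) ℂ)} [GradedAlgebra ℒ]
  (hℒ : ℒ 1 = ⊥)

include hℒ

theorem mem_zero_of_one_eq_bot (x : Matrix (Fin N) (Fin N) ℂ) : x ∈ ℒ 0 := by
  induction x using DirectSum.Decomposition.inductionOn ℒ with
  | zero => exact zero_mem _
  | @homogeneous j x =>
    rcases zmod_two_cases j with rfl | rfl
    · exact x.2
    · rw [(Submodule.mem_bot ℂ).1 (hℒ.le x.2)]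
      exact zero_mem _
  | add x y hx hy => exact add_mem hx hy

theorem gradedTr_mul_comm_of_one_eq_bot (a b : Matrix (Fin N) (Fin N) ℂ) :
    gradedTr ℒ (a * b) = gradedTr ℒ (b * a) := by
  rw [← sub_eq_zero, ← map_sub]
  refine (Submodule.Quotient.mk_eq_zero _).2 (Submodule.subset_span ⟨0, 0, a, b,
    mem_zero_of_one_eq_bot hℒ a, mem_zero_of_one_eq_bot hℒ b, ?_⟩)
  simp

theorem matrixTrace_bijective (hN : 0 < N) : Function.Bijective (matrixTrace ℒ hℒ) := by
  set o : Fin N := ⟨0, hN⟩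
  constructor
  · refine (injective_iff_map_eq_zero _).2 fun x hx => ?_
    obtain ⟨x, rfl⟩ := Submodule.mkQ_surjective _ x
    replace hx : x.trace = 0 := hx
    -- A matrix unit is the product of one ending and one starting at the base index, so it is
    -- equivalent to the product in the reverse order.
    have hs : ∀ i j c, gradedTr ℒ (Matrix.single i j c) =
        if i = j then gradedTr ℒ (Matrix.single o o c) else 0 := fun i j c => by
      have h1 : Matrix.single i j c = Matrix.single i o c * Matrix.single o j (1 : ℂ) := by simp
      rw [h1, gradedTr_mul_comm_of_one_eq_bot hℒ]
      split_ifs with hij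
      · subst hij
        simp
      · rw [Matrix.single_mul_single_of_ne _ _ _ _ (Ne.symm hij), map_zero]
    change gradedTr ℒ x = 0
    have hsum : ∑ i, gradedTr ℒ (Matrix.single o o (x i i)) =
        gradedTr ℒ (Matrix.single o o x.trace) := by
      rw [← map_sum, Matrix.trace]
      congr 1
      exact (map_sum (Matrix.singleLinearMap ℂ o o) _ _).symm
    rw [Matrix.matrix_eq_sum_single x, map_sum]
    refine (Finset.sum_congr rfl fun i _ => (map_sum _ _ _).trans
      ((Finset.sum_congr rfl fun j _ => hs i j _).trans
        (by rw [Finset.sum_ite_eq, if_pos (Finset.mem_univ _)]))).trans ?_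
    rw [hsum, hx, Matrix.single_zero, map_zero]
  · intro c
    exact ⟨gradedTr ℒ (Matrix.single o o c), Matrix.trace_single_eq_same o c⟩

variable (ℒ) in
theorem mem_evenPart_of_one_eq_bot {R : Type u} [Ring R] [Algebra ℂ R]
    (x : R ⊗[ℂ] Matrix (Fin N) (Fin N) ℂ) : x ∈ evenPart R ℒ :=
  LinearMap.mem_range.2 (LinearMap.lTensor_surjective R
    (fun y => ⟨⟨y, mem_zero_of_one_eq_bot hℒ y⟩, rfl⟩) x)

open FormsTensor

variable {R : Type u} [Ring R] [Algebra ℂ R]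

theorem contract_natTrace_mul_d (x y : R ⊗[ℂ] Matrix (Fin N) (Fin N) ℂ) :
    contract (XOdd R) (matrixTrace ℒ hℒ)
      (natTrace R ℒ (ofDegZero R ℒ x * FormsTensor.d R ℒ (ofDegZero R ℒ y))) =
    traceForm ((matrixEquivTensor (Fin N) ℂ R).symm x)
      ((matrixEquivTensor (Fin N) ℂ R).symm y) := by
  induction x using TensorProduct.induction_on with
  | zero => simp
  | add x x' hx hx' => simp only [map_add, add_mul, hx, hx', LinearMap.add_apply]
  | tmul r l =>
    induction y using TensorProduct.induction_on with
    | zero => simp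
    | add y y' hy hy' => simp only [map_add, mul_add, hy, hy']
    | tmul s m =>
      rw [ofDegZero_tmul, ofDegZero_tmul, d_zeroForm,
        zeroForm_mul_oneForm _ _ (mem_zero_of_one_eq_bot hℒ l), paritySign_zero, one_smul,
        natTrace_oneForm, OneForms.smul_mk, mul_one, traceForm_apply]
      have h : contract (XOdd R) (matrixTrace ℒ hℒ)
          ((OneForms.comm R).mkQ (OneForms.mk R r s) ⊗ₜ[ℂ] gradedTr ℒ (l * m)) =
          (l * m).trace • (OneForms.comm R).mkQ (OneForms.mk R r s) := rfl
      rw [h, Matrix.trace, Finset.sum_smul]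
      refine Finset.sum_congr rfl fun i _ => ?_
      rw [Matrix.diag_apply, Matrix.mul_apply, Finset.sum_smul]
      refine Finset.sum_congr rfl fun j _ => ?_
      rw [matrixEquivTensor_symm_tmul_apply, matrixEquivTensor_symm_tmul_apply]
      simp only [map_smul, LinearMap.smul_apply, smul_smul]
      rw [mul_comm]

theorem contract_natTrace_maurerCartan (u : (Matrix (Fin N) (Fin N) R)ˣ) :
    contract (XOdd R) (matrixTrace ℒ hℒ)
      (natTrace R ℒ (maurerCartan ℒ (matrixEquivTensor (Fin N) ℂ R u))) = cartanForm u := by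
  have h : Ring.inverse (matrixEquivTensor (Fin N) ℂ R u) =
      matrixEquivTensor (Fin N) ℂ R (u⁻¹ : _ˣ).1 :=
    Ring.inverse_unit (Units.map (matrixEquivTensor (Fin N) ℂ R).toAlgHom.toMonoidHom u)
  rw [maurerCartan, contract_natTrace_mul_d, h, AlgEquiv.symm_apply_apply,
    AlgEquiv.symm_apply_apply, cartanForm_eq]

end Matrix

section Trivial

open FormsTensor

variable {R : Type u} [Ring R] [Algebra ℂ R]
variable {L : Type v} [Ring L] [Algebra ℂ L] {ℒ : ZMod 2 → Submodule ℂ L} [GradedAlgebra ℒ]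

/-- For `D = θ = 0` the curvature vanishes, since `ω` is closed and `ω² = 0` in degrees at most
one. -/
theorem chernSimons_zero_zero [TopologicalSpace (FormsTensor R ℒ)] (h : IsAdmissible R ℒ)
    {g : R ⊗[ℂ] L} (hg : g ∈ evenPart R ℒ) (hu : IsUnit g) :
    chernSimons ℒ 0 0 g = natTrace R ℒ (maurerCartan ℒ g) := by
  have := seqLCAlgebra_of_isAdmissible h
  have hpot := isPotential_gaugeTransform (ℒ := ℒ) (zero_mem _) (zero_mem _) hg hu
  have hP : projOne R ℒ (maurerCartan ℒ g) = maurerCartan ℒ g := hpot.P_ω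
  have h0 : ofL R ℒ 0 = 0 := by
    rw [ofL_eq_zeroForm, ← ofDegZero_tmul, TensorProduct.tmul_zero, map_zero]
  have hβ : gaugeTransform ℒ 0 0 g = 0 := by simp [gaugeTransform, h0]
  have hd : FormsTensor.d R ℒ (maurerCartan ℒ g) = 0 := by
    rw [← hP]
    exact (tracedForms R ℒ).d_P _
  have hsq : maurerCartan ℒ g * maurerCartan ℒ g = 0 := by
    rw [← hP]
    exact projOne_mul_projOne _ _
  have hcurv : ∀ t, curvature ℒ 0 0 g t = 0 := fun t => by
    simp [curvature, potential, h0, hβ, hd, hsq]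
  have hexp : expSum (0 : FormsTensor R ℒ) = 1 := tendsto_expPartial_zero.limUnder_eq
  have hμ : muOne ℒ 0 0 g = fun _ => maurerCartan ℒ g := funext fun t => by
    rw [muOne, hβ, hcurv, neg_zero, hexp, add_zero, mul_one, hP]
  rw [chernSimons, hμ]
  exact congrArg _ ((isWeakIntegral_weakIntegral ⟨_, isWeakIntegral_const _⟩).unique
    (isWeakIntegral_const (maurerCartan ℒ g)))

end Trivial

section Comparison

open FormsTensor

variable {A : Type u} [Ring A] [Algebra ℂ A] {N : ℕ}
  {ℒ : ZMod 2 → Submodule ℂ (Matrix (Fin N) (Fin N) ℂ)} [GradedAlgebra ℒ] (hℒ : ℒ 1 = ⊥)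

/-- The Maurer-Cartan class and the Chern character are represented by the same lift of `g`. -/
theorem contract_maurerCartanClass (g : (Matrix (Fin N) (Fin N) A)ˣ) :
    HMinus.contract A (matrixTrace ℒ hℒ) (maurerCartanClass ℒ
      (Units.map (matrixEquivTensor (Fin N) ℂ A).toAlgHom.toMonoidHom g)
      (mem_evenPart_of_one_eq_bot ℒ hℒ _)) = chGL g := by
  obtain ⟨u, hu, rfl⟩ := exists_units_RHat g
  rw [chGL_map_toBase]
  refine congrArg Submodule.Quotient.mk (Subtype.ext (funext fun n => ?_))
  have hlift : liftRn A n (matrixEquivTensor (Fin N) ℂ A (u.1.map (RHat.toBase A))) =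
      matrixEquivTensor (Fin N) ℂ (Rn A n) (u.1.map (RHat.proj A n)) := by
    refine (rTensor_matrixEquivTensor _ _).trans (congrArg _ ?_)
    exact (congrArg (fun X : Matrix (Fin N) (Fin N) (RHat A) => X.map (RHat.proj A n)) hu).symm
  change contract _ _ (natTrace _ ℒ (maurerCartan ℒ (liftRn A n (matrixEquivTensor (Fin N) ℂ A
    (u.1.map (RHat.toBase A)))))) = XOdd.map (RHat.proj A n) (cartanForm u)
  rw [hlift, XOdd.map_cartanForm]
  exact contract_natTrace_maurerCartan hℒ
    (Units.map (RHat.proj A n).mapMatrix.toMonoidHom u)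

theorem exists_contract_cls_csn [∀ n, TopologicalSpace (FormsTensor (Rn A n) ℒ)]
    (h : ∀ n, IsAdmissible (Rn A n) ℒ) (g : (Matrix (Fin N) (Fin N) A)ˣ) :
    ∃ hc, HMinus.contract A (matrixTrace ℒ hℒ) (LimHomology.cls _ _ _ _
      (csn ℒ 0 0 (matrixEquivTensor (Fin N) ℂ A (g : Matrix (Fin N) (Fin N) A))) hc) = chGL g := by
  set G := Units.map (matrixEquivTensor (Fin N) ℂ A).toAlgHom.toMonoidHom g
  have hG := mem_evenPart_of_one_eq_bot ℒ hℒ G.1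
  have hcs : csn ℒ 0 0 (matrixEquivTensor (Fin N) ℂ A (g : Matrix (Fin N) (Fin N) A)) =
      fun n => natTrace (Rn A n) ℒ (maurerCartan ℒ (liftRn A n G.1)) :=
    funext fun n => chernSimons_zero_zero (h n) (liftRn_mem_evenPart hG n) (isUnit_liftRn G n)
  rw [hcs]
  exact ⟨natTrace_maurerCartan_mem_limCycles ℒ G hG, contract_maurerCartanClass hℒ g⟩

end Comparison

end BRS

end

theorem mainTheorem2 (A : Type u) [Ring A] [Algebra ℂ A] :
    -- the class of the triple `(D, θ, g)` in `H₋(lim X(R_n) ⊗ L_♮)`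
    (∀ (L : Type v) [Ring L] [Algebra ℂ L] (ℒ : ZMod 2 → Submodule ℂ L) [GradedAlgebra ℒ]
      (g : (A ⊗[ℂ] L)ˣ), (g : A ⊗[ℂ] L) ∈ evenPart A ℒ →
      (∀ n, IsUnit (liftRn A n (g : A ⊗[ℂ] L))) ∧
      ∃ κ : HMinus A (GradedAb ℒ),
        ∀ [∀ n, TopologicalSpace (FormsTensor (Rn A n) ℒ)],
          (∀ n, IsAdmissible (Rn A n) ℒ) →
          (∀ n, Continuous (FormsTensor.map ℒ (RnMap A n))) →
          ∀ D θ : L, D ∈ ℒ 1 → θ ∈ ℒ 1 →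
            (∀ n, Exponentiable ℒ D θ (liftRn A n (g : A ⊗[ℂ] L))) →
            (∀ n, IsWeakIntegral (muOne ℒ D θ (liftRn A n (g : A ⊗[ℂ] L)))
              (weakIntegral (muOne ℒ D θ (liftRn A n (g : A ⊗[ℂ] L))))) ∧
            (∀ n, csn ℒ D θ g n ∈ LinearMap.range
              ((gradedTr ℒ ∘ₗ (ℒ 0).subtype).lTensor (XOdd (Rn A n)))) ∧
            (∀ n, (bBar (Rn A n)).rTensor (GradedAb ℒ) (csn ℒ D θ g n) = 0) ∧
            (∀ n, (XOdd.map (RnMap A n)).rTensor (GradedAb ℒ) (csn ℒ D θ g (n + 1)) =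
              csn ℒ D θ g n) ∧
            ∃ h, LimHomology.cls _ _ _ _ (csn ℒ D θ g) h = κ) ∧
    -- the Cuntz-Quillen Chern character on `K₁(A)`
    (∃! ch : KOne A →+ HPOne A, IsChernCharacter ch) ∧
    -- the case `L = M_N(ℂ)`, `L₋ = 0`
    (∀ ch : KOne A →+ HPOne A, IsChernCharacter ch →
      ∀ (N : ℕ) (ℒ : ZMod 2 → Submodule ℂ (Matrix (Fin N) (Fin N) ℂ)) [GradedAlgebra ℒ]
        (hℒ : ℒ 1 = ⊥),
        (0 < N → Function.Bijective (HMinus.contract A (matrixTrace ℒ hℒ))) ∧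
        ∀ g : (Matrix (Fin N) (Fin N) A)ˣ,
          ∀ [∀ n, TopologicalSpace (FormsTensor (Rn A n) ℒ)],
            (∀ n, IsAdmissible (Rn A n) ℒ) →
            (∀ n, Continuous (FormsTensor.map ℒ (RnMap A n))) →
            ∀ D θ : Matrix (Fin N) (Fin N) ℂ, D ∈ ℒ 1 → θ ∈ ℒ 1 →
              ∃ h, HMinus.contract A (matrixTrace ℒ hℒ)
                (LimHomology.cls _ _ _ _
                  (csn ℒ D θ (matrixEquivTensor (Fin N) ℂ A (g : Matrix (Fin N) (Fin N) A))) h) =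
                ch (KOne.cls g)) := by
  refine ⟨fun L _ _ ℒ _ g hg => ⟨isUnit_liftRn g, maurerCartanClass ℒ g hg, ?_⟩,
    existsUnique_isChernCharacter, fun ch hch N ℒ _ hℒ => ⟨fun hN =>
      HMinus.contract_bijective A (matrixTrace_bijective hℒ hN), ?_⟩⟩
  · intro _ h hmap D θ hD hθ hexp
    have hc := csn_mem_limCycles ℒ h hmap hD hθ hg hexp
    exact ⟨fun n => FormsTensor.isWeakIntegral_muOne (h n) (hexp n),
      fun n => FormsTensor.chernSimons_mem_range hD hθ (liftRn_mem_evenPart hg n)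
        (isUnit_liftRn g n) (h n) (hexp n),
      fun n => congrFun (LinearMap.mem_ker.1 hc.2) n, hc.1, hc,
      cls_csn ℒ h hmap hD hθ hg hexp⟩
  · intro g _ h _ D θ hD hθ
    rw [hℒ, Submodule.mem_bot] at hD hθ
    subst hD hθ
    rw [isChernCharacter_iff.1 hch N g]
    exact exists_contract_cls_csn hℒ h g
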